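/- Let $L$ be a finite alphabet, partitioned into call, return and simple symbols, $L=L_c\cup L_r\cup L_i$, and also into inputs and outputs, $L=L_I\cup L_U$. A (finite) IOVPTS $\mathcal V$ over $L$ has a finite non-empty set of states, a set $V_{in}$ of initial states, a finite stack alphabet $\Gamma$, a bottom symbol $\bot\notin\Gamma$, and a finite set of transitions: push transitions $(p,a,Z,q)$ with $a\in L_c$, $Z\in\Gamma$; pop transitions $(p,a,Z,q)$ with $a\in L_r$, $Z\in\Gamma\cup\{\bot\}$; simple transitions $(p,a,q)$ with $a\in L_i\cup\{\varsigma\}$, where $\varsigma\notin L$ is the internal action. Configurations are pairs $(p,\alpha\bot)$ with $\alpha\in\Gamma^\star$; a push transition pushes $Z$, a pop transition with $Z\in\Gamma$ needs $Z$ on top and removes it, a pop transition with $Z=\bot$ needs $\alpha$ to be empty and leaves it empty, a simple transition leaves the stack unchanged. Write $c\overset{\sigma}{\Rightarrow}d$ ($\sigma\in L^\star$) if some run from $c$ to $d$ is labelled by $\sigma$ after all occurrences of $\varsigma$ are erased. Put $otr(\mathcal V)=\{\sigma : (s,\bot)\overset{\sigma}{\Rightarrow}d \text{ for some } s\in V_{in}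 \text{ and some } d\}$, $c\ \mathrm{after}\ \sigma=\{d : c\overset{\sigma}{\Rightarrow}d\}$ and $out(W)=\{\ell\in L_U : c\overset{\ell}{\Rightarrow}d \text{ for some } c\in W \text{ and some } d\}$. Call $\mathcal V$ deterministic if $(s_1,\bot)\overset{\sigma}{\Rightarrow}d_1$ and $(s_2,\bot)\overset{\sigma}{\Rightarrow}d_2$ with $s_1,s_2\in V_{in}$ imply $d_1=d_2$. For IOVPTSs $\mathcal S,\mathcal I$ over $L$, with initial states $S_{in}$ and $I_{in}$, say that $\mathcal I$ ioco-like $\mathcal S$ if for all $\sigma\in otr(\mathcal S)$, $q_0\in I_{in}$ and $\ell\in out((q_0,\bot)\ \mathrm{after}\ \sigma)$ there is $s_0\in S_{in}$ with $\ell\in out((s_0,\bot)\ \mathrm{after}\ \sigma)$. **Theorem.** There are a procedure and a constant $C$ such that the following holds for every deterministic specification IOVPTS $\mathcal S$ with $n_s$ states and $m_s\ge 1$ transitions, and every IOVPTS $\mathcal I$ over the same alphabet with $n_i$ states and $m_i$ transitions, however states, symbols and transitions are numbered in the input. After at most $$C\,\bigl(n_s^3n_i^3+n_s^2m_s^4m_i^2\bigr)$$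 steps the procedure has decided whether $\mathcal I$ ioco-like $\mathcal S$. If this does not hold, it has within the same number of steps also found a string that proves it, that is, a string $\sigma\ell$ with $\sigma\in otr(\mathcal S)$, $\ell\in L_U$, $\ell\in out((q_0,\bot)\ \mathrm{after}\ \sigma)$ for some $q_0\in I_{in}$, and $\ell\notin out((s_0,\bot)\ \mathrm{after}\ \sigma)$ for all $s_0\in S_{in}$. At that moment the string is stored in the form of a straight-line grammar, in which every nonterminal has one rule, producing the empty word, a letter, or the concatenation of two nonterminals; the procedure then goes on to write the string out symbol by symbol, and halts. (The string may be exponentially long, so the writing out is not covered by the bound.) Here a procedure is a program for a random access machine with unit costs: it has registers and finitely many arrays of natural numbers, with assignment, addition, truncated subtraction, indirect access to the arrays, comparison, conditionals and loops, each instruction and each test costing one step. The input, namely numbered lists of the symbols (with their classes), the initial states and the transitions, together with their sizes, is in the memory at the start. -/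

import Mathlib

/-! ## Visibly pushdown transition systems with inputs and outputs -/

/-- The three classes of a visibly pushdown alphabet: call symbols push, return symbols pop,
simple symbols leave the stack alone. -/
inductive ActionKind
  | call
  | ret
  | simple

inductive Direction
  | input
  | output

/-- An alphabet `L`, partitioned into call, return and simple symbols and, independently, into
input symbols and output symbols. -/
structure IOAlphabet (L : Type*) where
  kind : L → ActionKind
  dir : L → Direction

/-- The possible shapes of a transition, for states `Q`, symbols `L` and stack symbols `Γ`.
In `pop`, `some Z` pops `Z` and `none` stands for the bottom symbol `⊥`.
In `simple`, `some a` reads `a` and `none` stands for the internal action `ς`. -/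
inductive Transition (Q L Γ : Type*)
  | push (p : Q) (a : L) (Z : Γ) (q : Q)
  | pop (p : Q) (a : L) (Z : Option Γ) (q : Q)
  | simple (p : Q) (a : Option L) (q : Q)

namespace Transition

variable {Q L Γ : Type*}

def src : Transition Q L Γ → Q
  | push p _ _ _ => p
  | pop p _ _ _ => p
  | simple p _ _ => p

def tgt : Transition Q L Γ → Q
  | push _ _ _ q => q
  | pop _ _ _ q => q
  | simple _ _ q => q

/-- The action of a transition; `none` is the internal action `ς`. -/
def act : Transition Q L Γ → Option L
  | push _ a _ _ => some a
  | pop _ a _ _ => some a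
  | simple _ a _ => a

/-- A push transition carries a call symbol, a pop transition a return symbol, and a simple
transition a simple symbol or `ς`. -/
def WellFormed (A : IOAlphabet L) : Transition Q L Γ → Prop
  | push _ a _ _ => A.kind a = ActionKind.call
  | pop _ a _ _ => A.kind a = ActionKind.ret
  | simple _ a _ => ∀ b, a = some b → A.kind b = ActionKind.simple

end Transition

/-- An input/output visibly pushdown transition system over the alphabet `A`, with states `Q` and
stack symbols `Γ`. -/
structure IOVPTS {L : Type*} (A : IOAlphabet L) (Q Γ : Type*) where
  init : Finset Q
  trans : Finset (Transition Q L Γ)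
  wellFormed : ∀ t ∈ trans, t.WellFormed A

namespace IOVPTS

variable {L : Type*} {A : IOAlphabet L} {Q Γ Q₁ Γ₁ Q₂ Γ₂ : Type*}

/-- One move between configurations. A configuration `(p, α)` is a state with the stack content
above the bottom symbol, top first. A pop of `⊥` is possible exactly on the empty stack and leaves
it empty. -/
inductive Step (V : IOVPTS A Q Γ) : Q × List Γ → Option L → Q × List Γ → Prop
  | push {p : Q} {a : L} {Z : Γ} {q : Q} (α : List Γ) :
      Transition.push p a Z q ∈ V.trans → Step V (p, α) (some a) (q, Z :: α)
  | pop {p : Q} {a : L} {Z : Γ} {q : Q} (α : List Γ) :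
      Transition.pop p a (some Z) q ∈ V.trans → Step V (p, Z :: α) (some a) (q, α)
  | popBot {p : Q} {a : L} {q : Q} :
      Transition.pop p a none q ∈ V.trans → Step V (p, []) (some a) (q, [])
  | simple {p : Q} {x : Option L} {q : Q} (α : List Γ) :
      Transition.simple p x q ∈ V.trans → Step V (p, α) x (q, α)

/-- Runs, labelled with the sequence of all actions, internal ones included. -/
inductive Run (V : IOVPTS A Q Γ) : Q × List Γ → List (Option L) → Q × List Γ → Prop
  | nil (c : Q × List Γ) : Run V c [] c
  | cons {c d e : Q × List Γ} {x : Option L} {μ : List (Option L)} :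
      V.Step c x d → Run V d μ e → Run V c (x :: μ) e

/-- The observable arrow `c ⇒σ d`: some run from `c` to `d` is labelled with `σ` once all internal
actions are erased. -/
def Observes (V : IOVPTS A Q Γ) (c : Q × List Γ) (σ : List L) (d : Q × List Γ) : Prop :=
  ∃ μ : List (Option L), V.Run c μ d ∧ μ.reduceOption = σ

/-- The set `otr(V)` of observable traces. -/
def otr (V : IOVPTS A Q Γ) : Set (List L) :=
  {σ | ∃ s ∈ V.init, ∃ d, V.Observes (s, []) σ d}

def after (V : IOVPTS A Q Γ) (c : Q × List Γ) (σ : List L) : Set (Q × List Γ) :=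
  {d | V.Observes c σ d}

/-- The output symbols that can be observed next from a configuration in `W`. -/
def out (V : IOVPTS A Q Γ) (W : Set (Q × List Γ)) : Set L :=
  {ℓ | A.dir ℓ = Direction.output ∧ ∃ c ∈ W, ∃ d, V.Observes c [ℓ] d}

/-- At most one configuration is reached by observing a given string from initial
configurations (in particular, by the empty string, there is at most one initial state). -/
def Deterministic (V : IOVPTS A Q Γ) : Prop :=
  ∀ s₁ ∈ V.init, ∀ s₂ ∈ V.init, ∀ (σ : List L) (d₁ d₂ : Q × List Γ),
    V.Observes (s₁, []) σ d₁ → V.Observes (s₂, []) σ d₂ → d₁ = d₂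

/-- `I ioco-like S`. -/
def IocoLike (I : IOVPTS A Q₁ Γ₁) (S : IOVPTS A Q₂ Γ₂) : Prop :=
  ∀ σ ∈ S.otr, ∀ q ∈ I.init, ∀ ℓ ∈ I.out (I.after (q, []) σ),
    ∃ s ∈ S.init, ℓ ∈ S.out (S.after (s, []) σ)

/-- The string `w = σℓ` proves that `I ioco-like S` fails. -/
def IsWitness (I : IOVPTS A Q₁ Γ₁) (S : IOVPTS A Q₂ Γ₂) (w : List L) : Prop :=
  ∃ (σ : List L) (ℓ : L), w = σ ++ [ℓ] ∧ σ ∈ S.otr ∧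
    (∃ q ∈ I.init, ℓ ∈ I.out (I.after (q, []) σ)) ∧
    ∀ s ∈ S.init, ℓ ∉ S.out (S.after (s, []) σ)

end IOVPTS

/-! ## A random access machine with unit costs

Registers and finitely many arrays hold natural numbers. Arithmetic is addition and truncated
subtraction only. Every instruction and every evaluation of a test costs one step. -/

inductive Test
  | eq (x y : ℕ)
  | lt (x y : ℕ)

/-- Programs; `x y z` are names of registers, `a` is the name of an array. -/
inductive Prog
  | skip
  | const (x n : ℕ)
  | move (x y : ℕ)
  | add (x y z : ℕ)
  | sub (x y z : ℕ)
  | load (x a y : ℕ)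
  | store (a x y : ℕ)
  | seq (p q : Prog)
  | ite (b : Test) (p q : Prog)
  | loop (b : Test) (p : Prog)

structure Store where
  reg : ℕ → ℕ
  arr : ℕ → ℕ → ℕ

namespace Store

def setReg (m : Store) (x v : ℕ) : Store :=
  { m with reg := Function.update m.reg x v }

def setArr (m : Store) (a i v : ℕ) : Store :=
  { m with arr := Function.update m.arr a (Function.update (m.arr a) i v) }

end Store

def Test.Holds (m : Store) : Test → Prop
  | Test.eq x y => m.reg x = m.reg y
  | Test.lt x y => m.reg x < m.reg y

/-- `Exec p m t m'`: started in `m`, the program `p` halts in `m'` after exactly `t` steps. -/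
inductive Exec : Prog → Store → ℕ → Store → Prop
  | skip (m : Store) : Exec Prog.skip m 1 m
  | const (m : Store) (x n : ℕ) : Exec (Prog.const x n) m 1 (m.setReg x n)
  | move (m : Store) (x y : ℕ) : Exec (Prog.move x y) m 1 (m.setReg x (m.reg y))
  | add (m : Store) (x y z : ℕ) : Exec (Prog.add x y z) m 1 (m.setReg x (m.reg y + m.reg z))
  | sub (m : Store) (x y z : ℕ) : Exec (Prog.sub x y z) m 1 (m.setReg x (m.reg y - m.reg z))
  | load (m : Store) (x a y : ℕ) : Exec (Prog.load x a y) m 1 (m.setReg x (m.arr a (m.reg y)))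
  | store (m : Store) (a x y : ℕ) :
      Exec (Prog.store a x y) m 1 (m.setArr a (m.reg x) (m.reg y))
  | seq {p q : Prog} {m₁ m₂ m₃ : Store} {t u : ℕ} :
      Exec p m₁ t m₂ → Exec q m₂ u m₃ → Exec (Prog.seq p q) m₁ (t + u) m₃
  | iteTrue {b : Test} {p q : Prog} {m m₁ : Store} {t : ℕ} :
      b.Holds m → Exec p m t m₁ → Exec (Prog.ite b p q) m (t + 1) m₁
  | iteFalse {b : Test} {p q : Prog} {m m₁ : Store} {t : ℕ} :
      ¬ b.Holds m → Exec q m t m₁ → Exec (Prog.ite b p q) m (t + 1) m₁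
  | loopDone {b : Test} {p : Prog} {m : Store} :
      ¬ b.Holds m → Exec (Prog.loop b p) m 1 m
  | loopNext {b : Test} {p : Prog} {m m₁ m₂ : Store} {t u : ℕ} :
      b.Holds m → Exec p m t m₁ → Exec (Prog.loop b p) m₁ u m₂ →
      Exec (Prog.loop b p) m (t + u + 1) m₂

/-- A straight-line grammar stored in the arrays 12, 13, 14, with one rule for every nonterminal
`i`: according to the entry `0`, `1` or `2` of array 12, `i` produces the empty word, the letter in
array 13, or the concatenation of what the nonterminals in arrays 13 and 14 produce.
`m.Derives i w` says that nonterminal `i` produces `w`; there is at most one such `w`. -/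
inductive Store.Derives (m : Store) : ℕ → List ℕ → Prop
  | empty {i : ℕ} : m.arr 12 i = 0 → Derives m i []
  | letter {i : ℕ} : m.arr 12 i = 1 → Derives m i [m.arr 13 i]
  | concat {i : ℕ} {u v : List ℕ} : m.arr 12 i = 2 →
      Derives m (m.arr 13 i) u → Derives m (m.arr 14 i) v → Derives m i (u ++ v)

/-! ## The input of the machine -/

/-- A way of writing a system down: numberings of the states and of the stack symbols, and a list
of the transitions in some order, without repetition. -/
structure IOVPTS.Listing {L : Type*} {A : IOAlphabet L} {Q Γ : Type*} [Fintype Q] [Fintype Γ]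
    (V : IOVPTS A Q Γ) where
  stateNum : Q ≃ Fin (Fintype.card Q)
  stackNum : Γ ≃ Fin (Fintype.card Γ)
  list : List (Transition Q L Γ)
  nodup : list.Nodup
  mem_list : ∀ t, t ∈ list ↔ t ∈ V.trans

def ActionKind.code : ActionKind → ℕ
  | call => 0
  | ret => 1
  | simple => 2

def Direction.code : Direction → ℕ
  | input => 0
  | output => 1

/-- Internal action `0`, the symbol with number `k` is `k + 1`. -/
def actCode {L : Type*} [Fintype L] (e : L ≃ Fin (Fintype.card L)) : Option L → ℕ
  | none => 0
  | some a => (e a : ℕ) + 1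

/-- The stack entry of a transition: `0` for the place-holder of simple transitions, `1` for `⊥`,
and `k + 2` for the stack symbol with number `k`. -/
def stackCode {Q L Γ : Type*} [Fintype Γ] (e : Γ ≃ Fin (Fintype.card Γ)) :
    Transition Q L Γ → ℕ
  | Transition.simple _ _ _ => 0
  | Transition.pop _ _ none _ => 1
  | Transition.pop _ _ (some Z) _ => (e Z : ℕ) + 2
  | Transition.push _ _ Z _ => (e Z : ℕ) + 2

/-- The table with entry `f x` at the position given by the number of `x`, and `0` elsewhere. -/
def numTable {X : Type*} [Fintype X] (e : X ≃ Fin (Fintype.card X)) (f : X → ℕ) (i : ℕ) : ℕ :=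
  if h : i < Fintype.card X then f (e.symm ⟨i, h⟩) else 0

/-- The table with entry `f x` for the `i`-th member `x` of a list, and `0` after its end. -/
def listTable {X : Type*} (l : List X) (f : X → ℕ) (i : ℕ) : ℕ :=
  (l.map f).getD i 0

open Classical in
/-- The initial store for the specification `S` and the implementation `I`. Registers 0 to 3 hold
the numbers of states and transitions of `S` and of `I`, registers 4 to 6 the sizes of the alphabet
and of the two stack alphabets. Arrays 0 and 1 hold kind and direction of every symbol; arrays 2 to
6 hold the initial-state flags of `S` and the sources, actions, stack entries and targets of its
transitions; arrays 7 to 11 do the same for `I`. Everything else is `0`. -/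
noncomputable def inputStore {L Q₁ Γ₁ Q₂ Γ₂ : Type*} [Fintype L] [Fintype Q₁] [Fintype Γ₁]
    [Fintype Q₂] [Fintype Γ₂] {A : IOAlphabet L} {S : IOVPTS A Q₁ Γ₁} {I : IOVPTS A Q₂ Γ₂}
    (e : L ≃ Fin (Fintype.card L)) (lS : S.Listing) (lI : I.Listing) : Store where
  reg
    | 0 => Fintype.card Q₁
    | 1 => S.trans.card
    | 2 => Fintype.card Q₂
    | 3 => I.trans.card
    | 4 => Fintype.card L
    | 5 => Fintype.card Γ₁
    | 6 => Fintype.card Γ₂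
    | _ => 0
  arr
    | 0 => numTable e fun a => (A.kind a).code
    | 1 => numTable e fun a => (A.dir a).code
    | 2 => numTable lS.stateNum fun q => if q ∈ S.init then 1 else 0
    | 3 => listTable lS.list fun t => (lS.stateNum t.src : ℕ)
    | 4 => listTable lS.list fun t => actCode e t.act
    | 5 => listTable lS.list fun t => stackCode lS.stackNum t
    | 6 => listTable lS.list fun t => (lS.stateNum t.tgt : ℕ)
    | 7 => numTable lI.stateNum fun q => if q ∈ I.init then 1 else 0
    | 8 => listTable lI.list fun t => (lI.stateNum t.src : ℕ)
    | 9 => listTable lI.list fun t => actCode e t.act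
    | 10 => listTable lI.list fun t => stackCode lI.stackNum t
    | 11 => listTable lI.list fun t => (lI.stateNum t.tgt : ℕ)
    | _ => fun _ => 0

/-! Since the specification `S` is deterministic, after a trace `σ` it is in at most one
configuration. Hence `S` can run as a monitor beside the implementation `I`, and an output seen
after `σ` is missing in `S` exactly when this one configuration offers no step for it. Both systems
read the same visible word, and the letters alone decide about pushing and popping, so the two
stacks always have equal height and can be zipped into one stack of pairs. The joint behaviour is
therefore a single pushdown system. Its states are the `N = n_s n_i` pairs together with a sink `N`,
which is entered when `I` emits an output that `S` refuses. Conformance fails iff the sink is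
reachable (`IsProduct.witness_of_reads`, `IsProduct.reads_of_not_iocoLike`).

Reachability is decided by saturating a grammar. An item for a pair `(x, y)` of states produces
words of runs from `x` to `y` that never look below their initial stack. Two artificial sources
stand for runs from an initial state: one for those that end with the empty stack, one for those
that end with any stack. A matched push and pop form a rule with body letter, item, letter; an
intermediate item makes it binary. All words produced belong to real runs (`IsClause.sound`).
Conversely, every stack reached by a run splits at its unmatched pushes into segments with derivable
items (`Covered`), so a reachable state has a derivable item (`Reads.derivable`).

The clauses are Horn clauses with two premises, and saturation is linear in their number: each
clause is inspected once for each premise, when that premise leaves a queue (`wp_saturate`). A newly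
found item receives the clause that fired as its only rule; this refers to items found earlier, so
the rules form a straight-line grammar. The grammar gives a word of some run into the sink, and by
soundness any such word is a witness.

For the cost, transitivity contributes about `N ^ 3` clauses. A product transition needs a
transition of `I` together with a transition of `S`, or with a state of `S` and possibly a stack
entry of `S`. With `m_s ≥ 1` their number `T` is at most `3 X` for `X = n_s m_s² m_i`, and testing
refusals by search also costs `O(X)`. Pairs of push and pop contribute at most `2 T ^ 2` clauses,
which gives `O(N ^ 3 + X ^ 2)`, the stated bound (`Store.maxSteps_le`). Alphabets do not enter: only
letters on transitions of `I`, and only stack entries on transitions of `S`, are ever enumerated. -/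

/-! ## A program logic with step counts -/

namespace Prog

/-- The registers a program may write. -/
def regs : Prog → List ℕ
  | skip => []
  | const x _ => [x]
  | move x _ => [x]
  | add x _ _ => [x]
  | sub x _ _ => [x]
  | load x _ _ => [x]
  | store _ _ _ => []
  | seq p q => p.regs ++ q.regs
  | ite _ p q => p.regs ++ q.regs
  | loop _ p => p.regs

/-- The arrays a program may write. -/
def arrs : Prog → List ℕ
  | skip => []
  | const _ _ => []
  | move _ _ => []
  | add _ _ _ => []
  | sub _ _ _ => []
  | load _ _ _ => []
  | store a _ _ => [a]
  | seq p q => p.arrs ++ q.arrs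
  | ite _ p q => p.arrs ++ q.arrs
  | loop _ p => p.arrs

/-- Sequential composition of a list of programs. -/
def block : List Prog → Prog
  | [] => skip
  | [p] => p
  | p :: ps => seq p (block ps)

/-- The result of a loop-free program (loops are ignored). -/
noncomputable def run : Prog → Store → Store
  | skip, m => m
  | const x n, m => m.setReg x n
  | move x y, m => m.setReg x (m.reg y)
  | add x y z, m => m.setReg x (m.reg y + m.reg z)
  | sub x y z, m => m.setReg x (m.reg y - m.reg z)
  | load x a y, m => m.setReg x (m.arr a (m.reg y))
  | store a x y, m => m.setArr a (m.reg x) (m.reg y)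
  | seq p q, m => q.run (p.run m)
  | ite (Test.eq x y) p q, m => if m.reg x = m.reg y then p.run m else q.run m
  | ite (Test.lt x y) p q, m => if m.reg x < m.reg y then p.run m else q.run m
  | loop _ _, m => m

/-- An upper bound for the number of steps of a loop-free program. -/
def cost : Prog → ℕ
  | seq p q => p.cost + q.cost
  | ite _ p q => p.cost + q.cost + 1
  | _ => 1

def LoopFree : Prog → Prop
  | seq p q => p.LoopFree ∧ q.LoopFree
  | ite _ p q => p.LoopFree ∧ q.LoopFree
  | loop _ _ => False
  | _ => True

/-- Loop-free code is total and its result can be computed by `simp`, so rules of a program logic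
are needed only to join pieces and to treat loops. -/
theorem LoopFree.exec {p : Prog} (h : p.LoopFree) (m : Store) :
    ∃ t, Exec p m t (p.run m) ∧ t ≤ p.cost := by
  induction p generalizing m with
  | skip => exact ⟨1, .skip m, le_rfl⟩
  | const x n => exact ⟨1, .const m x n, le_rfl⟩
  | move x y => exact ⟨1, .move m x y, le_rfl⟩
  | add x y z => exact ⟨1, .add m x y z, le_rfl⟩
  | sub x y z => exact ⟨1, .sub m x y z, le_rfl⟩
  | load x a y => exact ⟨1, .load m x a y, le_rfl⟩
  | store a x y => exact ⟨1, .store m a x y, le_rfl⟩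
  | seq p q hp hq =>
    obtain ⟨t, h1, h2⟩ := hp h.1 m
    obtain ⟨u, h3, h4⟩ := hq h.2 (p.run m)
    exact ⟨t + u, .seq h1 h3, Nat.add_le_add h2 h4⟩
  | ite b p q hp hq =>
    obtain ⟨t, h1, h2⟩ := hp h.1 m
    obtain ⟨u, h3, h4⟩ := hq h.2 m
    have key : ∀ (r : Store), (b.Holds m → r = p.run m) → (¬ b.Holds m → r = q.run m) →
        ∃ t, Exec (ite b p q) m t r ∧ t ≤ p.cost + q.cost + 1 := by
      intro r hr1 hr2
      by_cases hb : b.Holds m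
      · exact ⟨t + 1, hr1 hb ▸ .iteTrue hb h1, by omega⟩
      · exact ⟨u + 1, hr2 hb ▸ .iteFalse hb h3, by omega⟩
    cases b with
    | eq x y =>
      exact key _ (fun hb => if_pos hb) (fun hb => if_neg hb)
    | lt x y =>
      exact key _ (fun hb => if_pos hb) (fun hb => if_neg hb)
  | loop b p => exact h.elim

/-- The stores `m` and `m'` differ at most in what `p` may write. -/
structure Frame (p : Prog) (m m' : Store) : Prop where
  reg : ∀ x, x ∉ p.regs → m'.reg x = m.reg x
  arr : ∀ a, a ∉ p.arrs → m'.arr a = m.arr a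

theorem Frame.refl (p : Prog) (m : Store) : Frame p m m := ⟨fun _ _ => rfl, fun _ _ => rfl⟩

theorem Frame.trans {p : Prog} {m₁ m₂ m₃ : Store} (h : Frame p m₁ m₂) (h' : Frame p m₂ m₃) :
    Frame p m₁ m₃ :=
  ⟨fun x hx => (h'.reg x hx).trans (h.reg x hx), fun x hx => (h'.arr x hx).trans (h.arr x hx)⟩

theorem Frame.mono {p q : Prog} {m m' : Store} (h : Frame p m m') (hr : p.regs ⊆ q.regs)
    (ha : p.arrs ⊆ q.arrs) : Frame q m m' :=
  ⟨fun x hx => h.reg x fun h => hx (hr h), fun x hx => h.arr x fun h => hx (ha h)⟩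

/-- What is left untouched can be read off the syntax. Invariants then mention only what changes,
and `decide` on concrete register numbers does the rest. -/
theorem _root_.Exec.frame {p : Prog} {m m' : Store} {t : ℕ} (h : Exec p m t m') :
    Frame p m m' := by
  induction h with
  | skip => exact Frame.refl _ _
  | const m x n =>
    exact ⟨fun y hy => by simp [Store.setReg, Function.update, show y ≠ x by simpa [regs] using hy],
      fun _ _ => rfl⟩
  | move m x =>
    exact ⟨fun y hy => by simp [Store.setReg, Function.update, show y ≠ x by simpa [regs] using hy],
      fun _ _ => rfl⟩
  | add m x =>
    exact ⟨fun y hy => by simp [Store.setReg, Function.update, show y ≠ x by simpa [regs] using hy],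
      fun _ _ => rfl⟩
  | sub m x =>
    exact ⟨fun y hy => by simp [Store.setReg, Function.update, show y ≠ x by simpa [regs] using hy],
      fun _ _ => rfl⟩
  | load m x =>
    exact ⟨fun y hy => by simp [Store.setReg, Function.update, show y ≠ x by simpa [regs] using hy],
      fun _ _ => rfl⟩
  | store m a =>
    exact ⟨fun _ _ => rfl,
      fun y hy => by simp [Store.setArr, Function.update, show y ≠ a by simpa [arrs] using hy]⟩
  | seq _ _ h1 h2 =>
    exact (h1.mono (List.subset_append_left _ _) (List.subset_append_left _ _)).trans
      (h2.mono (List.subset_append_right _ _) (List.subset_append_right _ _))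
  | iteTrue _ _ h1 => exact h1.mono (List.subset_append_left _ _) (List.subset_append_left _ _)
  | iteFalse _ _ h1 => exact h1.mono (List.subset_append_right _ _) (List.subset_append_right _ _)
  | loopDone => exact Frame.refl _ _
  | loopNext _ _ _ h1 h2 =>
    exact (Frame.mono (q := loop _ _) h1 (List.Subset.refl _) (List.Subset.refl _)).trans h2

/-- Started in `m`, the program halts after at most `c` steps in a store with `Q`. -/
def WP (p : Prog) (m : Store) (c : ℕ) (Q : Store → Prop) : Prop :=
  ∃ t m', Exec p m t m' ∧ t ≤ c ∧ Q m'

theorem WP.mono {p : Prog} {m : Store} {c c' : ℕ} {Q Q' : Store → Prop} (h : WP p m c Q)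
    (hc : c ≤ c') (hQ : ∀ m', Frame p m m' → Q m' → Q' m') : WP p m c' Q' := by
  obtain ⟨t, m', h1, h2, h3⟩ := h
  exact ⟨t, m', h1, h2.trans hc, hQ _ h1.frame h3⟩

theorem WP.seq {p q : Prog} {m : Store} {c₁ c₂ : ℕ} {R Q : Store → Prop} (h : WP p m c₁ R)
    (h' : ∀ m', Frame p m m' → R m' → WP q m' c₂ Q) : WP (seq p q) m (c₁ + c₂) Q := by
  obtain ⟨t, m', h1, h2, h3⟩ := h
  obtain ⟨u, m'', h4, h5, h6⟩ := h' m' h1.frame h3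
  exact ⟨t + u, m'', .seq h1 h4, Nat.add_le_add h2 h5, h6⟩

theorem WP.ite {b : Test} {p q : Prog} {m : Store} {c : ℕ} {Q : Store → Prop}
    (h : b.Holds m → WP p m c Q) (h' : ¬ b.Holds m → WP q m c Q) : WP (ite b p q) m (c + 1) Q := by
  by_cases hb : b.Holds m
  · obtain ⟨t, m', h1, h2, h3⟩ := h hb
    exact ⟨t + 1, m', .iteTrue hb h1, by omega, h3⟩
  · obtain ⟨t, m', h1, h2, h3⟩ := h' hb
    exact ⟨t + 1, m', .iteFalse hb h1, by omega, h3⟩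

theorem WP.run {p : Prog} (h : p.LoopFree) {m : Store} {Q : Store → Prop} (hQ : Q (p.run m)) :
    WP p m p.cost Q := by
  obtain ⟨t, h1, h2⟩ := h.exec m
  exact ⟨t, _, h1, h2, hQ⟩

/-- The invariant carries a potential which pays for the steps. -/
theorem WP.loop {b : Test} {p : Prog} (Inv : ℕ → Store → Prop)
    (step : ∀ k m, Inv k m → b.Holds m → ∃ c k', c + 1 + k' ≤ k ∧ WP p m c (Inv k'))
    (k : ℕ) (m : Store) (h : Inv k m) :
    WP (loop b p) m (k + 1) fun m' => (∃ k', Inv k' m') ∧ ¬ b.Holds m' := by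
  induction k using Nat.strong_induction_on generalizing m with
  | _ k ih =>
    by_cases hb : b.Holds m
    · obtain ⟨c, k', hk, t, m', h1, h2, h3⟩ := step k m h hb
      obtain ⟨u, m'', h4, h5, h6⟩ := ih k' (by omega) m' h3
      exact ⟨t + u + 1, m'', .loopNext hb h1 h4, by omega, h6⟩
    · exact ⟨1, m, .loopDone hb, by omega, ⟨k, h⟩, hb⟩

/-- `for x < n`, where register `r` holds `n`; register 8 holds 1. -/
def forLt (x r : ℕ) (p : Prog) : Prog :=
  seq (const x 0) (loop (Test.lt x r) (seq p (add x x 8)))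

/-- A round costs `c` for the body, one step for the increment and one for the test; the final 2 are
the initialisation and the failing test. The counter changes between rounds, so the invariant must
not depend on it. -/
theorem wp_forLt {x r : ℕ} {p : Prog} {m : Store} {n c : ℕ} (Inv : ℕ → Store → Prop)
    (hr : m.reg r = n) (h8 : m.reg 8 = 1) (hx : x ∉ p.regs) (hrp : r ∉ x :: p.regs)
    (h8p : 8 ∉ x :: p.regs)
    (hInv : ∀ i m' v, Inv i m' → Inv i (m'.setReg x v))
    (h0 : Inv 0 m)
    (step : ∀ i < n, ∀ m', m'.reg x = i → Frame (forLt x r p) m m' → Inv i m' →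
      WP p m' c (Inv (i + 1))) :
    WP (forLt x r p) m (n * (c + 2) + 2) (Inv n) := by
  have hreg : (forLt x r p).regs = x :: (p.regs ++ [x]) := rfl
  have hsub : ∀ y, y ∉ x :: p.regs → y ∉ (forLt x r p).regs := by
    intro y hy; rw [hreg]; simp at hy ⊢; tauto
  have harr : (forLt x r p).arrs = p.arrs ++ [] := rfl
  -- The potential is the cost of the rounds still to come.
  have main := WP.loop (b := Test.lt x r) (p := seq p (add x x 8))
    (fun k m' => ∃ i ≤ n, k = (n - i) * (c + 2) ∧ m'.reg x = i ∧ Frame (forLt x r p) m m' ∧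
      Inv i m') (by
    rintro k m' ⟨i, hi, rfl, hxi, hf, hI⟩ hb
    have hrn : m'.reg r = n := (hf.reg r (hsub r hrp)).trans hr
    have hlt : i < n := by simpa [Test.Holds, hxi, hrn] using hb
    refine ⟨c + 1, (n - (i + 1)) * (c + 2), ?_, ?_⟩
    · obtain ⟨d, rfl⟩ := Nat.exists_eq_add_of_lt hlt
      have e1 : i + d + 1 - (i + 1) = d := by omega
      have e2 : i + d + 1 - i = d + 1 := by omega
      rw [e1, e2]; ring_nf; omega
    · refine WP.seq (step i hlt m' hxi hf hI) ?_
      intro m'' hf'' hI''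
      refine ⟨1, _, .add _ _ _ _, le_rfl, i + 1, hlt, rfl, ?_, ?_, hInv _ _ _ hI''⟩
      · have h1 : m''.reg x = i := (hf''.reg x hx).trans hxi
        have h2 : m''.reg 8 = 1 := by
          rw [hf''.reg 8 (fun h => h8p (List.mem_cons_of_mem _ h)), hf.reg 8 (hsub 8 h8p), h8]
        simp [Store.setReg, h1, h2]
      · refine hf.trans ((hf''.mono ?_ ?_).trans (Frame.mono (Exec.frame (.add m'' x x 8)) ?_ ?_))
        · rw [hreg]; intro y hy; simp [hy]
        · rw [harr]; intro y hy; simp [hy]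
        · rw [hreg]; simp [regs]
        · simp [arrs])
    (n * (c + 2)) (m.setReg x 0) ⟨0, Nat.zero_le _, by simp, by simp [Store.setReg],
      (Frame.mono (Exec.frame (.const m x 0)) (by rw [hreg]; simp [regs]) (by simp [arrs])),
      hInv _ _ _ h0⟩
  have := WP.seq (p := const x 0) (m := m) (c₁ := 1) (R := fun m' => m' = m.setReg x 0)
    ⟨1, _, .const m x 0, le_rfl, rfl⟩ (fun m' _ hm' => hm' ▸ main)
  refine WP.mono this (by omega) ?_
  rintro m' - ⟨⟨k, i, hi, -, hxi, hf, hI⟩, hb⟩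
  have hrn : m'.reg r = n := (hf.reg r (hsub r hrp)).trans hr
  have : i = n := by
    simp only [Test.Holds, hxi, hrn] at hb; omega
  exact this ▸ hI

/-! ### Programs that enlarge a set stored in memory -/

/-- A way to store a set together with a bound for the size of its representation, and the
registers and arrays that matter. -/
structure _root_.SetRep (α : Type) where
  rep : (α → Prop) → ℕ → Store → Prop
  regs : List ℕ
  arrs : List ℕ
  local_rep : ∀ P n m m', (∀ x ∈ regs, m'.reg x = m.reg x) → (∀ a ∈ arrs, m'.arr a = m.arr a) →
    rep P n m → rep P n m'
  mono_rep : ∀ P n n' m, n ≤ n' → rep P n m → rep P n' m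

/-- `p` adds the set `G` to the represented set, enlarging the size by at most `d`. -/
def Gen {α : Type} (Φ : SetRep α) (p : Prog) (m : Store) (G : α → Prop) (d c : ℕ) : Prop :=
  ∀ P n, Φ.rep P n m → WP p m c (Φ.rep (fun a => P a ∨ G a) (n + d))

/-- `p` writes nothing that matters to the representation. -/
def Indep {α : Type} (Φ : SetRep α) (p : Prog) : Prop :=
  (∀ x ∈ Φ.regs, x ∉ p.regs) ∧ ∀ x ∈ Φ.arrs, x ∉ p.arrs

theorem Indep.rep {α : Type} {Φ : SetRep α} {p : Prog} (h : Indep Φ p) {m m' : Store}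
    (hf : Frame p m m') {P : α → Prop} {n : ℕ} (hP : Φ.rep P n m) : Φ.rep P n m' :=
  Φ.local_rep P n m m' (fun x hx => hf.reg x (h.1 x hx)) (fun x hx => hf.arr x (h.2 x hx)) hP

section
variable {α : Type} {Φ : SetRep α} {p q : Prog} {m : Store} {G G' : α → Prop} {d d' c c' : ℕ}

/-- `Gen` quantifies over the set already stored, so consecutive programs contribute a union while
sizes and costs add up. -/
theorem Gen.seq (h : Gen Φ p m G d c) (h' : ∀ m', Frame p m m' → Gen Φ q m' G' d' c') :
    Gen Φ (seq p q) m (fun a => G a ∨ G' a) (d + d') (c + c') := by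
  intro P n hP
  refine WP.seq (h P n hP) fun m' hf hm' => ?_
  have := h' m' hf _ _ hm'
  simpa only [or_assoc, add_assoc] using this

theorem Gen.pre {R : Store → Prop} (hp : WP p m c R) (hi : Indep Φ p)
    (h' : ∀ m', Frame p m m' → R m' → Gen Φ q m' G d c') : Gen Φ (Prog.seq p q) m G d (c + c') := by
  intro P n hP
  exact WP.seq hp fun m' hf hm' => h' m' hf hm' P n (hi.rep hf hP)

theorem Gen.skip (hG : ∀ a, ¬ G a) (hc : 1 ≤ c) : Gen Φ skip m G d c := by
  intro P n hP
  have e : (fun a => P a ∨ G a) = P := by funext a; simp [hG]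
  rw [e]
  exact ⟨1, m, .skip m, hc, Φ.mono_rep _ _ _ _ (Nat.le_add_right _ _) hP⟩

theorem Gen.ite {b : Test} (h : b.Holds m → Gen Φ p m G d c) (h' : ¬ b.Holds m → Gen Φ q m G d c) :
    Gen Φ (ite b p q) m G d (c + 1) := fun P n hP =>
  WP.ite (fun hb => h hb P n hP) fun hb => h' hb P n hP

theorem Gen.mono (h : Gen Φ p m G d c) (hd : d ≤ d') (hc : c ≤ c') (hG : ∀ a, G a ↔ G' a) :
    Gen Φ p m G' d' c' := by
  intro P n hP
  refine WP.mono (h P n hP) hc fun m' _ hm' => ?_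
  have e : (fun a => P a ∨ G' a) = fun a => P a ∨ G a := by funext a; simp [hG]
  rw [e]
  exact Φ.mono_rep _ _ _ _ (by omega) hm'

/-- The invariant is that the sets of the earlier rounds have been added. The size `d` per round is
only an upper bound, so rounds that add nothing are allowed. -/
theorem Gen.forLt {x r n : ℕ} {G : ℕ → α → Prop} (hr : m.reg r = n) (h8 : m.reg 8 = 1)
    (hx : x ∉ p.regs) (hrp : r ∉ x :: p.regs) (h8p : 8 ∉ x :: p.regs) (hxΦ : x ∉ Φ.regs)
    (step : ∀ i < n, ∀ m', m'.reg x = i → Frame (forLt x r p) m m' → Gen Φ p m' (G i) d c) :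
    Gen Φ (forLt x r p) m (fun a => ∃ i < n, G i a) (n * d) (n * (c + 2) + 2) := by
  intro P k hP
  refine wp_forLt (fun i => Φ.rep (fun a => P a ∨ ∃ j < i, G j a) (k + i * d)) hr h8 hx hrp h8p
    ?_ ?_ ?_
  · intro i m' v h
    refine Φ.local_rep _ _ m' _ ?_ (fun _ _ => rfl) h
    intro y hy
    have : y ≠ x := fun h => hxΦ (h ▸ hy)
    simp [Store.setReg, this]
  · simpa using hP
  · intro i hi m' hxi hf h
    refine WP.mono (step i hi m' hxi hf _ _ h) le_rfl fun m'' _ hm'' => ?_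
    have e1 : k + (i + 1) * d = k + i * d + d := by ring
    rw [e1]
    convert hm'' using 2
    rw [or_assoc]
    refine or_congr Iff.rfl ?_
    constructor
    · rintro ⟨j, hj, h⟩
      rcases Nat.lt_succ_iff_lt_or_eq.mp hj with hj | hj
      · exact Or.inl ⟨j, hj, h⟩
      · exact Or.inr (hj ▸ h)
    · rintro (⟨j, hj, h⟩ | h)
      · exact ⟨j, by omega, h⟩
      · exact ⟨i, by omega, h⟩

end

end Prog

/-! ### Reading a store after an assignment. -/

@[simp] theorem Store.setReg_reg (m : Store) (x v y : ℕ) :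
    (m.setReg x v).reg y = if y = x then v else m.reg y := by
  simp [Store.setReg, Function.update_apply]

@[simp] theorem Store.setReg_arr (m : Store) (x v : ℕ) : (m.setReg x v).arr = m.arr := rfl

@[simp] theorem Store.setArr_reg (m : Store) (a i v : ℕ) : (m.setArr a i v).reg = m.reg := rfl

@[simp] theorem Store.setArr_arr (m : Store) (a i v b j : ℕ) :
    (m.setArr a i v).arr b j = if b = a ∧ j = i then v else m.arr b j := by
  by_cases hb : b = a
  · subst hb; simp [Store.setArr, Function.update_apply]
  · simp [Store.setArr, hb]

/-! ## Lists of records and of clauses in memory -/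

/-- A transition of a product system: kind, source, target, the item which produces the letter, and
the stack entries of both components. -/
structure Rec where
  kind : ℕ
  src : ℕ
  tgt : ℕ
  lit : ℕ
  zs : ℕ
  zi : ℕ

def Store.recAt (m : Store) (j : ℕ) : Rec :=
  ⟨m.arr 20 j, m.arr 21 j, m.arr 22 j, m.arr 23 j, m.arr 24 j, m.arr 25 j⟩

/-- Records are stored in the arrays 20 to 25, their number in register 15. Array 26 and register
16 hold the multiples of `nn`, starting from `base`. -/
def recRep (base nn : ℕ) : SetRep Rec where
  rep P n m := m.reg 15 ≤ n ∧ m.reg 16 = base + m.reg 15 * nn ∧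
    (∀ r, P r ↔ ∃ j < m.reg 15, m.recAt j = r) ∧ ∀ j < m.reg 15, m.arr 26 j = base + j * nn
  regs := [15, 16]
  arrs := [20, 21, 22, 23, 24, 25, 26]
  local_rep P n m m' hr ha h := by
    simp only [List.forall_mem_cons, List.not_mem_nil, IsEmpty.forall_iff, implies_true,
      and_true] at hr ha
    have e : ∀ j, m'.recAt j = m.recAt j := by
      intro j; simp [Store.recAt, ha]
    simpa only [hr, e, ha] using h
  mono_rep P n n' m hn h := ⟨h.1.trans hn, h.2⟩

/-- Appends the record in the registers 40 to 45. -/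
def addRec : Prog :=
  .block [.store 20 15 40, .store 21 15 41, .store 22 15 42, .store 23 15 43, .store 24 15 44,
    .store 25 15 45, .store 26 15 16, .add 15 15 8, .add 16 16 12]

theorem gen_addRec {base nn : ℕ} {m : Store} {r : Rec} (h8 : m.reg 8 = 1) (h12 : m.reg 12 = nn)
    (h40 : m.reg 40 = r.kind) (h41 : m.reg 41 = r.src) (h42 : m.reg 42 = r.tgt)
    (h43 : m.reg 43 = r.lit) (h44 : m.reg 44 = r.zs) (h45 : m.reg 45 = r.zi) :
    Prog.Gen (recRep base nn) addRec m (fun a => a = r) 1 9 := by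
  rintro P n ⟨h1, h2, h3, h4⟩
  refine Prog.WP.run (p := addRec) (by simp [addRec, Prog.block, Prog.LoopFree]) ?_
  have e15 : (addRec.run m).reg 15 = m.reg 15 + 1 := by simp [addRec, Prog.block, Prog.run, h8]
  have eold : ∀ j < m.reg 15, (addRec.run m).recAt j = m.recAt j := by
    intro j hj
    simp [addRec, Prog.block, Prog.run, Store.recAt, hj.ne]
  have enew : (addRec.run m).recAt (m.reg 15) = r := by
    simp [addRec, Prog.block, Prog.run, Store.recAt, h40, h41, h42, h43, h44, h45]
  refine ⟨by omega, ?_, fun a => ?_, fun j hj => ?_⟩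
  · rw [e15]; simp [addRec, Prog.block, Prog.run, h2, h12]; ring
  · rw [e15]
    change (P a ∨ a = r) ↔ _
    rw [h3]
    constructor
    · rintro (⟨j, hj, rfl⟩ | rfl)
      · exact ⟨j, by omega, eold j hj⟩
      · exact ⟨_, by omega, enew⟩
    · rintro ⟨j, hj, rfl⟩
      rcases Nat.lt_succ_iff_lt_or_eq.mp hj with hj | rfl
      · exact Or.inl ⟨j, hj, (eold j hj).symm⟩
      · exact Or.inr enew
  · rw [e15] at hj
    rcases Nat.lt_succ_iff_lt_or_eq.mp hj with hj | rfl
    · rw [← h4 j hj]; simp [addRec, Prog.block, Prog.run, hj.ne]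
    · rw [← h2]; simp [addRec, Prog.block, Prog.run]

/-- The rule that the item `head` produces the concatenation of what `left` and `right` produce. -/
structure Clause where
  head : ℕ
  left : ℕ
  right : ℕ

/-- From the entry `p` on, the linked list in memory holds the clauses of a list. -/
def Store.Chain (m : Store) (k : ℕ) : ℕ → List Clause → Prop
  | p, [] => p = 0
  | p, c :: l => 0 < p ∧ p ≤ k ∧ m.arr 27 p = c.head ∧ m.arr 28 p = c.left ∧ m.arr 29 p = c.right ∧
      m.Chain k (m.arr 30 p) l

/-- A chain visits only positions up to `k`. Hence the chains of all items can share the same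
arrays, and an entry written beyond `k` disturbs none of them. -/
theorem Store.Chain.congr {m m' : Store} {k k' p : ℕ} {l : List Clause} (h : m.Chain k p l)
    (hk : k ≤ k') (e : ∀ j ≤ k, m'.arr 27 j = m.arr 27 j ∧ m'.arr 28 j = m.arr 28 j ∧
      m'.arr 29 j = m.arr 29 j ∧ m'.arr 30 j = m.arr 30 j) : m'.Chain k' p l := by
  induction l generalizing p with
  | nil => exact h
  | cons c l ih =>
    obtain ⟨h1, h2, h3, h4, h5, h6⟩ := h
    obtain ⟨e1, e2, e3, e4⟩ := e p h2
    refine ⟨h1, h2.trans hk, e1.trans h3, e2.trans h4, e3.trans h5, ?_⟩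
    rw [e4]
    exact ih h6

/-- The clauses of a list in which an item is needed, with multiplicity. -/
def users (E : List Clause) (i : ℕ) : List Clause :=
  E.flatMap fun c => (if c.right = i then [c] else []) ++ if c.left = i then [c] else []

theorem mem_users {E : List Clause} {i : ℕ} {c : Clause} :
    c ∈ users E i ↔ c ∈ E ∧ (c.left = i ∨ c.right = i) := by
  simp only [users, List.mem_flatMap, List.mem_append]
  constructor
  · rintro ⟨d, hd, h | h⟩
    · split_ifs at h with hi
      · rw [List.mem_singleton] at h; subst h; exact ⟨hd, Or.inr hi⟩
      · simp at h
    · split_ifs at h with hi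
      · rw [List.mem_singleton] at h; subst h; exact ⟨hd, Or.inl hi⟩
      · simp at h
  · rintro ⟨hc, h | h⟩
    · exact ⟨c, hc, Or.inr (by simp [h])⟩
    · exact ⟨c, hc, Or.inl (by simp [h])⟩

/-- A clause has two premises, and each equals at most one member of a list without repetition. This
is the charging argument behind linear-time saturation. -/
theorem sum_length_users (E : List Clause) {q : List ℕ} (hq : q.Nodup) :
    (q.map fun i => (users E i).length).sum ≤ 2 * E.length := by
  induction E with
  | nil => simp [users]
  | cons c E ih =>
    have key : ∀ a : ℕ, (q.map fun i => (if a = i then [c] else []).length).sum ≤ 1 := by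
      intro a
      have : (q.map fun i => (if a = i then [c] else []).length).sum = q.count a := by
        clear hq ih
        induction q with
        | nil => rfl
        | cons i q ih =>
          rw [List.map_cons, List.sum_cons, ih, List.count_cons]
          by_cases h : a = i
          · simp [h, add_comm]
          · simp [h, Ne.symm h]
      rw [this]
      exact List.nodup_iff_count_le_one.mp hq a
    have e : (q.map fun i => (users (c :: E) i).length) = q.map fun i =>
        ((if c.right = i then [c] else []).length + (if c.left = i then [c] else []).length) +
          (users E i).length := by
      refine List.map_congr_left fun i _ => ?_
      simp only [users, List.flatMap_cons, List.length_append]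
    rw [e, List.sum_map_add, List.sum_map_add, List.length_cons]
    have := key c.right
    have := key c.left
    omega

/-- Clauses are stored in the arrays 27 to 29, and array 31 holds for every item the start of a list,
linked by array 30, of the clauses that need it. -/
def clauseRep : SetRep Clause where
  rep P n m := ∃ E : List Clause, (∀ c, P c ↔ c ∈ E) ∧ E.length ≤ n ∧
    ∀ i, m.Chain (m.reg 14) (m.arr 31 i) (users E i)
  regs := [14]
  arrs := [27, 28, 29, 30, 31]
  local_rep P n m m' hr ha h := by
    simp only [List.forall_mem_cons, List.not_mem_nil, IsEmpty.forall_iff, implies_true,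
      and_true] at hr ha
    obtain ⟨E, h1, h2, h3⟩ := h
    refine ⟨E, h1, h2, fun i => ?_⟩
    rw [hr, ha.2.2.2.2]
    exact (h3 i).congr le_rfl (by simp [ha])
  mono_rep P n n' m hn := by
    rintro ⟨E, h1, h2, h3⟩
    exact ⟨E, h1, h2.trans hn, h3⟩

/-- Adds the clause in the registers 50 to 52 to the list of the item in register `w`. -/
def link (w : ℕ) : Prog :=
  .block [.add 14 14 8, .store 27 14 50, .store 28 14 51, .store 29 14 52, .load 53 31 w,
    .store 30 14 53, .store 31 w 14]

/-- The counter in register 14 is advanced before the entry is written. Thus position 0 remains free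
as end marker, and the new entry lies beyond all older chains. -/
theorem wp_link {w : ℕ} {m : Store} {c : Clause} (h8 : m.reg 8 = 1) (h50 : m.reg 50 = c.head)
    (h51 : m.reg 51 = c.left) (h52 : m.reg 52 = c.right) (hw : w ≠ 14 ∧ w ≠ 53)
    {U : ℕ → List Clause} (h : ∀ i, m.Chain (m.reg 14) (m.arr 31 i) (U i)) :
    Prog.WP (link w) m 7 fun m' => ∀ i, m'.Chain (m'.reg 14) (m'.arr 31 i)
      ((if m.reg w = i then [c] else []) ++ U i) := by
  refine Prog.WP.run (p := link w) (by simp [link, Prog.block, Prog.LoopFree]) fun i => ?_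
  have e14 : ((link w).run m).reg 14 = m.reg 14 + 1 := by simp [link, Prog.block, Prog.run, h8]
  have hold : ((link w).run m).Chain (m.reg 14 + 1) (m.arr 31 i) (U i) := by
    refine (h i).congr (Nat.le_succ _) fun j hj => ?_
    have : j ≠ m.reg 14 + 1 := by omega
    simp [link, Prog.block, Prog.run, h8, this]
  rw [e14]
  by_cases hi : m.reg w = i
  · subst hi
    have e31 : ((link w).run m).arr 31 (m.reg w) = m.reg 14 + 1 := by
      simp [link, Prog.block, Prog.run, h8, hw]
    have e30 : ((link w).run m).arr 30 (m.reg 14 + 1) = m.arr 31 (m.reg w) := by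
      simp [link, Prog.block, Prog.run, h8, hw]
    rw [if_pos rfl, e31]
    refine ⟨Nat.succ_pos _, le_rfl, ?_, ?_, ?_, ?_⟩
    · simp [link, Prog.block, Prog.run, h8, h50]
    · simp [link, Prog.block, Prog.run, h8, h51]
    · simp [link, Prog.block, Prog.run, h8, h52]
    · rw [e30]; exact hold
  · have e31 : ((link w).run m).arr 31 i = m.arr 31 i := by
      simp [link, Prog.block, Prog.run, hw, Ne.symm hi]
    rw [if_neg hi, e31]
    exact hold

/-- Adds the clause in the registers 50 to 52. -/
def addClause : Prog := .seq (link 51) (link 52)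

theorem gen_addClause {m : Store} {c : Clause} (h8 : m.reg 8 = 1) (h50 : m.reg 50 = c.head)
    (h51 : m.reg 51 = c.left) (h52 : m.reg 52 = c.right) :
    Prog.Gen clauseRep addClause m (fun a => a = c) 1 14 := by
  rintro P n ⟨E, h1, h2, h3⟩
  show Prog.WP (.seq (link 51) (link 52)) m (7 + 7) _
  refine Prog.WP.seq (wp_link (w := 51) h8 h50 h51 h52 (by norm_num) h3) fun m' hf h => ?_
  have f : ∀ x, x ∉ [14, 53] → m'.reg x = m.reg x := by
    intro x hx; exact hf.reg x (by simpa [link, Prog.block, Prog.regs] using hx)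
  refine (wp_link (w := 52) (c := c) (by simp [f, h8]) (by simp [f, h50]) (by simp [f, h51])
    (by simp [f, h52]) (by norm_num) h).mono le_rfl fun m'' _ h' => ?_
  -- The entry for the right premise is linked last and so comes first in the chain, in agreement
  -- with the order in `users`.
  refine ⟨c :: E, fun a => by simp only [h1, List.mem_cons, or_comm], by simpa using h2, fun i => ?_⟩
  have := h' i
  rw [f 52 (by simp), h51, h52, ← List.append_assoc] at this
  simpa only [users, List.flatMap_cons] using this

/-! ## Saturation: the items derivable from the clauses -/

/-- Derivations in the grammar in memory that use items of `T` only. -/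
inductive Store.DerivesIn (m : Store) (T : ℕ → Prop) : ℕ → List ℕ → Prop
  | empty {i : ℕ} : T i → m.arr 12 i = 0 → DerivesIn m T i []
  | letter {i : ℕ} : T i → m.arr 12 i = 1 → DerivesIn m T i [m.arr 13 i]
  | concat {i : ℕ} {u v : List ℕ} : T i → m.arr 12 i = 2 →
      DerivesIn m T (m.arr 13 i) u → DerivesIn m T (m.arr 14 i) v → DerivesIn m T i (u ++ v)

theorem Store.DerivesIn.derives {m : Store} {T : ℕ → Prop} {i : ℕ} {w : List ℕ}
    (h : m.DerivesIn T i w) : m.Derives i w := by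
  induction h with
  | empty _ h => exact .empty h
  | letter _ h => exact .letter h
  | concat _ h _ _ h1 h2 => exact .concat h h1 h2

/-- Confining a derivation to `T` protects it: the two stores may disagree on the rules of all other
items. -/
theorem Store.DerivesIn.mono {m m' : Store} {T T' : ℕ → Prop} {i : ℕ} {w : List ℕ}
    (h : m.DerivesIn T i w) (hT : ∀ i, T i → T' i)
    (e : ∀ i, T i → m'.arr 12 i = m.arr 12 i ∧ m'.arr 13 i = m.arr 13 i ∧
      m'.arr 14 i = m.arr 14 i) : m'.DerivesIn T' i w := by
  induction h with
  | empty hi h => exact .empty (hT _ hi) ((e _ hi).1.trans h)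
  | letter hi h =>
    rw [← (e _ hi).2.1]
    exact .letter (hT _ hi) ((e _ hi).1.trans h)
  | concat hi h _ _ h1 h2 =>
    refine .concat (hT _ hi) ((e _ hi).1.trans h) ?_ ?_
    · rw [(e _ hi).2.1]; exact h1
    · rw [(e _ hi).2.2]; exact h2

/-- The items of `q` are the ones found so far: they are listed in array 19 and marked in
array 18, and have rules in the grammar. -/
structure Store.Found (m : Store) (Sem : ℕ → List ℕ → Prop) (q : List ℕ) : Prop where
  len : m.reg 18 = q.length
  get : ∀ j (h : j < q.length), m.arr 19 j = q[j]
  nodup : q.Nodup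
  mark : ∀ i, m.arr 18 i = if i ∈ q then 1 else 0
  sound : ∀ i ∈ q, ∃ w, m.DerivesIn (· ∈ q) i w ∧ Sem i w

/-- The item `i` is new, so no recorded derivation uses its rule, and overwriting that rule leaves
all of them valid. The last hypothesis may therefore build on them in the new store. -/
theorem Store.Found.push {m m' : Store} {Sem : ℕ → List ℕ → Prop} {q : List ℕ} {i : ℕ}
    (h : m.Found Sem q) (hi : i ∉ q) (h18 : m'.reg 18 = m.reg 18 + 1)
    (e19 : ∀ j, m'.arr 19 j = if j = m.reg 18 then i else m.arr 19 j)
    (e18 : ∀ j, m'.arr 18 j = if j = i then 1 else m.arr 18 j)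
    (e : ∀ j, j ≠ i → m'.arr 12 j = m.arr 12 j ∧ m'.arr 13 j = m.arr 13 j ∧
      m'.arr 14 j = m.arr 14 j)
    (hw : (∀ j w, m.DerivesIn (· ∈ q) j w → m'.DerivesIn (· ∈ q ++ [i]) j w) →
      ∃ w, m'.DerivesIn (· ∈ q ++ [i]) i w ∧ Sem i w) : m'.Found Sem (q ++ [i]) := by
  have hmono : ∀ j w, m.DerivesIn (· ∈ q) j w → m'.DerivesIn (· ∈ q ++ [i]) j w := by
    intro j w hd
    refine hd.mono (fun _ h => List.mem_append_left _ h) fun k hk => e k ?_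
    rintro rfl; exact hi hk
  refine ⟨by simp [h18, h.len], fun j hj => ?_, ?_, fun j => ?_, fun j hj => ?_⟩
  · rw [e19, h.len, List.getElem_append]
    have hj' : j < q.length + 1 := by simpa using hj
    by_cases hjq : j < q.length
    · simp [hjq, hjq.ne, h.get j hjq]
    · have : j = q.length := by omega
      simp [this]
  · rw [List.nodup_append]
    refine ⟨h.nodup, List.nodup_singleton i, ?_⟩
    intro a ha b hb
    rw [List.mem_singleton] at hb
    rintro rfl
    exact hi (hb ▸ ha)
  · rw [e18, h.mark]
    by_cases hji : j = i <;> simp [hji]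
  · rcases List.mem_append.mp hj with hj | hj
    · obtain ⟨w, h1, h2⟩ := h.sound j hj
      exact ⟨w, hmono j w h1, h2⟩
    · rw [List.mem_singleton] at hj
      subst hj
      exact hw hmono

theorem Store.Found.congr {m m' : Store} {Sem : ℕ → List ℕ → Prop} {q : List ℕ}
    (h : m.Found Sem q) (h18 : m'.reg 18 = m.reg 18)
    (e : ∀ a ∈ [12, 13, 14, 18, 19], m'.arr a = m.arr a) : m'.Found Sem q := by
  simp only [List.forall_mem_cons, List.not_mem_nil, IsEmpty.forall_iff, implies_true,
      and_true] at e
  refine ⟨h18.trans h.len, ?_, h.nodup, ?_, fun i hi => ?_⟩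
  · rw [e.2.2.2.2]; exact h.get
  · rw [e.2.2.2.1]; exact h.mark
  · obtain ⟨w, h1, h2⟩ := h.sound i hi
    exact ⟨w, h1.mono (fun _ h => h) (by simp [e]), h2⟩

/-- Reads the clause at the position in register 67, and moves on in the list. -/
def readClause : Prog :=
  .block [.load 60 27 67, .load 61 28 67, .load 62 29 67, .load 67 30 67, .load 63 18 60,
    .load 64 18 61, .load 65 18 62]

/-- Gives the item in register 60 the rule that concatenates the items in registers 61 and 62. -/
def addRule : Prog :=
  .block [.store 18 60 8, .const 66 2, .store 12 60 66, .store 13 60 61, .store 14 60 62,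
    .store 19 18 60, .add 18 18 8]

/-- Marks are 0 or 1, so the two strict comparisons say that the head is not yet found while both
premises are. -/
def scan : Prog :=
  .loop (.lt 7 67) (.seq readClause (.ite (.lt 63 64) (.ite (.lt 63 65) addRule .skip) .skip))

/-- A clause fires as soon as both premises are in the current queue, but this is promised only for
premises in the fixed set `D`: items found during the scan get their own turn later. -/
theorem wp_scan {m : Store} {Sem : ℕ → List ℕ → Prop} {E l₀ : List Clause} {k : ℕ}
    {q₀ D : List ℕ} (h7 : m.reg 7 = 0) (h8 : m.reg 8 = 1) (hl : ∀ c ∈ l₀, c ∈ E)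
    (hSem : ∀ c ∈ E, ∀ u v, Sem c.left u → Sem c.right v → Sem c.head (u ++ v))
    (hc : m.Chain k (m.reg 67) l₀) (hq : m.Found Sem q₀) (hD : ∀ i ∈ D, i ∈ q₀) :
    Prog.WP scan m (17 * l₀.length + 1) fun m' => ∃ q, m'.Found Sem q ∧ q₀ <+: q ∧
      (∀ i ∈ q, i ∈ q₀ ∨ ∃ c ∈ E, c.head = i) ∧
      ∀ c ∈ l₀, c.left ∈ D → c.right ∈ D → c.head ∈ q := by
  refine (Prog.WP.loop (fun κ m' => ∃ q l, κ = 17 * l.length ∧ Prog.Frame scan m m' ∧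
    m'.Chain k (m'.reg 67) l ∧ (∀ c ∈ l, c ∈ l₀) ∧ m'.Found Sem q ∧ q₀ <+: q ∧
    (∀ i ∈ q, i ∈ q₀ ∨ ∃ c ∈ E, c.head = i) ∧
    ∀ c ∈ l₀, c.left ∈ D → c.right ∈ D → c.head ∈ q ∨ c ∈ l) ?_ (17 * l₀.length) m
    ⟨q₀, l₀, rfl, .refl _ _, hc, fun _ h => h, hq, List.prefix_refl _, fun _ h => Or.inl h,
      fun _ h _ _ => Or.inr h⟩).mono le_rfl ?_
  · rintro κ m₁ ⟨q, l, rfl, hf, hch, hl₀, hq, hpre, hhead, hcl⟩ hb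
    have f7 : m₁.reg 7 = 0 := (hf.reg 7 (by decide)).trans h7
    have f8 : m₁.reg 8 = 1 := (hf.reg 8 (by decide)).trans h8
    have hpos : 0 < m₁.reg 67 := by simpa [Test.Holds, f7] using hb
    cases l with
    | nil => exact absurd hch hpos.ne'
    | cons c l =>
    obtain ⟨-, hk, hh, hle, hri, hch⟩ := hch
    have hcE : c ∈ E := hl c (hl₀ c List.mem_cons_self)
    -- Reading the clause costs 7, the two tests 2, the new rule 7; the test of the loop makes it 17
    -- per clause.
    refine ⟨16, 17 * l.length, by simp only [List.length_cons]; omega, ?_⟩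
    refine Prog.WP.seq (p := readClause) (c₁ := 7) (c₂ := 9) (R := fun m' => m'.reg 60 = c.head ∧
      m'.reg 61 = c.left ∧ m'.reg 62 = c.right ∧ m'.reg 67 = m₁.arr 30 (m₁.reg 67) ∧
      m'.reg 63 = m₁.arr 18 c.head ∧ m'.reg 64 = m₁.arr 18 c.left ∧
      m'.reg 65 = m₁.arr 18 c.right)
      (Prog.WP.run (p := readClause) (by simp [readClause, Prog.block, Prog.LoopFree])
        (by simp [readClause, Prog.block, Prog.run, hh, hle, hri])) ?_
    rintro m₂ hf₂ ⟨r60, r61, r62, r67, r63, r64, r65⟩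
    have a2 : ∀ a, m₂.arr a = m₁.arr a := fun a => hf₂.arr a (by
      simp [readClause, Prog.block, Prog.arrs])
    have hf2' : Prog.Frame scan m m₂ := hf.trans (hf₂.mono (by decide) (by decide))
    have hq₂ : m₂.Found Sem q := hq.congr (hf₂.reg 18 (by decide)) fun a _ => a2 a
    have hch₂ : m₂.Chain k (m₂.reg 67) l := by
      rw [r67]; exact hch.congr le_rfl (by simp [a2])
    have hl₀' : ∀ d ∈ l, d ∈ l₀ := fun d hd => hl₀ d (List.mem_cons_of_mem _ hd)
    have hskip : (c.left ∈ D → c.right ∈ D → c.head ∈ q) → ∃ q l', 17 * l.length = 17 * l'.length ∧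
        Prog.Frame scan m m₂ ∧
        m₂.Chain k (m₂.reg 67) l' ∧ (∀ c ∈ l', c ∈ l₀) ∧ m₂.Found Sem q ∧ q₀ <+: q ∧
        (∀ i ∈ q, i ∈ q₀ ∨ ∃ c ∈ E, c.head = i) ∧
        ∀ c ∈ l₀, c.left ∈ D → c.right ∈ D → c.head ∈ q ∨ c ∈ l' := by
      intro hc
      refine ⟨q, l, rfl, hf2', hch₂, hl₀', hq₂, hpre, hhead, fun d hd h1 h2 => ?_⟩
      rcases hcl d hd h1 h2 with h | h
      · exact Or.inl h
      · rcases List.mem_cons.mp h with rfl | h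
        · exact Or.inl (hc h1 h2)
        · exact Or.inr h
    have hDq : ∀ i ∈ D, i ∈ q := fun i hi => hpre.subset (hD i hi)
    refine Prog.WP.ite (c := 8) (fun hb1 => Prog.WP.ite (c := 7) (fun hb2 => ?_) fun hb2 => ?_)
      fun hb1 => ?_
    · simp only [Test.Holds, r63, r64, r65, hq.mark] at hb1 hb2
      have hhq : c.head ∉ q := by
        intro h; rw [if_pos h] at hb1; split_ifs at hb1 <;> omega
      rw [if_neg hhq] at hb1 hb2
      have hlq : c.left ∈ q := by by_contra h; simp [h] at hb1
      have hrq : c.right ∈ q := by by_contra h; simp [h] at hb2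
      refine Prog.WP.mono (Prog.WP.run (p := addRule) (Q := fun m' => m' = addRule.run m₂)
        (by simp [addRule, Prog.block, Prog.LoopFree]) rfl) (by decide) ?_
      rintro m₃ hf₃ hm₃
      have f8 : m₂.reg 8 = 1 := (hf2'.reg 8 (by decide)).trans h8
      have hq₃ : m₃.Found Sem (q ++ [c.head]) := by
        refine hq₂.push hhq ?_ ?_ ?_ ?_ ?_
        · simp [hm₃, addRule, Prog.block, Prog.run, f8]
        · intro j; simp [hm₃, addRule, Prog.block, Prog.run, r60]
        · intro j; simp [hm₃, addRule, Prog.block, Prog.run, r60, f8]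
        · intro j hj; simp [hm₃, addRule, Prog.block, Prog.run, r60, hj]
        · intro hmono
          obtain ⟨u, hu, su⟩ := hq₂.sound _ hlq
          obtain ⟨v, hv, sv⟩ := hq₂.sound _ hrq
          refine ⟨u ++ v, .concat (by simp) ?_ ?_ ?_, hSem c hcE u v su sv⟩
          · simp [hm₃, addRule, Prog.block, Prog.run, r60]
          · have : m₃.arr 13 c.head = c.left := by
              simp [hm₃, addRule, Prog.block, Prog.run, r60, r61]
            rw [this]; exact hmono _ _ hu
          · have : m₃.arr 14 c.head = c.right := by
              simp [hm₃, addRule, Prog.block, Prog.run, r60, r62]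
            rw [this]; exact hmono _ _ hv
      refine ⟨q ++ [c.head], l, rfl, hf2'.trans (hf₃.mono (by decide) (by decide)), ?_, hl₀', hq₃,
        hpre.trans (List.prefix_append _ _), ?_, ?_⟩
      · rw [hf₃.reg 67 (by decide)]
        refine hch₂.congr le_rfl fun j _ => ?_
        rw [hf₃.arr 27 (by decide), hf₃.arr 28 (by decide), hf₃.arr 29 (by decide),
          hf₃.arr 30 (by decide)]
        simp
      · intro i hi
        rcases List.mem_append.mp hi with h | h
        · exact hhead i h
        · exact Or.inr ⟨c, hcE, (List.mem_singleton.mp h).symm⟩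
      · intro d hd h1 h2
        rcases hcl d hd h1 h2 with h | h
        · exact Or.inl (List.mem_append_left _ h)
        · rcases List.mem_cons.mp h with rfl | h
          · exact Or.inl (by simp)
          · exact Or.inr h
    · refine ⟨1, m₂, .skip _, by norm_num, hskip fun h1 h2 => ?_⟩
      simp only [Test.Holds, r63, r65, hq.mark, hDq _ h2] at hb2
      by_contra h; simp [h] at hb2
    · refine ⟨1, m₂, .skip _, by norm_num, hskip fun h1 h2 => ?_⟩
      simp only [Test.Holds, r63, r64, hq.mark, hDq _ h1] at hb1
      by_contra h; simp [h] at hb1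
  · rintro m' - ⟨⟨κ, q, l, -, hf, hch, -, hq, hpre, hhead, hcl⟩, hb⟩
    refine ⟨q, hq, hpre, hhead, fun c hc h1 h2 => ?_⟩
    have f7 : m'.reg 7 = 0 := (hf.reg 7 (by decide)).trans h7
    cases l with
    | nil => simpa using hcl c hc h1 h2
    | cons d l => exact absurd (show (Test.lt 7 67).Holds m' by
        simpa [Test.Holds, f7] using hch.1) hb

/-- Array 19 serves as a queue: positions below register 17 have been processed, those from there up
to register 18 are waiting. -/
def saturate : Prog :=
  .loop (.lt 17 18) (.seq (.block [.load 68 19 17, .add 17 17 8, .load 67 31 68]) scan)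

/-- Every item passes through the queue once, at 5 steps besides its scan, and at most `E.length`
items are added to the initial ones. Each clause is scanned at most twice at 17 steps, once for each
premise. This gives the coefficient `39 = 5 + 2 * 17`. -/
theorem wp_saturate {m : Store} {Sem : ℕ → List ℕ → Prop} {E : List Clause}
    {q₀ : List ℕ} (h7 : m.reg 7 = 0) (h8 : m.reg 8 = 1) (h17 : m.reg 17 = 0)
    (hSem : ∀ c ∈ E, ∀ u v, Sem c.left u → Sem c.right v → Sem c.head (u ++ v))
    (hE : ∀ i, m.Chain (m.reg 14) (m.arr 31 i) (users E i)) (hq : m.Found Sem q₀) :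
    Prog.WP saturate m (5 * q₀.length + 39 * E.length + 1) fun m' => ∃ q, m'.Found Sem q ∧
      q₀ <+: q ∧ ∀ c ∈ E, c.left ∈ q → c.right ∈ q → c.head ∈ q := by
  -- The potential is what remains of the total after the first `n` queue members have been paid
  -- for.
  refine (Prog.WP.loop (fun κ m' => ∃ q n, κ + 5 * n +
      17 * ((q.take n).map fun i => (users E i).length).sum = 5 * q₀.length + 39 * E.length ∧
      Prog.Frame saturate m m' ∧ m'.Found Sem q ∧ q₀ <+: q ∧ m'.reg 17 = n ∧ n ≤ q.length ∧
      (∀ i ∈ q, i ∈ q₀ ∨ ∃ c ∈ E, c.head = i) ∧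
      ∀ c ∈ E, c.left ∈ q.take n → c.right ∈ q.take n → c.head ∈ q) ?_ _ m
    ⟨q₀, 0, by simp, .refl _ _, hq, List.prefix_refl _, h17, Nat.zero_le _, fun _ h => Or.inl h,
      by simp⟩).mono le_rfl ?_
  · rintro κ m₁ ⟨q, n, hκ, hf, hq, hpre, h17, hn, hhead, hcl⟩ hb
    have f7 : m₁.reg 7 = 0 := (hf.reg 7 (by decide)).trans h7
    have f8 : m₁.reg 8 = 1 := (hf.reg 8 (by decide)).trans h8
    have hn : n < q.length := by simpa [Test.Holds, h17, hq.len] using hb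
    have htake : q.take (n + 1) = q.take n ++ [q[n]] := by simp
    -- The queue has no repetitions and consists of start items and heads of clauses.
    have hlen : ∀ q : List ℕ, q.Nodup → (∀ i ∈ q, i ∈ q₀ ∨ ∃ c ∈ E, c.head = i) →
        q.length ≤ q₀.length + E.length := by
      intro q hnd hh
      have : q ⊆ q₀ ++ E.map Clause.head := by
        intro i hi
        rw [List.mem_append, List.mem_map]
        exact hh i hi
      simpa using (List.subperm_of_subset hnd this).length_le
    have hlenq := hlen q hq.nodup hhead
    have hsum := sum_length_users E (hq.nodup.sublist (List.take_sublist (n + 1) q))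
    rw [htake, List.map_append, List.sum_append] at hsum
    simp only [List.map_cons, List.map_nil, List.sum_cons, List.sum_nil, add_zero] at hsum
    refine ⟨3 + (17 * (users E q[n]).length + 1), κ - 17 * (users E q[n]).length - 5, by omega, ?_⟩
    refine Prog.WP.seq (R := fun m' => m'.reg 17 = n + 1 ∧ m'.reg 67 = m₁.arr 31 q[n])
      (Prog.WP.run (p := .block [.load 68 19 17, .add 17 17 8, .load 67 31 68])
        (by simp [Prog.block, Prog.LoopFree])
        (by simp [Prog.block, Prog.run, h17, f8, hq.get n hn])) ?_
    rintro m₂ hf₂ ⟨r17, r67⟩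
    have hf2' : Prog.Frame saturate m m₂ := hf.trans (hf₂.mono (by decide) (by decide))
    have hq₂ : m₂.Found Sem q := hq.congr (hf₂.reg 18 (by decide)) fun a _ => hf₂.arr a (by
      simp [Prog.block, Prog.arrs])
    have hch : m₂.Chain (m.reg 14) (m₂.reg 67) (users E q[n]) := by
      rw [r67, hf.arr 31 (by decide)]
      refine (hE _).congr le_rfl fun j _ => ?_
      rw [hf2'.arr 27 (by decide), hf2'.arr 28 (by decide), hf2'.arr 29 (by decide),
        hf2'.arr 30 (by decide)]
      simp
    refine (wp_scan (D := q.take (n + 1)) ((hf2'.reg 7 (by decide)).trans h7)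
      ((hf2'.reg 8 (by decide)).trans h8) (fun c hc => (mem_users.mp hc).1) hSem hch hq₂
      (fun i hi => List.mem_of_mem_take hi)).mono le_rfl ?_
    rintro m₃ hf₃ ⟨q', hq', hpre', hhead', hcl'⟩
    have htk : ∀ k ≤ q.length, q'.take k = q.take k := by
      intro k hk
      obtain ⟨s, rfl⟩ := hpre'
      rw [List.take_append_of_le_length hk]
    refine ⟨q', n + 1, ?_, hf2'.trans (hf₃.mono (by decide) (by decide)), hq', hpre.trans hpre', ?_,
      ?_, ?_, ?_⟩
    · rw [htk _ hn, htake, List.map_append, List.sum_append]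
      simp only [List.map_cons, List.map_nil, List.sum_cons, List.sum_nil, add_zero]
      omega
    · rw [hf₃.reg 17 (by decide), r17]
    · exact Nat.le_trans hn hpre'.length_le
    · intro i hi
      rcases hhead' i hi with h | h
      · exact hhead i h
      · exact Or.inr h
    · intro c hc h1 h2
      rw [htk _ hn] at h1 h2
      -- A clause that needs the item just processed was in the scanned chain; any other one had
      -- both premises among the earlier items.
      by_cases hu : c.left = q[n] ∨ c.right = q[n]
      · exact hcl' c (mem_users.mpr ⟨hc, hu⟩) h1 h2
      · push Not at hu
        rw [htake, List.mem_append, List.mem_singleton] at h1 h2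
        exact hpre'.subset (hcl c hc (h1.resolve_right hu.1) (h2.resolve_right hu.2))
  · rintro m' - ⟨⟨κ, q, n, -, hf, hq, hpre, h17, hn, -, hcl⟩, hb⟩
    have : n = q.length := by
      simp only [Test.Holds, h17, hq.len] at hb; omega
    rw [this, List.take_length] at hcl
    exact ⟨q, hq, hpre, hcl⟩

/-! ## Writing out the word of a straight-line grammar -/

/-- Replaces the item on top of the stack by the items of its rule, or writes a letter. -/
def expandTop : Prog :=
  .block [.sub 70 70 8, .load 71 32 70, .load 72 12 71,
    .ite (.eq 72 7) .skip (.ite (.eq 72 8)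
      (.block [.load 73 13 71, .store 15 0 73, .add 0 0 8])
      (.block [.load 73 14 71, .store 32 70 73, .add 70 70 8, .load 73 13 71, .store 32 70 73,
        .add 70 70 8]))]

def expand : Prog := .loop (.lt 7 70) expandTop

/-- The stack of items to be expanded, with its top at the end, and the output so far. -/
structure Store.Expanding (m : Store) (s out : List ℕ) : Prop where
  r7 : m.reg 7 = 0
  r8 : m.reg 8 = 1
  r70 : m.reg 70 = s.length
  stack : ∀ j (h : j < s.length), m.arr 32 j = s[j]
  r0 : m.reg 0 = out.length
  out : ∀ j (h : j < out.length), m.arr 15 j = out[j]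

/-- In continuation form: if the loop terminates well once `i` has been replaced by its word in the
output, it does so with `i` still on the stack. Induction on the derivation thus proves termination
without any measure. -/
theorem Store.Derives.expand {g : Store} {i : ℕ} {w : List ℕ} (h : g.Derives i w)
    {R : Store → Prop} (s out : List ℕ) (m : Store)
    (hg : ∀ a ∈ [12, 13, 14], m.arr a = g.arr a) (hm : m.Expanding (s ++ [i]) out)
    (hR : ∀ m' : Store, (∀ a ∈ [12, 13, 14], m'.arr a = g.arr a) → m'.Expanding s (out ++ w) →
      ∃ t m'', Exec expand m' t m'' ∧ R m'') : ∃ t m'', Exec expand m t m'' ∧ R m'' := by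
  induction h generalizing s out m with
  | _ => ?_
  all_goals
    obtain ⟨r7, r8, r70, hst, r0, hout⟩ := hm
    have r70' : m.reg 70 = s.length + 1 := by simpa using r70
    have htop := hst s.length (by simp)
    rw [List.getElem_concat_length rfl] at htop
    have hrest : ∀ j (h : j < s.length), m.arr 32 j = s[j] := fun j hj =>
      (hst j (by simp; omega)).trans (List.getElem_append_left hj)
    have hb : (Test.lt 7 70).Holds m := by simp [Test.Holds, r7, r70']
    obtain ⟨t, ht, -⟩ := Prog.LoopFree.exec (p := expandTop)
      (by simp [expandTop, Prog.block, Prog.LoopFree]) m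
    have hg' : ∀ a ∈ [12, 13, 14], (expandTop.run m).arr a = g.arr a := by
      intro a ha
      rw [ht.frame.arr a (by revert a; decide), hg a ha]
    suffices ∃ t m'', Exec _root_.expand (expandTop.run m) t m'' ∧ R m'' by
      obtain ⟨u, m'', h1, h2⟩ := this
      exact ⟨_, m'', .loopNext hb ht h1, h2⟩
    simp only [List.forall_mem_cons, List.not_mem_nil, IsEmpty.forall_iff, implies_true,
      and_true] at hg
    obtain ⟨g12, g13, g14⟩ := hg
  · rename_i i hi
    refine hR _ hg' ⟨?_, ?_, ?_, ?_, ?_, ?_⟩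
    all_goals simp [expandTop, Prog.block, Prog.run, r7, r8, r70', htop, g12, hi, r0]
    · exact hrest
    · exact hout
  · rename_i i hi
    refine hR _ hg' ⟨?_, ?_, ?_, ?_, ?_, ?_⟩
    all_goals simp [expandTop, Prog.block, Prog.run, r7, r8, r70', htop, g12, g13, hi, r0]
    · exact hrest
    · intro j hj
      rw [List.getElem_append]
      by_cases h : j < out.length
      · simp [h, h.ne, hout j h]
      · have : j = out.length := by omega
        simp [this]
  · rename_i i u v hi _ _ ih1 ih2
    -- The right part waits on the stack while the left part is written.
    refine ih1 (s ++ [g.arr 14 i]) out _ hg' ⟨?_, ?_, ?_, ?_, ?_, ?_⟩ fun m' hm' he' =>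
      ih2 s (out ++ u) m' hm' he' fun m'' h h' => hR m'' h (by rwa [← List.append_assoc])
    all_goals simp [expandTop, Prog.block, Prog.run, r7, r8, r70', htop, g12, g13, g14, hi, r0]
    · intro j hj
      rcases lt_or_ge j s.length with h | h
      · rw [List.getElem_append_left h, if_neg (by omega), if_neg (by omega), hrest j h]
      · rw [List.getElem_append_right h]
        rcases Nat.eq_or_lt_of_le h with h | h
        · subst h; simp
        · have : j = s.length + 1 := by omega
          subst this; simp
    · exact hout

/-- The start symbol in register 1 becomes the bottom of the work stack. Register 0 stops holding
the verdict and counts the letters written. -/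
def writeInit : Prog :=
  .block [.const 7 0, .const 8 1, .const 0 0, .store 32 7 1, .const 70 1]

/-- Writes out the word of the item in register 1. -/
def writeOut : Prog := .seq writeInit expand

theorem Store.Derives.writeOut {m : Store} {w : List ℕ} (h : m.Derives (m.reg 1) w) :
    ∃ t m', Exec writeOut m t m' ∧ (List.range (m'.reg 0)).map (m'.arr 15) = w := by
  obtain ⟨t, ht, -⟩ := Prog.LoopFree.exec (p := writeInit)
    (by simp [writeInit, Prog.block, Prog.LoopFree]) m
  obtain ⟨u, m', h1, h2⟩ := h.expand (R := fun m' => (List.range (m'.reg 0)).map (m'.arr 15) = w)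
    [] [] (writeInit.run m) (fun a ha => ht.frame.arr a (by revert a; decide))
    ⟨by simp [writeInit, Prog.block, Prog.run], by simp [writeInit, Prog.block, Prog.run],
      by simp [writeInit, Prog.block, Prog.run], by simp [writeInit, Prog.block, Prog.run],
      by simp [writeInit, Prog.block, Prog.run], by simp⟩ (by
      intro m' _ he
      refine ⟨1, m', .loopDone (by simp [Test.Holds, he.r7, he.r70]), ?_⟩
      refine List.ext_getElem (by simp [he.r0]) fun j h1 h2 => ?_
      simpa using he.out j (by simpa using h2))
  exact ⟨_, m', .seq ht h1, h2⟩

/-! ## Pushdown systems given by records, and their saturation clauses -/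

/-- A pushdown system with the states `0, …, N`, given by a sequence of records. In the clauses,
`N + 1` and `N + 2` play the role of two more sources of runs: `N + 1` of the runs which start in
an initial state and end with the empty stack, `N + 2` of all runs which start in an initial state
with the empty stack. The number of symbols is `nL`. -/
structure RecSys where
  N : ℕ
  nL : ℕ
  T : ℕ
  init : ℕ → Prop
  tr : ℕ → Rec

namespace RecSys

variable (Y : RecSys)

def nn : ℕ := Y.N + 3

/-- The item for the empty word; `eps + 1 + a` is the item for the letter `a`. -/
def eps : ℕ := Y.nn * Y.nn

/-- From here on, there is a block of items for every record. -/
def base : ℕ := Y.eps + Y.nL + 1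

def item (x y : ℕ) : ℕ := x * Y.nn + y

/-- Stands for the words that lead from `y` to the source of the record `t` and then read its
letter. With these items the rule for a matched push and pop, whose body has three parts, becomes
two binary rules. -/
def mid (t y : ℕ) : ℕ := Y.base + t * Y.nn + y

/-- The asymmetry between sources and targets makes `N` a sink: it is neither initial nor left
again. -/
structure Valid : Prop where
  init_lt : ∀ x, Y.init x → x < Y.N
  src_lt : ∀ t < Y.T, (Y.tr t).src < Y.N
  tgt_le : ∀ t < Y.T, (Y.tr t).tgt ≤ Y.N
  lit_ge : ∀ t < Y.T, Y.eps ≤ (Y.tr t).lit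
  lit_lt : ∀ t < Y.T, (Y.tr t).lit < Y.base

/-- What the item of a letter or of the empty word produces. -/
def word (a : ℕ) : List ℕ := if a = Y.eps then [] else [a - Y.eps - 1]

/-- One move between configurations, and the word it reads. -/
inductive Move : ℕ × List (ℕ × ℕ) → List ℕ → ℕ × List (ℕ × ℕ) → Prop
  | simple (t : ℕ) (γ : List (ℕ × ℕ)) : t < Y.T → (Y.tr t).kind = 2 →
      Move ((Y.tr t).src, γ) (Y.word (Y.tr t).lit) ((Y.tr t).tgt, γ)
  | push (t : ℕ) (γ : List (ℕ × ℕ)) : t < Y.T → (Y.tr t).kind = 0 →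
      Move ((Y.tr t).src, γ) (Y.word (Y.tr t).lit)
        ((Y.tr t).tgt, ((Y.tr t).zs, (Y.tr t).zi) :: γ)
  | pop (t : ℕ) (γ : List (ℕ × ℕ)) : t < Y.T → (Y.tr t).kind = 1 →
      Move ((Y.tr t).src, ((Y.tr t).zs, (Y.tr t).zi) :: γ) (Y.word (Y.tr t).lit)
        ((Y.tr t).tgt, γ)
  | popBot (t : ℕ) : t < Y.T → (Y.tr t).kind = 1 → (Y.tr t).zs = 1 → (Y.tr t).zi = 1 →
      Move ((Y.tr t).src, []) (Y.word (Y.tr t).lit) ((Y.tr t).tgt, [])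

inductive Reads : ℕ × List (ℕ × ℕ) → List ℕ → ℕ × List (ℕ × ℕ) → Prop
  | refl (c : ℕ × List (ℕ × ℕ)) : Reads c [] c
  | snoc {c d e : ℕ × List (ℕ × ℕ)} {u v : List ℕ} : Reads c u d → Y.Move d v e →
      Reads c (u ++ v) e

variable {Y}

theorem Reads.trans {c d e : ℕ × List (ℕ × ℕ)} {u v : List ℕ} (h : Y.Reads c u d)
    (h' : Y.Reads d v e) : Y.Reads c (u ++ v) e := by
  induction h' with
  | refl => simpa using h
  | snoc _ hm ih => rw [← List.append_assoc]; exact .snoc ih hm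

theorem Move.reads {c d : ℕ × List (ℕ × ℕ)} {u : List ℕ} (h : Y.Move c u d) : Y.Reads c u d :=
  Reads.snoc (.refl c) h

variable (Y)

/-- The source from which the move of a record is applied in the clauses. -/
def SingleSource (r : Rec) (u : ℕ) : Prop :=
  r.kind = 2 ∧ u = r.src ∨ r.kind = 0 ∧ u = Y.N + 2 ∨
    r.kind = 1 ∧ r.zs = 1 ∧ r.zi = 1 ∧ u = Y.N + 1

def Match (r r' : Rec) : Prop := r.kind = 0 ∧ r'.kind = 1 ∧ r.zs = r'.zs ∧ r.zi = r'.zi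

/-- An unmatched push is applied only from `N + 2`, where the stack is forgotten, and a pop of the
bottom only from `N + 1`, where the stack is known to be empty. All other pushes and pops occur in
matched pairs. `start` says that runs ending with the empty stack are among all runs. -/
inductive IsClause : Clause → Prop
  | start : IsClause ⟨Y.item (Y.N + 2) (Y.N + 1), Y.eps, Y.eps⟩
  | refl (x : ℕ) : x < Y.nn → IsClause ⟨Y.item x x, Y.eps, Y.eps⟩
  | init (x : ℕ) : Y.init x → IsClause ⟨Y.item (Y.N + 1) x, Y.eps, Y.eps⟩
  | trans (x y z : ℕ) : x < Y.nn → y < Y.nn → z < Y.nn →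
      IsClause ⟨Y.item x z, Y.item x y, Y.item y z⟩
  | single (t u : ℕ) : t < Y.T → Y.SingleSource (Y.tr t) u →
      IsClause ⟨Y.item u (Y.tr t).tgt, Y.item u (Y.tr t).src, (Y.tr t).lit⟩
  | inner (t t' : ℕ) : t < Y.T → t' < Y.T → Match (Y.tr t) (Y.tr t') →
      IsClause ⟨Y.mid t' (Y.tr t).tgt, Y.item (Y.tr t).tgt (Y.tr t').src, (Y.tr t').lit⟩
  | outer (t t' : ℕ) : t < Y.T → t' < Y.T → Match (Y.tr t) (Y.tr t') →
      IsClause ⟨Y.item (Y.tr t).src (Y.tr t').tgt, (Y.tr t).lit, Y.mid t' (Y.tr t).tgt⟩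

/-! ### Soundness -/

/-- In `inside` the quantifier over `γ` expresses that the run does not touch the stack below it.
Below `nn`, `nil` concerns only the pairs formed by the two artificial sources, which produce the
empty word. -/
inductive SemPair : ℕ → ℕ → List ℕ → Prop
  | inside {x y : ℕ} {w : List ℕ} : x ≤ Y.N → y ≤ Y.N → (∀ γ, Y.Reads (x, γ) w (y, γ)) →
      SemPair x y w
  | bot {x y : ℕ} {w : List ℕ} : Y.init x → y ≤ Y.N → Y.Reads (x, []) w (y, []) →
      SemPair (Y.N + 1) y w
  | top {x y : ℕ} {γ : List (ℕ × ℕ)} {w : List ℕ} : Y.init x → y ≤ Y.N →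
      Y.Reads (x, []) w (y, γ) → SemPair (Y.N + 2) y w
  | nil {x y : ℕ} : Y.N < y → y ≤ x → SemPair x y []

/-- The three kinds of items occupy disjoint ranges, split at `eps` and `base`, so each constructor
can be recovered from the number. -/
inductive Sem : ℕ → List ℕ → Prop
  | pair {x y : ℕ} {w : List ℕ} : x < Y.nn → y < Y.nn → Y.SemPair x y w → Sem (Y.item x y) w
  | lit {a : ℕ} : Y.eps ≤ a → a < Y.base → Sem a (Y.word a)
  | mid {t y : ℕ} {u : List ℕ} : t < Y.T → y < Y.nn → Y.SemPair y (Y.tr t).src u →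
      Sem (Y.mid t y) (u ++ Y.word (Y.tr t).lit)

variable {Y}

theorem item_lt {x y : ℕ} (hx : x < Y.nn) (hy : y < Y.nn) : Y.item x y < Y.eps := by
  unfold item eps; nlinarith

theorem mul_add_inj {n x y x' y' : ℕ} (hy : y < n) (hy' : y' < n) (h : x * n + y = x' * n + y') :
    x = x' ∧ y = y' := by
  have hn : 0 < n := by omega
  have h1 : x = x' := by
    have := congrArg (· / n) h
    simpa [mul_comm _ n, Nat.mul_add_div hn, Nat.div_eq_of_lt hy, Nat.div_eq_of_lt hy'] using this
  subst h1
  exact ⟨rfl, by omega⟩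

theorem Sem.of_item {x y i : ℕ} {w : List ℕ} (h : Y.Sem i w) (hi : i = Y.item x y) (hx : x < Y.nn)
    (hy : y < Y.nn) : Y.SemPair x y w := by
  have := item_lt hx hy
  cases h with
  | pair hx' hy' h =>
    obtain ⟨rfl, rfl⟩ := mul_add_inj hy' hy hi
    exact h
  | lit h1 _ => omega
  | mid _ _ _ => simp only [RecSys.mid, base] at hi; omega

theorem Sem.of_lit {a : ℕ} {w : List ℕ} (h : Y.Sem a w) (h1 : Y.eps ≤ a) (h2 : a < Y.base) :
    w = Y.word a := by
  cases h with
  | pair hx' hy' h => have := item_lt hx' hy'; omega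
  | lit => rfl
  | mid _ _ _ => simp only [RecSys.mid] at h2; omega

theorem Sem.of_mid {t y i : ℕ} {w : List ℕ} (h : Y.Sem i w) (hi : i = Y.mid t y)
    (hy : y < Y.nn) : ∃ u, w = u ++ Y.word (Y.tr t).lit ∧ Y.SemPair y (Y.tr t).src u := by
  have hb : Y.eps ≤ Y.base := by simp only [base]; omega
  cases h with
  | pair hx' hy' h => have := item_lt hx' hy'; simp only [RecSys.mid] at hi; omega
  | lit => simp only [RecSys.mid] at hi; omega
  | mid _ hy' h =>
    simp only [RecSys.mid] at hi
    rw [add_assoc, add_assoc] at hi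
    obtain ⟨rfl, rfl⟩ := mul_add_inj hy' hy (Nat.add_left_cancel hi)
    exact ⟨_, rfl, h⟩

theorem word_eps : Y.word Y.eps = [] := if_pos rfl

theorem SemPair.of_le {x y : ℕ} {w : List ℕ} (h : Y.SemPair x y w) (hx : x ≤ Y.N) (γ) :
    Y.Reads (x, γ) w (y, γ) := by
  cases h with
  | inside _ _ h => exact h γ
  | bot => omega
  | top => omega
  | nil => omega

theorem SemPair.of_eq_bot {x y : ℕ} {w : List ℕ} (h : Y.SemPair x y w) (hx : x = Y.N + 1)
    (hy : y ≤ Y.N) : ∃ x₀, Y.init x₀ ∧ Y.Reads (x₀, []) w (y, []) := by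
  cases h with
  | inside => omega
  | bot h _ h' => exact ⟨_, h, h'⟩
  | top => omega
  | nil => omega

theorem SemPair.of_eq_top {x y : ℕ} {w : List ℕ} (h : Y.SemPair x y w) (hx : x = Y.N + 2)
    (hy : y ≤ Y.N) : ∃ x₀ γ, Y.init x₀ ∧ Y.Reads (x₀, []) w (y, γ) := by
  cases h with
  | inside => omega
  | bot => omega
  | top h _ h' => exact ⟨_, _, h, h'⟩
  | nil => omega

/-- A run from an initial state is continued by a run valid over any stack, in particular over the
one reached. If the first part is `nil`, the bound on `x` leaves the two artificial sources, and
passing from `N + 1` to `N + 2` only forgets that the stack is empty. -/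
theorem SemPair.trans {x y z : ℕ} {u v : List ℕ} (h : Y.SemPair x y u) (h' : Y.SemPair y z v)
    (hx : x < Y.nn) : Y.SemPair x z (u ++ v) := by
  cases h with
  | inside h1 h2 h3 =>
    cases h' with
    | inside _ h4 h5 => exact .inside h1 h4 fun γ => (h3 γ).trans (h5 γ)
    | bot => omega
    | top => omega
    | nil => omega
  | bot h1 h2 h3 =>
    cases h' with
    | inside _ h4 h5 => exact .bot h1 h4 (h3.trans (h5 []))
    | bot => omega
    | top => omega
    | nil => omega
  | top h1 h2 h3 =>
    cases h' with
    | inside _ h4 h5 => exact .top h1 h4 (h3.trans (h5 _))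
    | bot => omega
    | top => omega
    | nil => omega
  | nil h1 h2 =>
    simp only [nn] at hx
    cases h' with
    | inside => omega
    | bot h3 h4 h5 =>
      have : x = Y.N + 1 ∨ x = Y.N + 2 := by omega
      rcases this with rfl | rfl
      · exact .bot h3 h4 h5
      · exact .top h3 h4 h5
    | top h3 h4 h5 =>
      have : x = Y.N + 2 := by omega
      subst this
      exact .top h3 h4 h5
    | nil h3 h4 => exact .nil h3 (h4.trans h2)

/-- Each clause is a way of composing runs. In `outer`, the body of a matched pair runs on top of
the pushed entry, as it runs over any stack, and thus leaves that entry for the pop. -/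
theorem IsClause.sound (hY : Y.Valid) {c : Clause} (hc : Y.IsClause c) {u v : List ℕ}
    (hu : Y.Sem c.left u) (hv : Y.Sem c.right v) : Y.Sem c.head (u ++ v) := by
  have heps : Y.eps < Y.base := by simp only [base]; omega
  have hnil : ∀ w, Y.Sem Y.eps w → w = [] := fun w h => (h.of_lit le_rfl heps).trans word_eps
  have hnn : Y.nn = Y.N + 3 := rfl
  cases hc with
  | start =>
    rw [hnil u hu, hnil v hv]
    exact .pair (by omega) (by omega) (.nil (by omega) (by omega))
  | refl x hx =>
    rw [hnil u hu, hnil v hv]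
    refine .pair hx hx ?_
    rcases le_or_gt x Y.N with h | h
    · exact .inside h h fun γ => .refl _
    · exact .nil h le_rfl
  | init x hx =>
    rw [hnil u hu, hnil v hv]
    have := hY.init_lt x hx
    exact .pair (by omega) (by omega) (.bot hx (by omega) (.refl _))
  | trans x y z hx hy hz =>
    exact .pair hx hz ((hu.of_item rfl hx hy).trans (hv.of_item rfl hy hz) hx)
  | single t s ht hs =>
    have h1 := hY.src_lt t ht
    have h2 := hY.tgt_le t ht
    have hs' : s < Y.nn := by
      rcases hs with ⟨-, rfl⟩ | ⟨-, rfl⟩ | ⟨-, -, -, rfl⟩ <;> omega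
    rw [hv.of_lit (hY.lit_ge t ht) (hY.lit_lt t ht)]
    have hu := hu.of_item rfl hs' (by omega)
    refine .pair hs' (by omega) ?_
    rcases hs with ⟨hk, rfl⟩ | ⟨hk, rfl⟩ | ⟨hk, h3, h4, rfl⟩
    · exact hu.trans (.inside h1.le h2 fun γ => (Move.simple t γ ht hk).reads) hs'
    · obtain ⟨x₀, γ, h5, h6⟩ := hu.of_eq_top rfl h1.le
      exact .top h5 h2 (.snoc h6 (.push t _ ht hk))
    · obtain ⟨x₀, h5, h6⟩ := hu.of_eq_bot rfl h1.le
      exact .bot h5 h2 (.snoc h6 (.popBot t ht hk h3 h4))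
  | inner t t' ht ht' h =>
    have h1 := hY.tgt_le t ht
    have h2 := hY.src_lt t' ht'
    rw [hv.of_lit (hY.lit_ge t' ht') (hY.lit_lt t' ht')]
    exact .mid ht' (by omega) (hu.of_item rfl (by omega) (by omega))
  | outer t t' ht ht' h =>
    have h1 := hY.tgt_le t ht
    have h2 := hY.src_lt t ht
    have h3 := hY.tgt_le t' ht'
    rw [hu.of_lit (hY.lit_ge t ht) (hY.lit_lt t ht)]
    obtain ⟨w, rfl, hw⟩ := hv.of_mid rfl (by omega)
    refine .pair (by omega) (by omega) (.inside h2.le h3 fun γ => ?_)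
    refine (Move.push t γ ht h.1).reads.trans (.snoc (hw.of_le h1 _) ?_)
    rw [h.2.2.1, h.2.2.2]
    exact Move.pop t' γ ht' h.2.1

/-! ### Completeness -/

/-- The stack is explained by pushes, between which there are derivable items. -/
def Covered (Y : RecSys) (q : ℕ → Prop) : ℕ → List (ℕ × ℕ) → Prop
  | y, [] => q (Y.item (Y.N + 1) y)
  | y, z :: γ => ∃ t < Y.T, (Y.tr t).kind = 0 ∧ z = ((Y.tr t).zs, (Y.tr t).zi) ∧
      Covered Y q (Y.tr t).src γ ∧ q (Y.item (Y.tr t).tgt y)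

/-- The segments between the unmatched pushes are joined from the bottom upwards: `single` at `N +
2` crosses each push, transitivity adds the segment after it. -/
theorem Covered.derivable (hY : Y.Valid) {q : ℕ → Prop} (heps : q Y.eps)
    (hlit : ∀ t < Y.T, q (Y.tr t).lit)
    (hcl : ∀ c, Y.IsClause c → q c.left → q c.right → q c.head) {y : ℕ} {γ : List (ℕ × ℕ)}
    (hy : y ≤ Y.N) (h : Y.Covered q y γ) : q (Y.item (Y.N + 2) y) := by
  have hnn : Y.nn = Y.N + 3 := rfl
  induction γ generalizing y with
  | nil =>
    exact hcl _ (.trans (Y.N + 2) (Y.N + 1) y (by omega) (by omega) (by omega))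
      (hcl _ .start heps heps) h
  | cons z γ ih =>
    obtain ⟨t, ht, hk, -, h1, h2⟩ := h
    have h3 := hY.src_lt t ht
    have h4 := hY.tgt_le t ht
    exact hcl _ (.trans (Y.N + 2) (Y.tr t).tgt y (by omega) (by omega) (by omega))
      (hcl _ (.single t (Y.N + 2) ht (.inr (.inl ⟨hk, rfl⟩))) (ih h3.le h1) (hlit t ht)) h2

/-- Only the topmost segment gets longer. -/
theorem Covered.append (hY : Y.Valid) {q : ℕ → Prop}
    (hcl : ∀ c, Y.IsClause c → q c.left → q c.right → q c.head) {x y : ℕ} {γ : List (ℕ × ℕ)}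
    (hx : x ≤ Y.N) (hy : y ≤ Y.N) (h : Y.Covered q x γ) (hxy : q (Y.item x y)) :
    Y.Covered q y γ := by
  have hnn : Y.nn = Y.N + 3 := rfl
  cases γ with
  | nil => exact hcl _ (.trans (Y.N + 1) x y (by omega) (by omega) (by omega)) h hxy
  | cons z γ =>
    obtain ⟨t, ht, hk, hz, h1, h2⟩ := h
    have h4 := hY.tgt_le t ht
    exact ⟨t, ht, hk, hz, h1,
      hcl _ (.trans (Y.tr t).tgt x y (by omega) (by omega) (by omega)) h2 hxy⟩

/-- A push opens a new, empty segment. A pop meets the push that `Covered` recorded for the top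
entry; `inner` and `outer` fold push, segment and pop into an item that extends the segment below.
-/
theorem Covered.move (hY : Y.Valid) {q : ℕ → Prop} (heps : q Y.eps)
    (hlit : ∀ t < Y.T, q (Y.tr t).lit)
    (hcl : ∀ c, Y.IsClause c → q c.left → q c.right → q c.head) {c d : ℕ × List (ℕ × ℕ)}
    {w : List ℕ} (hm : Y.Move c w d) (h : Y.Covered q c.1 c.2) : Y.Covered q d.1 d.2 := by
  have hnn : Y.nn = Y.N + 3 := rfl
  have hrefl : ∀ x ≤ Y.N, q (Y.item x x) := fun x hx => hcl _ (.refl x (by omega)) heps heps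
  cases hm with
  | simple t γ ht hk =>
    have h3 := hY.src_lt t ht
    exact h.append hY hcl h3.le (hY.tgt_le t ht)
      (hcl _ (.single t _ ht (.inl ⟨hk, rfl⟩)) (hrefl _ h3.le) (hlit t ht))
  | push t γ ht hk => exact ⟨t, ht, hk, rfl, h, hrefl _ (hY.tgt_le t ht)⟩
  | pop t γ ht hk =>
    obtain ⟨t', ht', hk', hz, h1, h2⟩ := h
    obtain ⟨hz1, hz2⟩ := Prod.ext_iff.mp hz
    have hM : Match (Y.tr t') (Y.tr t) := ⟨hk', hk, hz1.symm, hz2.symm⟩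
    exact h1.append hY hcl (hY.src_lt t' ht').le (hY.tgt_le t ht)
      (hcl _ (.outer t' t ht' ht hM) (hlit t' ht') (hcl _ (.inner t' t ht' ht hM) h2 (hlit t ht)))
  | popBot t ht hk h1 h2 =>
    exact hcl _ (.single t (Y.N + 1) ht (.inr (.inr ⟨hk, h1, h2, rfl⟩))) h (hlit t ht)

/-- The conclusion does not mention `w`: the item may end up with the word of another run, which is
harmless by soundness. -/
theorem Reads.derivable (hY : Y.Valid) {q : ℕ → Prop} (heps : q Y.eps)
    (hlit : ∀ t < Y.T, q (Y.tr t).lit)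
    (hcl : ∀ c, Y.IsClause c → q c.left → q c.right → q c.head) {x y : ℕ} {γ : List (ℕ × ℕ)}
    {w : List ℕ} (hx : Y.init x) (hy : y ≤ Y.N) (h : Y.Reads (x, []) w (y, γ)) :
    q (Y.item (Y.N + 2) y) := by
  have : ∀ c w d, Y.Reads c w d → c = (x, []) → Y.Covered q d.1 d.2 := by
    intro c w d h
    induction h with
    | refl =>
      intro hc
      rw [hc]
      exact hcl _ (.init x hx) heps heps
    | snoc _ hm ih => exact fun hc => (ih hc).move hY heps hlit hcl hm
  exact (this _ _ _ h rfl).derivable hY heps hlit hcl hy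

end RecSys

/-! ## Runs of input/output systems -/

namespace IOVPTS

variable {L : Type*} {A : IOAlphabet L} {Q Γ : Type*}

section
variable {V : IOVPTS A Q Γ}

theorem Run.snoc {c d e : Q × List Γ} {μ : List (Option L)} {x : Option L} (h : V.Run c μ d)
    (h' : V.Step d x e) : V.Run c (μ ++ [x]) e := by
  induction h with
  | nil c => exact .cons h' (.nil _)
  | cons h1 _ ih => exact .cons h1 (ih h')

theorem Run.of_append {c e : Q × List Γ} {μ ν : List (Option L)} (h : V.Run c (μ ++ ν) e) :
    ∃ d, V.Run c μ d ∧ V.Run d ν e := by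
  induction μ generalizing c with
  | nil => exact ⟨c, .nil c, h⟩
  | cons x μ ih =>
    cases h with
    | cons h1 h2 =>
      obtain ⟨d, h3, h4⟩ := ih h2
      exact ⟨d, .cons h1 h3, h4⟩

theorem Run.of_snoc {c e : Q × List Γ} {μ : List (Option L)} {x : Option L}
    (h : V.Run c (μ ++ [x]) e) : ∃ d, V.Run c μ d ∧ V.Step d x e := by
  obtain ⟨d, h1, h2⟩ := h.of_append
  cases h2 with
  | cons h3 h4 => cases h4 with
    | nil => exact ⟨d, h1, h3⟩

theorem Run.append {c d e : Q × List Γ} {μ ν : List (Option L)} (h : V.Run c μ d)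
    (h' : V.Run d ν e) : V.Run c (μ ++ ν) e := by
  induction h with
  | nil c => exact h'
  | cons h1 _ ih => exact .cons h1 (ih h')

theorem reduceOption_singleton (x : Option L) : [x].reduceOption = x.toList := by
  cases x <;> rfl

theorem Observes.refl (c : Q × List Γ) : V.Observes c [] c := ⟨[], .nil c, rfl⟩

theorem Observes.snoc {c d e : Q × List Γ} {σ : List L} {x : Option L} (h : V.Observes c σ d)
    (h' : V.Step d x e) : V.Observes c (σ ++ x.toList) e := by
  obtain ⟨μ, h1, rfl⟩ := h
  exact ⟨μ ++ [x], h1.snoc h', by rw [List.reduceOption_append, reduceOption_singleton]⟩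

theorem Observes.trans {c d e : Q × List Γ} {σ τ : List L} (h : V.Observes c σ d)
    (h' : V.Observes d τ e) : V.Observes c (σ ++ τ) e := by
  obtain ⟨μ, h1, rfl⟩ := h
  obtain ⟨ν, h2, rfl⟩ := h'
  exact ⟨μ ++ ν, h1.append h2, List.reduceOption_append _ _⟩

/-- The run is cut around its last visible step; only internal moves follow. -/
theorem Observes.of_snoc {c e : Q × List Γ} {σ : List L} {a : L} (h : V.Observes c (σ ++ [a]) e) :
    ∃ d d', V.Observes c σ d ∧ V.Step d (some a) d' ∧ V.Observes d' [] e := by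
  obtain ⟨μ, h1, h2⟩ := h
  induction μ using List.reverseRecOn generalizing e with
  | nil => simp at h2
  | append_singleton μ x ih =>
    obtain ⟨d, h3, h4⟩ := h1.of_snoc
    rw [List.reduceOption_append, reduceOption_singleton] at h2
    cases x with
    | none =>
      obtain ⟨d₁, d₂, h5, h6, h7⟩ := ih h3 (by simpa using h2)
      exact ⟨d₁, d₂, h5, h6, h7.snoc h4⟩
    | some b =>
      obtain ⟨h5, h6⟩ := List.append_inj' h2 rfl
      obtain rfl : b = a := by simpa using h6
      exact ⟨d, e, ⟨μ, h3, h5⟩, h4, .refl e⟩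

/-- Deterministic systems cannot leave a reachable configuration by internal actions. -/
theorem Deterministic.step_of_observes (hV : V.Deterministic) {s : Q} (hs : s ∈ V.init)
    {σ : List L} {a : L} {e : Q × List Γ} (h : V.Observes (s, []) (σ ++ [a]) e) :
    ∃ d, V.Observes (s, []) σ d ∧ V.Step d (some a) e := by
  obtain ⟨d, d', h1, h2, h3⟩ := h.of_snoc
  -- The configuration right after `a` and the final one are reached by the same string.
  obtain rfl : d' = e := hV s hs s hs (σ ++ [a]) d' e (h1.snoc h2)
    (by simpa using (h1.snoc h2).trans h3)
  exact ⟨d, h1, h2⟩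

end

theorem IsWitness.not_iocoLike {Q' Γ' : Type*} {I : IOVPTS A Q' Γ'} {S : IOVPTS A Q Γ} {v : List L}
    (h : I.IsWitness S v) : ¬ I.IocoLike S := by
  obtain ⟨σ, ℓ, -, h1, ⟨q, hq, h2⟩, h3⟩ := h
  intro hI
  obtain ⟨s, hs, h4⟩ := hI σ h1 q hq ℓ h2
  exact h3 s hs h4

/-! ### Steps described by numerical codes. -/

/-- The kind of a move with a given action. -/
def kindCode (A : IOAlphabet L) : Option L → ℕ
  | none => 2
  | some a => (A.kind a).code

variable [Fintype Γ]

/-- The stack entry seen by a pop transition. -/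
def topCode (e : Γ ≃ Fin (Fintype.card Γ)) : List Γ → ℕ
  | [] => 1
  | Z :: _ => (e Z : ℕ) + 2

/-- The change of the stack by a transition with kind `k` and stack entry `z`. -/
def Changes (e : Γ ≃ Fin (Fintype.card Γ)) (k z : ℕ) (α β : List Γ) : Prop :=
  k = 2 ∧ β = α ∨ (k = 0 ∧ ∃ Z, z = (e Z : ℕ) + 2 ∧ β = Z :: α) ∨
    k = 1 ∧ z = topCode e α ∧ β = α.tail

/-- Well-formedness lets the action determine the shape of the transition, so the codes kept in
memory suffice to describe a step. -/
theorem step_iff {V : IOVPTS A Q Γ} (e : Γ ≃ Fin (Fintype.card Γ)) {c d : Q × List Γ}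
    {x : Option L} : V.Step c x d ↔ ∃ t ∈ V.trans, t.src = c.1 ∧ t.act = x ∧ t.tgt = d.1 ∧
      Changes e (kindCode A x) (stackCode e t) c.2 d.2 := by
  constructor
  · intro h
    cases h with
    | push α h =>
      refine ⟨_, h, rfl, rfl, rfl, .inr (.inl ⟨?_, _, rfl, rfl⟩)⟩
      have := V.wellFormed _ h
      simp only [Transition.WellFormed] at this
      simp [kindCode, this, ActionKind.code]
    | pop α h =>
      refine ⟨_, h, rfl, rfl, rfl, .inr (.inr ⟨?_, rfl, rfl⟩)⟩
      have := V.wellFormed _ h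
      simp only [Transition.WellFormed] at this
      simp [kindCode, this, ActionKind.code]
    | popBot h =>
      refine ⟨_, h, rfl, rfl, rfl, .inr (.inr ⟨?_, rfl, rfl⟩)⟩
      have := V.wellFormed _ h
      simp only [Transition.WellFormed] at this
      simp [kindCode, this, ActionKind.code]
    | simple α h =>
      refine ⟨_, h, rfl, rfl, rfl, .inl ⟨?_, rfl⟩⟩
      have := V.wellFormed _ h
      simp only [Transition.WellFormed] at this
      cases x with
      | none => rfl
      | some a => simp [kindCode, this a rfl, ActionKind.code]
  · obtain ⟨p, α⟩ := c
    obtain ⟨q, β⟩ := d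
    rintro ⟨t, ht, h1, rfl, h2, h3⟩
    have hw := V.wellFormed _ ht
    cases t with
    | push p' a Z q' =>
      simp only [Transition.src, Transition.tgt] at h1 h2
      subst h1 h2
      simp only [Transition.WellFormed] at hw
      simp only [Transition.act, kindCode, hw, ActionKind.code, Changes, stackCode] at h3
      obtain ⟨Z', hZ, hβ⟩ : ∃ Z', (e Z : ℕ) + 2 = (e Z' : ℕ) + 2 ∧ β = Z' :: α := by simpa using h3
      obtain rfl : Z = Z' := e.injective (Fin.ext (by omega))
      subst hβ
      exact .push α ht
    | pop p' a Z q' =>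
      simp only [Transition.src, Transition.tgt] at h1 h2
      subst h1 h2
      simp only [Transition.WellFormed] at hw
      simp only [Transition.act, kindCode, hw, ActionKind.code, Changes] at h3
      obtain ⟨hZ, rfl⟩ : stackCode e (.pop p' a Z q' : Transition Q L Γ) = topCode e α ∧
        β = α.tail := by simpa using h3
      cases Z with
      | none =>
        cases α with
        | nil => exact .popBot ht
        | cons => simp [stackCode, topCode] at hZ
      | some Z =>
        cases α with
        | nil => simp [stackCode, topCode] at hZ
        | cons Z' α =>
          simp only [stackCode, topCode] at hZ
          obtain rfl : Z = Z' := e.injective (Fin.ext (by omega))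
          exact .pop α ht
    | simple p' x q' =>
      simp only [Transition.src, Transition.tgt] at h1 h2
      subst h1 h2
      have hk : kindCode A x = 2 := by
        cases x with
        | none => rfl
        | some a => simp [kindCode, hw a rfl, ActionKind.code]
      simp only [Transition.act, hk, Changes] at h3
      obtain rfl : β = α := by simpa using h3
      exact .simple _ ht

theorem changes_push {V : IOVPTS A Q Γ} (e : Γ ≃ Fin (Fintype.card Γ)) {t : Transition Q L Γ}
    (ht : t ∈ V.trans) (hk : kindCode A t.act = 0) (α : List Γ) :
    ∃ β, Changes e 0 (stackCode e t) α β := by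
  have hw := V.wellFormed _ ht
  cases t with
  | push p' a Z q' => exact ⟨Z :: α, .inr (.inl ⟨rfl, Z, rfl, rfl⟩)⟩
  | pop p' a Z q' =>
    simp only [Transition.WellFormed] at hw
    simp [Transition.act, kindCode, hw, ActionKind.code] at hk
  | simple p' x q' =>
    cases x with
    | none => simp [Transition.act, kindCode] at hk
    | some a => simp [Transition.act, kindCode, hw a rfl, ActionKind.code] at hk

end IOVPTS

/-! ## The product of a specification and an implementation -/

namespace RecSys

def PairChanges (k zs zi : ℕ) (γ δ : List (ℕ × ℕ)) : Prop :=
  k = 2 ∧ δ = γ ∨ (k = 0 ∧ δ = (zs, zi) :: γ) ∨ (k = 1 ∧ γ = (zs, zi) :: δ) ∨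
    k = 1 ∧ zs = 1 ∧ zi = 1 ∧ γ = [] ∧ δ = []

theorem move_iff {Y : RecSys} {x y : ℕ} {γ δ : List (ℕ × ℕ)} {w : List ℕ} :
    Y.Move (x, γ) w (y, δ) ↔ ∃ r, (∃ t < Y.T, Y.tr t = r) ∧ r.src = x ∧ r.tgt = y ∧
      Y.word r.lit = w ∧ PairChanges r.kind r.zs r.zi γ δ := by
  constructor
  · intro h
    cases h with
    | simple t γ ht hk => exact ⟨_, ⟨t, ht, rfl⟩, rfl, rfl, rfl, .inl ⟨hk, rfl⟩⟩
    | push t γ ht hk => exact ⟨_, ⟨t, ht, rfl⟩, rfl, rfl, rfl, .inr (.inl ⟨hk, rfl⟩)⟩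
    | pop t γ ht hk => exact ⟨_, ⟨t, ht, rfl⟩, rfl, rfl, rfl, .inr (.inr (.inl ⟨hk, rfl⟩))⟩
    | popBot t ht hk h1 h2 =>
      exact ⟨_, ⟨t, ht, rfl⟩, rfl, rfl, rfl, .inr (.inr (.inr ⟨hk, h1, h2, rfl, rfl⟩))⟩
  · rintro ⟨_, ⟨t, ht, rfl⟩, rfl, rfl, rfl, ⟨hk, rfl⟩ | ⟨hk, rfl⟩ | ⟨hk, rfl⟩ |
      ⟨hk, h1, h2, rfl, rfl⟩⟩
    · exact .simple t _ ht hk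
    · exact .push t _ ht hk
    · exact .pop t _ ht hk
    · exact .popBot t ht hk h1 h2

/-! ### The joint stack of two systems. -/

variable {Γs Γi : Type} [Fintype Γs] [Fintype Γi]

/-- The joint stack. -/
def zipStacks (eS : Γs ≃ Fin (Fintype.card Γs)) (eI : Γi ≃ Fin (Fintype.card Γi))
    (α : List Γs) (β : List Γi) : List (ℕ × ℕ) :=
  List.zipWith (fun Z Z' => ((eS Z : ℕ) + 2, (eI Z' : ℕ) + 2)) α β

/-- The common kind `k` forces both stacks to change in the same way. Equal lengths ensure that
zipping loses nothing and that both stacks become empty together. -/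
theorem PairChanges.of_changes {eS : Γs ≃ Fin (Fintype.card Γs)} {eI : Γi ≃ Fin (Fintype.card Γi)}
    {k zs zi : ℕ} {α α' : List Γs} {β β' : List Γi} (hl : α.length = β.length)
    (hα : IOVPTS.Changes eS k zs α α') (hβ : IOVPTS.Changes eI k zi β β') :
    α'.length = β'.length ∧ PairChanges k zs zi (zipStacks eS eI α β) (zipStacks eS eI α' β') := by
  rcases hα with ⟨hk, rfl⟩ | ⟨hk, Z, rfl, rfl⟩ | ⟨hk, rfl, rfl⟩
  all_goals
    rcases hβ with ⟨hk', rfl⟩ | ⟨hk', Z', rfl, rfl⟩ | ⟨hk', rfl, rfl⟩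
    all_goals first | omega | skip
  · exact ⟨hl, .inl ⟨hk, rfl⟩⟩
  · exact ⟨by simpa using hl, .inr (.inl ⟨hk, rfl⟩)⟩
  · refine ⟨by simp [hl], ?_⟩
    cases α with
    | nil =>
      cases β with
      | nil => exact .inr (.inr (.inr ⟨hk, rfl, rfl, rfl, rfl⟩))
      | cons => simp at hl
    | cons Z α =>
      cases β with
      | nil => simp at hl
      | cons => exact .inr (.inr (.inl ⟨hk, rfl⟩))

/-- Conversely, a joint pop tests both tops at once. Codes of stack symbols start at 2, so the code
1 of the bottom is never confused with a symbol. -/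
theorem PairChanges.of_one {eS : Γs ≃ Fin (Fintype.card Γs)} {eI : Γi ≃ Fin (Fintype.card Γi)}
    {zs zi : ℕ} {α : List Γs} {β : List Γi} {δ : List (ℕ × ℕ)} (hl : α.length = β.length)
    (h : PairChanges 1 zs zi (zipStacks eS eI α β) δ) :
    zs = IOVPTS.topCode eS α ∧ zi = IOVPTS.topCode eI β ∧ δ = zipStacks eS eI α.tail β.tail := by
  rcases h with ⟨hk, -⟩ | ⟨hk, -⟩ | ⟨-, h⟩ | ⟨-, h1, h2, h3, h4⟩
  · omega
  · omega
  · cases α with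
    | nil => simp [zipStacks] at h
    | cons Z α =>
      cases β with
      | nil => simp at hl
      | cons Z' β =>
        simp only [zipStacks, List.zipWith_cons_cons, List.cons.injEq, Prod.mk.injEq] at h
        exact ⟨h.1.1.symm, h.1.2.symm, h.2.symm⟩
  · cases α with
    | nil =>
      cases β with
      | nil => exact ⟨h1, h2, h4⟩
      | cons => simp at hl
    | cons Z α =>
      cases β with
      | nil => simp at hl
      | cons Z' β => simp [zipStacks] at h3

end RecSys

/-! ### Correctness of the product. -/

section Product

open RecSys IOVPTS

variable {L Qs Γs Qi Γi : Type} [Fintype Qs] [Fintype Γs] [Fintype Qi] [Fintype Γi]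
  {A : IOAlphabet L} {S : IOVPTS A Qs Γs} {I : IOVPTS A Qi Γi}

def pairCode (lS : S.Listing) (lI : I.Listing) (p : Qs) (q : Qi) : ℕ :=
  lS.stateNum p * Fintype.card Qi + lI.stateNum q

theorem pairCode_lt {lS : S.Listing} {lI : I.Listing} (p : Qs) (q : Qi) :
    pairCode lS lI p q < Fintype.card Qs * Fintype.card Qi := by
  have h1 := (lS.stateNum p).isLt
  have h2 := (lI.stateNum q).isLt
  unfold pairCode
  nlinarith

theorem pairCode_inj {lS : S.Listing} {lI : I.Listing} {p p' : Qs} {q q' : Qi}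
    (h : pairCode lS lI p q = pairCode lS lI p' q') : p = p' ∧ q = q' := by
  obtain ⟨h1, h2⟩ := mul_add_inj (lI.stateNum q).isLt (lI.stateNum q').isLt h
  exact ⟨lS.stateNum.injective (Fin.ext h1), lI.stateNum.injective (Fin.ext h2)⟩

variable [Fintype L] (e : L ≃ Fin (Fintype.card L)) (lS : S.Listing) (lI : I.Listing)

/-- In the state `p` with the stack entry `z` on top, `S` has no transition with the symbol `ℓ`. -/
def Refuses (p : Qs) (ℓ : L) (z : ℕ) : Prop :=
  ∀ t ∈ S.trans, t.src = p → t.act = some ℓ → A.kind ℓ = .ret ∧ stackCode lS.stackNum t ≠ z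

/-- The records of the product. A refused output leads to the state `N`. -/
inductive IsRecord (N eps : ℕ) : Rec → Prop
  | both (t : Transition Qs L Γs) (u : Transition Qi L Γi) : t ∈ S.trans → u ∈ I.trans →
      t.act = u.act → IsRecord N eps ⟨kindCode A u.act, pairCode lS lI t.src u.src,
        pairCode lS lI t.tgt u.tgt, eps + actCode e u.act, stackCode lS.stackNum t,
        stackCode lI.stackNum u⟩
  | internal (p : Qs) (u : Transition Qi L Γi) : u ∈ I.trans → u.act = none →
      IsRecord N eps ⟨2, pairCode lS lI p u.src, pairCode lS lI p u.tgt, eps, 0,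
        stackCode lI.stackNum u⟩
  | refused (p : Qs) (u : Transition Qi L Γi) (ℓ : L) (z : ℕ) : u ∈ I.trans → u.act = some ℓ →
      A.dir ℓ = .output → (z = 1 ∨ ∃ t ∈ S.trans, stackCode lS.stackNum t = z) →
      Refuses lS p ℓ z → IsRecord N eps ⟨if (A.kind ℓ).code = 1 then 1 else 2,
        pairCode lS lI p u.src, N, eps + actCode e (some ℓ), z, stackCode lI.stackNum u⟩

/-- Only the set of records is prescribed; their order and possible repetitions are left open, as
they depend on the program. -/
structure IsProduct (Y : RecSys) : Prop where
  N : Y.N = Fintype.card Qs * Fintype.card Qi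
  nL : Y.nL = Fintype.card L
  init : ∀ x, Y.init x ↔ ∃ p ∈ S.init, ∃ q ∈ I.init, x = pairCode lS lI p q
  tr : ∀ r, (∃ t < Y.T, Y.tr t = r) ↔ IsRecord e lS lI Y.N Y.eps r

variable {e lS lI}

theorem actCode_le (x : Option L) : actCode e x ≤ Fintype.card L := by
  cases x with
  | none => exact Nat.zero_le _
  | some a => exact (e a).isLt

namespace IsProduct

variable {Y : RecSys}

theorem valid (hY : IsProduct e lS lI Y) : Y.Valid := by
  have key : ∀ t < Y.T, (Y.tr t).src < Y.N ∧ (Y.tr t).tgt ≤ Y.N ∧ Y.eps ≤ (Y.tr t).lit ∧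
      (Y.tr t).lit < Y.base := by
    intro t ht
    have h := (hY.tr _).mp ⟨t, ht, rfl⟩
    generalize Y.tr t = r at h
    have hp : ∀ p q, pairCode lS lI p q < Y.N := fun p q => hY.N ▸ pairCode_lt p q
    have ha : ∀ x : Option L, actCode e x ≤ Y.nL := fun x => hY.nL ▸ actCode_le x
    simp only [base]
    cases h with
    | both t u _ _ _ =>
      have := ha u.act
      exact ⟨hp _ _, (hp _ _).le, by simp, by simp only; omega⟩
    | internal p u _ _ => exact ⟨hp _ _, (hp _ _).le, by simp, by simp only; omega⟩
    | refused p u ℓ z =>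
      have := ha (some ℓ)
      exact ⟨hp _ _, le_rfl, by simp, by simp only; omega⟩
  refine ⟨?_, fun t ht => (key t ht).1, fun t ht => (key t ht).2.1, fun t ht => (key t ht).2.2.1,
    fun t ht => (key t ht).2.2.2⟩
  intro x hx
  obtain ⟨p, -, q, -, rfl⟩ := (hY.init x).mp hx
  exact hY.N ▸ pairCode_lt p q

theorem word_actCode (x : Option L) :
    Y.word (Y.eps + actCode e x) = x.toList.map fun a => (e a : ℕ) := by
  cases x with
  | none => simp [word, actCode]
  | some a => simp [word, actCode]

variable (e lS lI Y) in
/-- What a run of the product to `x` with the word `w` says about the two systems. -/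
def Faithful (w : List ℕ) (x : ℕ) (γ : List (ℕ × ℕ)) : Prop :=
  (∃ s ∈ S.init, ∃ s' ∈ I.init, ∃ p q α β σ, x = pairCode lS lI p q ∧ α.length = β.length ∧
    γ = zipStacks lS.stackNum lI.stackNum α β ∧ S.Observes (s, []) σ (p, α) ∧
    I.Observes (s', []) σ (q, β) ∧ w = σ.map fun a => (e a : ℕ)) ∨
  x = Y.N ∧ ∃ v, I.IsWitness S v ∧ w = v.map fun a => (e a : ℕ)

/-- Determinism enters only for refused outputs: there the refusal by the tracked configuration must
exclude every other way for `S` to produce the output. No record leaves the sink. -/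
theorem faithful_move (hY : IsProduct e lS lI Y) (hS : S.Deterministic) {w v : List ℕ} {x y : ℕ}
    {γ δ : List (ℕ × ℕ)} (h : Faithful e lS lI Y w x γ) (hm : Y.Move (x, γ) v (y, δ)) :
    Faithful e lS lI Y (w ++ v) y δ := by
  obtain ⟨r, hr, hsrc, htgt, rfl, hch⟩ := move_iff.mp hm
  rw [hY.tr] at hr
  have hp : ∀ p q, pairCode lS lI p q ≠ Y.N := fun p q => hY.N ▸ (pairCode_lt p q).ne
  rcases h with ⟨s, hs, s', hs', p, q, α, β, σ, rfl, hl, rfl, hS₁, hI₁, rfl⟩ | ⟨rfl, -⟩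
  · cases hr with
    | both t u ht hu htu =>
      obtain ⟨rfl, rfl⟩ := pairCode_inj hsrc
      obtain ⟨α', β', hα, hβ, hδ⟩ : ∃ α' β',
          Changes lS.stackNum (kindCode A u.act) (stackCode lS.stackNum t) α α' ∧
          Changes lI.stackNum (kindCode A u.act) (stackCode lI.stackNum u) β β' ∧
          δ = zipStacks lS.stackNum lI.stackNum α' β' := by
        rcases hch with ⟨hk, rfl⟩ | ⟨hk, rfl⟩ | h
        · exact ⟨α, β, .inl ⟨hk, rfl⟩, .inl ⟨hk, rfl⟩, rfl⟩
        · simp only at hk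
          rw [hk]
          obtain ⟨α', hα⟩ := changes_push lS.stackNum ht (htu ▸ hk) α
          obtain ⟨β', hβ⟩ := changes_push lI.stackNum hu hk β
          refine ⟨α', β', hα, hβ, ?_⟩
          rcases hα with ⟨h, -⟩ | ⟨-, Z, hZ, rfl⟩ | ⟨h, -⟩
          · omega
          · rcases hβ with ⟨h, -⟩ | ⟨-, Z', hZ', rfl⟩ | ⟨h, -⟩
            · omega
            · simp [zipStacks, hZ, hZ']
            · omega
          · omega
        · have hk : kindCode A u.act = 1 := by rcases h with ⟨h, -⟩ | ⟨h, -⟩ <;> exact h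
          have := PairChanges.of_one hl (hk ▸ Or.inr (Or.inr h))
          rw [hk]
          exact ⟨_, _, .inr (.inr ⟨rfl, this.1, rfl⟩), .inr (.inr ⟨rfl, this.2.1, rfl⟩), this.2.2⟩
      refine .inl ⟨s, hs, s', hs', t.tgt, u.tgt, α', β', σ ++ u.act.toList, htgt.symm,
        (PairChanges.of_changes hl hα hβ).1, hδ, ?_, ?_, ?_⟩
      · exact hS₁.snoc ((step_iff lS.stackNum).mpr ⟨t, ht, rfl, htu, rfl, hα⟩)
      · exact hI₁.snoc ((step_iff lI.stackNum).mpr ⟨u, hu, rfl, rfl, rfl, hβ⟩)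
      · rw [List.map_append, word_actCode]
    | internal p' u hu hact =>
      obtain ⟨rfl, rfl⟩ := pairCode_inj hsrc
      obtain rfl : δ = zipStacks lS.stackNum lI.stackNum α β := by
        rcases hch with ⟨-, h⟩ | ⟨h, -⟩ | ⟨h, -⟩ | ⟨h, -⟩
        · exact h
        all_goals simp at h
      refine .inl ⟨s, hs, s', hs', p', u.tgt, α, β, σ, htgt.symm, hl, rfl, hS₁, ?_, ?_⟩
      · have : I.Step (u.src, β) none (u.tgt, β) :=
          (step_iff lI.stackNum).mpr ⟨u, hu, rfl, hact, rfl, .inl ⟨rfl, rfl⟩⟩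
        simpa using hI₁.snoc this
      · simp [word_eps]
    | refused p' u ℓ z hu hact hdir hz href =>
      obtain ⟨rfl, rfl⟩ := pairCode_inj hsrc
      have hkind : A.kind ℓ = .ret → z = topCode lS.stackNum α ∧
          stackCode lI.stackNum u = topCode lI.stackNum β := by
        intro h
        simp only [h, ActionKind.code, if_pos] at hch
        have := PairChanges.of_one hl hch
        exact ⟨this.1, this.2.1⟩
      -- The record of a refused call leaves the joint stack alone, but the step of the
      -- implementation exists anyway, a push being possible on every stack.
      obtain ⟨β', hβ⟩ : ∃ β', Changes lI.stackNum (kindCode A u.act) (stackCode lI.stackNum u)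
          β β' := by
        rw [hact]
        cases hk : A.kind ℓ with
        | call =>
          obtain ⟨β', h⟩ := changes_push lI.stackNum hu
            (by rw [hact]; simp [kindCode, hk, ActionKind.code]) β
          exact ⟨β', by simpa [kindCode, hk, ActionKind.code] using h⟩
        | ret =>
          exact ⟨_, .inr (.inr ⟨by simp [kindCode, hk, ActionKind.code], (hkind hk).2, rfl⟩)⟩
        | simple => exact ⟨β, .inl ⟨by simp [kindCode, hk, ActionKind.code], rfl⟩⟩
      refine .inr ⟨htgt.symm, σ ++ [ℓ], ⟨σ, ℓ, rfl, ⟨s, hs, _, hS₁⟩, ⟨s', hs', hdir, _, hI₁,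
        (u.tgt, β'), ?_⟩, ?_⟩, ?_⟩
      · exact (Observes.refl _).snoc ((step_iff lI.stackNum).mpr ⟨u, hu, rfl, hact, rfl, by
          rw [← hact]; exact hβ⟩)
      · rintro s₁ hs₁ ⟨-, c, hc, d, hd⟩
        -- Internal moves before `ℓ` do not help `S`: the configuration they lead to is also reached
        -- by `σ`, hence is the tracked one.
        obtain ⟨c', d', h1, h2, -⟩ := Observes.of_snoc (σ := []) hd
        have hc' : S.Observes (s₁, []) σ c' := by simpa using Observes.trans hc h1
        obtain rfl := hS s₁ hs₁ s hs σ _ _ hc' hS₁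
        obtain ⟨t, ht, h3, h4, -, h5⟩ := (step_iff lS.stackNum).mp h2
        obtain ⟨hr, hne⟩ := href t ht h3 h4
        rw [(hkind hr).1] at hne
        rcases h5 with ⟨h, -⟩ | ⟨h, -⟩ | ⟨-, h, -⟩
        · simp [kindCode, hr, ActionKind.code] at h
        · simp [kindCode, hr, ActionKind.code] at h
        · exact hne h
      · rw [List.map_append, word_actCode]; rfl
  · cases hr with
    | both t u => exact (hp _ _ hsrc).elim
    | internal p' u => exact (hp _ _ hsrc).elim
    | refused p' u => exact (hp _ _ hsrc).elim

theorem witness_of_reads (hY : IsProduct e lS lI Y) (hS : S.Deterministic) {w : List ℕ} {x : ℕ}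
    {γ : List (ℕ × ℕ)} (hx : Y.init x) (h : Y.Reads (x, []) w (Y.N, γ)) :
    ∃ v, I.IsWitness S v ∧ w = v.map fun a => (e a : ℕ) := by
  have key : ∀ c w d, Y.Reads c w d → c = (x, []) → Faithful e lS lI Y w d.1 d.2 := by
    intro c w d h
    induction h with
    | refl =>
      intro hc
      obtain ⟨p, hp, q, hq, hpq⟩ := (hY.init x).mp hx
      rw [hc]
      exact .inl ⟨p, hp, q, hq, p, q, [], [], [], hpq, rfl, rfl, .refl _, .refl _, rfl⟩
    | snoc _ hm ih => exact fun hc => faithful_move hY hS (ih hc) hm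
  rcases key _ _ _ h rfl with ⟨_, _, _, _, p, q, _, _, _, h, -⟩ | ⟨-, h⟩
  · have := pairCode_lt (lS := lS) (lI := lI) p q
    rw [← hY.N, ← h] at this
    exact absurd this (lt_irrefl _)
  · exact h

/-- Every joint run is a run of the product. -/
theorem reads_of_run (hY : IsProduct e lS lI Y) (hS : S.Deterministic) {s : Qs} {s' : Qi}
    (hs : s ∈ S.init) {μ : List (Option L)} {q : Qi} {β : List Γi}
    (hI : I.Run (s', []) μ (q, β)) {p : Qs} {α : List Γs}
    (hSo : S.Observes (s, []) μ.reduceOption (p, α)) :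
    α.length = β.length ∧ (∀ Z ∈ α, ∃ t ∈ S.trans, stackCode lS.stackNum t =
      (lS.stackNum Z : ℕ) + 2) ∧ ∃ w, Y.Reads (pairCode lS lI s s', []) w
        (pairCode lS lI p q, zipStacks lS.stackNum lI.stackNum α β) := by
  induction μ using List.reverseRecOn generalizing q β p α with
  | nil =>
    cases hI
    -- Observing nothing, `S` cannot have changed its configuration.
    have := hS s hs s hs [] _ _ hSo (.refl _)
    obtain ⟨rfl, rfl⟩ := Prod.mk.inj this
    exact ⟨rfl, by simp, [], .refl _⟩
  | append_singleton μ x ih =>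
    obtain ⟨⟨q', β'⟩, hI', hstep⟩ := hI.of_snoc
    rw [List.reduceOption_append, reduceOption_singleton] at hSo
    obtain ⟨u, hu, hu1, hu2, hu3, hβ⟩ := (step_iff lI.stackNum).mp hstep
    simp only at hu1 hu3 hβ
    cases x with
    | none =>
      obtain ⟨h1, h2, w, h3⟩ := ih hI' (by simpa using hSo)
      rcases hβ with ⟨-, rfl⟩ | ⟨h, -⟩ | ⟨h, -⟩
      · refine ⟨h1, h2, _, .snoc h3 (move_iff.mpr ⟨_, (hY.tr _).mpr (.internal p u hu hu2), ?_, ?_,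
          rfl, .inl ⟨rfl, rfl⟩⟩)⟩
        · rw [hu1]
        · rw [hu3]
      · simp [kindCode] at h
      · simp [kindCode] at h
    | some a =>
      -- By determinism the visible step of `S` may be taken as its last one, so internal moves of
      -- `S` never need to be simulated.
      obtain ⟨⟨p', α'⟩, hS1, hS2⟩ := hS.step_of_observes hs hSo
      obtain ⟨h1, h2, w, h3⟩ := ih hI' hS1
      obtain ⟨t, ht, ht1, ht2, ht3, hα⟩ := (step_iff lS.stackNum).mp hS2
      simp only at ht1 ht3 hα
      obtain ⟨h4, h5⟩ := PairChanges.of_changes h1 hα hβ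
      refine ⟨h4, ?_, _, .snoc h3 (move_iff.mpr ⟨_, (hY.tr _).mpr (.both t u ht hu
        (ht2.trans hu2.symm)), ?_, ?_, rfl, ?_⟩)⟩
      · rcases hα with ⟨-, rfl⟩ | ⟨-, Z, hZ, rfl⟩ | ⟨-, -, rfl⟩
        · exact h2
        · intro Z' hZ'
          rcases List.mem_cons.mp hZ' with rfl | hZ'
          · exact ⟨t, ht, hZ⟩
          · exact h2 Z' hZ'
        · exact fun Z hZ => h2 Z (List.mem_of_mem_tail hZ)
      · rw [← ht1, ← hu1]
      · rw [← ht3, ← hu3]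
      · rw [hu2]; exact h5

/-- The common trace is simulated by joint moves, and the output that `S` lacks leads into the sink,
with `z` the top of the stack of `S`. -/
theorem reads_of_not_iocoLike (hY : IsProduct e lS lI Y) (hS : S.Deterministic)
    (h : ¬ I.IocoLike S) : ∃ x w γ, Y.init x ∧ Y.Reads (x, []) w (Y.N, γ) := by
  simp only [IocoLike, not_forall] at h
  obtain ⟨σ, ⟨s, hs, ⟨p, α⟩, hSo⟩, s', hs', ℓ, ⟨hdir, c, hc, d, hd⟩, hno⟩ := h
  obtain ⟨⟨q, β⟩, d', h1, h2, -⟩ := Observes.of_snoc (σ := []) hd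
  obtain ⟨μ, hμ, hσ⟩ : I.Observes (s', []) σ (q, β) := by simpa using Observes.trans hc h1
  obtain ⟨h3, h4, w, h5⟩ := reads_of_run hY hS hs hμ (hσ ▸ hSo)
  obtain ⟨u, hu, hu1, hu2, hu3, hβ⟩ := (step_iff lI.stackNum).mp h2
  simp only at hu1 hu3 hβ
  -- Any transition on `ℓ` that is not blocked by the top of the stack would make `ℓ` observable in
  -- `S`.
  have href : Refuses lS p ℓ (topCode lS.stackNum α) := by
    intro t ht ht1 ht2
    by_contra hcon
    refine hno ⟨s, hs, hdir, (p, α), hSo, ?_⟩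
    suffices ∃ α', Changes lS.stackNum (kindCode A (some ℓ)) (stackCode lS.stackNum t) α α' by
      obtain ⟨α', h⟩ := this
      exact ⟨(t.tgt, α'),
        (Observes.refl _).snoc ((step_iff lS.stackNum).mpr ⟨t, ht, ht1, ht2, rfl, h⟩)⟩
    cases hk : A.kind ℓ with
    | call =>
      obtain ⟨α', h⟩ := changes_push lS.stackNum ht
        (by rw [ht2]; simp [kindCode, hk, ActionKind.code]) α
      exact ⟨α', by simpa [kindCode, hk, ActionKind.code] using h⟩
    | ret =>
      refine ⟨_, .inr (.inr ⟨by simp [kindCode, hk, ActionKind.code], ?_, rfl⟩)⟩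
      by_contra h
      exact hcon ⟨hk, h⟩
    | simple => exact ⟨α, .inl ⟨by simp [kindCode, hk, ActionKind.code], rfl⟩⟩
  -- A symbol on a reachable stack was pushed by some transition, so the entries listed with the
  -- transitions, and the bottom, are all that must be tried.
  have hz : topCode lS.stackNum α = 1 ∨
      ∃ t ∈ S.trans, stackCode lS.stackNum t = topCode lS.stackNum α := by
    cases α with
    | nil => exact .inl rfl
    | cons Z α => exact .inr (h4 Z List.mem_cons_self)
  have hrec := (hY.tr _).mpr (.refused p u ℓ _ hu hu2 hdir hz href)
  have hinit : Y.init (pairCode lS lI s s') := (hY.init _).mpr ⟨s, hs, s', hs', rfl⟩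
  by_cases hk : A.kind ℓ = .ret
  · have hk1 : kindCode A (some ℓ) = 1 := by simp [kindCode, hk, ActionKind.code]
    have hβ' : stackCode lI.stackNum u = topCode lI.stackNum β := by
      rcases hβ with ⟨h, -⟩ | ⟨h, -⟩ | ⟨-, h, -⟩
      · omega
      · omega
      · exact h
    have hpc := (PairChanges.of_changes (eS := lS.stackNum) (eI := lI.stackNum) (k := 1) h3
      (.inr (.inr ⟨rfl, rfl, rfl⟩)) (.inr (.inr ⟨rfl, rfl, rfl⟩))).2
    refine ⟨_, _, zipStacks lS.stackNum lI.stackNum α.tail β.tail, hinit,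
      .snoc h5 (move_iff.mpr ⟨_, hrec, ?_, rfl, rfl, ?_⟩)⟩
    · simp only [hu1]
    · rw [hβ']; simpa [hk, ActionKind.code] using hpc
  · have hk1 : (A.kind ℓ).code ≠ 1 := by
      cases h : A.kind ℓ <;> simp_all [ActionKind.code]
    refine ⟨_, _, _, hinit,
      .snoc h5 (move_iff.mpr ⟨_, hrec, ?_, rfl, rfl, .inl ⟨if_neg hk1, rfl⟩⟩)⟩
    simp only [hu1]

end IsProduct

end Product

/-! ## The procedure: set-up -/

/-- The number of pairs of states. -/
def Store.pairs (g : Store) : ℕ := g.reg 0 * g.reg 2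

/-- The constants and tables that the procedure computes first from the input `g`. -/
structure Env (g m : Store) : Prop where
  inp : ∀ x ∈ [0, 1, 2, 3, 4], m.reg x = g.reg x
  r7 : m.reg 7 = 0
  r8 : m.reg 8 = 1
  r9 : m.reg 9 = g.pairs
  r10 : m.reg 10 = g.pairs + 1
  r11 : m.reg 11 = g.pairs + 2
  r12 : m.reg 12 = g.pairs + 3
  r13 : m.reg 13 = (g.pairs + 3) * (g.pairs + 3)
  r20 : m.reg 20 = g.reg 1 + 1
  inpArr : ∀ a ∈ [0, 1, 2, 3, 4, 6, 7, 8, 9, 10, 11], m.arr a = g.arr a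
  arr5 : ∀ j, m.arr 5 j = if j = g.reg 1 then 1 else g.arr 5 j
  arr16 : ∀ p < g.reg 0, m.arr 16 p = p * g.reg 2
  arr17 : ∀ x < g.pairs + 3, m.arr 17 x = x * (g.pairs + 3)

theorem Env.frame {g m m' : Store} {p : Prog} (h : Env g m) (hf : Prog.Frame p m m')
    (hr : ∀ x ∈ [0, 1, 2, 3, 4, 7, 8, 9, 10, 11, 12, 13, 20], x ∉ p.regs)
    (ha : ∀ a ∈ [0, 1, 2, 3, 4, 5, 6, 7, 8, 9, 10, 11, 16, 17], a ∉ p.arrs) : Env g m' := by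
  have e : ∀ x ∈ [0, 1, 2, 3, 4, 7, 8, 9, 10, 11, 12, 13, 20], m'.reg x = m.reg x :=
    fun x hx => hf.reg x (hr x hx)
  have e' : ∀ x ∈ [0, 1, 2, 3, 4, 5, 6, 7, 8, 9, 10, 11, 16, 17], m'.arr x = m.arr x :=
    fun x hx => hf.arr x (ha x hx)
  refine ⟨fun x hx => ?_, ?_, ?_, ?_, ?_, ?_, ?_, ?_, ?_, fun a h' => ?_, ?_, ?_, ?_⟩
  · rw [e x (by revert x; decide), h.inp x hx]
  · rw [e 7 (by decide), h.r7]
  · rw [e 8 (by decide), h.r8]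
  · rw [e 9 (by decide), h.r9]
  · rw [e 10 (by decide), h.r10]
  · rw [e 11 (by decide), h.r11]
  · rw [e 12 (by decide), h.r12]
  · rw [e 13 (by decide), h.r13]
  · rw [e 20 (by decide), h.r20]
  · rw [e' a (by revert a; decide), h.inpArr a h']
  · rw [e' 5 (by decide)]; exact h.arr5
  · rw [e' 16 (by decide)]; exact h.arr16
  · rw [e' 17 (by decide)]; exact h.arr17

/-- The store `g` is blank apart from the input. -/
structure Store.Blank (g : Store) : Prop where
  reg : ∀ x, 7 ≤ x → g.reg x = 0
  arr : ∀ a, 12 ≤ a → ∀ j, g.arr a j = 0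

def pairTable : Prog := .forLt 19 0 (.block [.store 16 19 9, .add 9 9 2])

def itemTable : Prog := .forLt 19 12 (.block [.store 17 19 13, .add 13 13 12])

def sizes : Prog := .block [.add 10 9 8, .add 11 10 8, .add 12 11 8]

/-- The code 1 of the bottom is appended to the stack entries of `S`, so that a loop of length `m_s
+ 1` tries every candidate for a top. Register 16 starts at the first number behind the letters. -/
def lastConstants : Prog := .block [.add 20 1 8, .store 5 1 8, .add 16 13 4, .add 16 16 8]

/-- Computes the constants and tables. -/
def setup : Prog := .block [.const 8 1, pairTable, sizes, itemTable, lastConstants]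

/-- The machine cannot multiply. Repeated addition yields a table of row offsets and leaves the
product in `s`. The case `r = b` is the square table of pairs. -/
theorem wp_multiples {a x r s b : ℕ} {m : Store} {n k : ℕ} (hr : m.reg r = n) (hb : m.reg b = k)
    (hs : m.reg s = 0) (h8 : m.reg 8 = 1) (hd : [x, r, s, b, 8].Nodup ∨ r = b ∧ [x, r, s, 8].Nodup) :
    Prog.WP (.forLt x r (.block [.store a x s, .add s s b])) m (n * 4 + 2) fun m' =>
      m'.reg s = n * k ∧ ∀ j < n, m'.arr a j = j * k := by
  have hd' : x ≠ r ∧ x ≠ s ∧ x ≠ b ∧ x ≠ 8 ∧ r ≠ s ∧ s ≠ b ∧ s ≠ 8 ∧ r ≠ 8 := by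
    rcases hd with h | ⟨rfl, h⟩
    · simp at h; tauto
    · simp at h; tauto
  obtain ⟨h1, h2, h3, h4, h5, h6, h7, h9⟩ := hd'
  have e : (Prog.block [.store a x s, .add s s b]).regs = [s] := rfl
  have e' : (Prog.forLt x r (.block [.store a x s, .add s s b])).regs = [x, s, x] := rfl
  refine Prog.wp_forLt (c := 2) (fun i m' => m'.reg s = i * k ∧ ∀ j < i, m'.arr a j = j * k) hr h8
    (by simp [e, h2]) (by simp [e, Ne.symm h1, h5]) (by simp [e, Ne.symm h4, Ne.symm h7]) ?_
    (by simpa using hs) ?_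
  · intro i m' v h
    simpa [Ne.symm h2] using h
  · intro i hi m' hx hf h
    refine Prog.WP.run (p := .block [.store a x s, .add s s b]) (by simp [Prog.block, Prog.LoopFree])
      ⟨?_, fun j hj => ?_⟩
    · have : m'.reg b = k := by
        rw [hf.reg b (by simp [e', Ne.symm h3, Ne.symm h6]), hb]
      simp [Prog.block, Prog.run, this, h.1]; ring
    · rcases Nat.lt_succ_iff_lt_or_eq.mp hj with hj | rfl
      · simp [Prog.block, Prog.run, hx, hj.ne, h.2 j hj]
      · simp [Prog.block, Prog.run, hx, h.1]

theorem wp_setup {g : Store} (hg : g.Blank) :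
    Prog.WP setup g (4 * g.reg 0 + 4 * g.pairs + 24) fun m => Env g m ∧
      m.reg 16 = (g.pairs + 3) * (g.pairs + 3) + g.reg 4 + 1 := by
  have h1 : Prog.WP (.const 8 1) g 1 fun m => m.reg 8 = 1 :=
    Prog.WP.run (p := .const 8 1) trivial (by simp [Prog.run])
  refine Prog.WP.mono (c := 1 + (g.reg 0 * 4 + 2 + (3 + ((g.pairs + 3) * 4 + 2 + 4))))
    (h1.seq fun m₁ f₁ r8 => ?_) (by omega) fun m _ h => h
  refine (wp_multiples (n := g.reg 0) (k := g.reg 2) (f₁.reg 0 (by decide)) (f₁.reg 2 (by decide))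
    ((f₁.reg 9 (by decide)).trans (hg.reg 9 (by decide))) r8 (.inl (by decide))).seq
    fun m₂ f₂ h₂ => ?_
  have h3 : Prog.WP sizes m₂ 3 fun m => m.reg 9 = g.pairs ∧ m.reg 10 = g.pairs + 1 ∧
      m.reg 11 = g.pairs + 2 ∧ m.reg 12 = g.pairs + 3 := by
    refine Prog.WP.run (p := sizes) (by simp [sizes, Prog.block, Prog.LoopFree]) ?_
    have : m₂.reg 8 = 1 := (f₂.reg 8 (by decide)).trans r8
    simp [sizes, Prog.block, Prog.run, this, h₂.1, Store.pairs]
  refine h3.seq fun m₃ f₃ h₃ => ?_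
  refine (wp_multiples (n := g.pairs + 3) (k := g.pairs + 3) h₃.2.2.2 h₃.2.2.2
    (by rw [f₃.reg 13 (by decide), f₂.reg 13 (by decide), f₁.reg 13 (by decide),
      hg.reg 13 (by decide)])
    (by rw [f₃.reg 8 (by decide), f₂.reg 8 (by decide), r8]) (.inr ⟨rfl, by decide⟩)).seq
    fun m₄ f₄ h₄ => ?_
  refine Prog.WP.run (p := lastConstants) (by simp [lastConstants, Prog.block, Prog.LoopFree])
    ⟨?_, ?_⟩
  · have k8 : m₄.reg 8 = 1 := by
      rw [f₄.reg 8 (by decide), f₃.reg 8 (by decide), f₂.reg 8 (by decide), r8]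
    have e : ∀ x ∈ [0, 1, 2, 3, 4, 7], m₄.reg x = g.reg x := by
      intro x hx
      rw [f₄.reg x (by revert x; decide), f₃.reg x (by revert x; decide),
        f₂.reg x (by revert x; decide), f₁.reg x (by revert x; decide)]
    have e' : ∀ a ∈ [0, 1, 2, 3, 4, 5, 6, 7, 8, 9, 10, 11], m₄.arr a = g.arr a := by
      intro x hx
      rw [f₄.arr x (by revert x; decide), f₃.arr x (by revert x; decide),
        f₂.arr x (by revert x; decide), f₁.arr x (by revert x; decide)]
    have hr : ∀ x, x ∉ [20, 16] → (lastConstants.run m₄).reg x = m₄.reg x := by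
      intro x hx
      simp at hx
      simp [lastConstants, Prog.block, Prog.run, hx]
    have ha : ∀ a ≠ 5, (lastConstants.run m₄).arr a = m₄.arr a := by
      intro a ha
      funext j
      simp [lastConstants, Prog.block, Prog.run, ha]
    refine ⟨fun x hx => ?_, ?_, ?_, ?_, ?_, ?_, ?_, ?_, ?_, fun a h => ?_, ?_, ?_, ?_⟩
    · rw [hr x (by revert x; decide), e x (by revert x; decide)]
    · rw [hr 7 (by decide), e 7 (by decide), hg.reg 7 (by decide)]
    · rw [hr 8 (by decide), k8]
    · rw [hr 9 (by decide), f₄.reg 9 (by decide), h₃.1]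
    · rw [hr 10 (by decide), f₄.reg 10 (by decide), h₃.2.1]
    · rw [hr 11 (by decide), f₄.reg 11 (by decide), h₃.2.2.1]
    · rw [hr 12 (by decide), f₄.reg 12 (by decide), h₃.2.2.2]
    · rw [hr 13 (by decide), h₄.1]
    · have := e 1 (by decide)
      simp [lastConstants, Prog.block, Prog.run, this, k8]
    · rw [ha a (by rintro rfl; simp at h), e' a (by revert a; decide)]
    · intro j
      have := e 1 (by decide)
      simp [lastConstants, Prog.block, Prog.run, this, k8, e' 5 (by decide)]
    · intro p hp
      rw [ha 16 (by decide), f₄.arr 16 (by decide), f₃.arr 16 (by decide), h₂.2 p hp]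
    · intro x hx
      rw [ha 17 (by decide), h₄.2 x hx]
  · have k8 : m₄.reg 8 = 1 := by
      rw [f₄.reg 8 (by decide), f₃.reg 8 (by decide), f₂.reg 8 (by decide), r8]
    have k4 : m₄.reg 4 = g.reg 4 := by
      rw [f₄.reg 4 (by decide), f₃.reg 4 (by decide), f₂.reg 4 (by decide), f₁.reg 4 (by decide)]
    simp [lastConstants, Prog.block, Prog.run, k8, k4, h₄.1]

/-! ## The procedure: records of the product -/

def Store.epsItem (g : Store) : ℕ := (g.pairs + 3) * (g.pairs + 3)

def Store.kindOf (g : Store) (a : ℕ) : ℕ := if a = 0 then 2 else g.arr 0 (a - 1)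

/-- The stack entries of the specification, and the bottom symbol after the end of the list. -/
def Store.entry (g : Store) (j : ℕ) : ℕ := if j = g.reg 1 then 1 else g.arr 5 j

/-- The specification has a transition from `p` for the `i`-th transition of the implementation. -/
def Store.Accepts (g : Store) (i p z n : ℕ) : Prop :=
  ∃ j < n, g.arr 3 j = p ∧ g.arr 4 j = g.arr 9 i ∧ (g.kindOf (g.arr 9 i) = 1 → g.arr 5 j = z)

def Store.recBoth (g : Store) (i j : ℕ) : Rec :=
  ⟨g.kindOf (g.arr 9 i), g.arr 3 j * g.reg 2 + g.arr 8 i, g.arr 6 j * g.reg 2 + g.arr 11 i,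
    g.epsItem + g.arr 9 i, g.arr 5 j, g.arr 10 i⟩

def Store.recInternal (g : Store) (i p : ℕ) : Rec :=
  ⟨2, p * g.reg 2 + g.arr 8 i, p * g.reg 2 + g.arr 11 i, g.epsItem + g.arr 9 i, 0, g.arr 10 i⟩

def Store.recRefused (g : Store) (i p z : ℕ) : Rec :=
  ⟨if g.kindOf (g.arr 9 i) = 1 then 1 else 2, p * g.reg 2 + g.arr 8 i, g.pairs,
    g.epsItem + g.arr 9 i, z, g.arr 10 i⟩

/-- Reads the transition of the implementation with the number in register 21. -/
def readTrans : Prog :=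
  .block [.load 26 8 21, .load 27 9 21, .load 45 10 21, .load 28 11 21, .add 43 13 27, .sub 30 27 8,
    .load 31 1 30, .ite (.eq 27 7) (.const 29 2) (.load 29 0 30)]

structure HasRead (g : Store) (i : ℕ) (m : Store) : Prop where
  r26 : m.reg 26 = g.arr 8 i
  r27 : m.reg 27 = g.arr 9 i
  r28 : m.reg 28 = g.arr 11 i
  r29 : m.reg 29 = g.kindOf (g.arr 9 i)
  r31 : m.reg 31 = g.arr 1 (g.arr 9 i - 1)
  r43 : m.reg 43 = g.epsItem + g.arr 9 i
  r45 : m.reg 45 = g.arr 10 i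

theorem HasRead.frame {g m m' : Store} {i : ℕ} {p : Prog} (h : HasRead g i m)
    (hf : Prog.Frame p m m') (hp : ∀ x ∈ [26, 27, 28, 29, 31, 43, 45], x ∉ p.regs) :
    HasRead g i m' :=
  ⟨(hf.reg 26 (hp _ (by decide))).trans h.r26, (hf.reg 27 (hp _ (by decide))).trans h.r27,
    (hf.reg 28 (hp _ (by decide))).trans h.r28, (hf.reg 29 (hp _ (by decide))).trans h.r29,
    (hf.reg 31 (hp _ (by decide))).trans h.r31, (hf.reg 43 (hp _ (by decide))).trans h.r43,
    (hf.reg 45 (hp _ (by decide))).trans h.r45⟩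

theorem wp_readTrans {g m : Store} {i : ℕ} (h : Env g m) (h21 : m.reg 21 = i) :
    Prog.WP readTrans m 10 (HasRead g i) := by
  have e : ∀ a ∈ [0, 1, 2, 3, 4, 6, 7, 8, 9, 10, 11], m.arr a = g.arr a := h.inpArr
  simp only [List.forall_mem_cons, List.not_mem_nil, IsEmpty.forall_iff, implies_true,
    and_true] at e
  refine Prog.WP.run (p := readTrans) (by simp [readTrans, Prog.block, Prog.LoopFree]) ?_
  have h13 : m.reg 13 = g.epsItem := h.r13
  by_cases hz : g.arr 9 i = 0
  · constructor <;>
      simp [readTrans, Prog.block, Prog.run, h21, e, h.r7, h.r8, h13, Store.kindOf, hz]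
  · constructor <;>
      simp [readTrans, Prog.block, Prog.run, h21, e, h.r7, h.r8, h13, Store.kindOf, hz]

/-- Makes records of the joint moves with the transition read last. -/
def jointRecords : Prog :=
  .forLt 22 1 (.seq (.load 32 4 22) (.ite (.eq 32 27)
    (.seq (.block [.load 33 3 22, .load 33 16 33, .add 41 33 26, .load 34 6 22, .load 34 16 34,
      .add 42 34 28, .move 40 29, .load 44 5 22]) addRec) .skip))

theorem gen_jointRecords {g m : Store} {i base : ℕ} (h : Env g m) (hr : HasRead g i m)
    (hg : ∀ j < g.reg 1, g.arr 3 j < g.reg 0 ∧ g.arr 6 j < g.reg 0) :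
    Prog.Gen (recRep base (g.pairs + 3)) jointRecords m
      (fun r => ∃ j < g.reg 1, g.arr 4 j = g.arr 9 i ∧ r = g.recBoth i j)
      (g.reg 1) (g.reg 1 * 21 + 2) := by
  refine (Prog.Gen.forLt (n := g.reg 1) (d := 1) (c := 19)
    (G := fun j r => g.arr 4 j = g.arr 9 i ∧ r = g.recBoth i j) (h.inp 1 (by decide)) h.r8
    (by decide) (by decide) (by decide) (by simp [recRep]) ?_).mono (by omega) (by omega)
    fun _ => Iff.rfl
  intro j hj m' hx hf
  have h' : Env g m' := h.frame hf (by decide) (by decide)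
  have hr' : HasRead g i m' := hr.frame hf (by decide)
  have e := h'.inpArr
  simp only [List.forall_mem_cons, List.not_mem_nil, IsEmpty.forall_iff, implies_true,
    and_true] at e
  refine Prog.Gen.pre (c := 1) (c' := 18) (R := fun m => m.reg 32 = g.arr 4 j)
    (Prog.WP.run (p := .load 32 4 22) trivial (by simp [Prog.run, hx, e]))
    ⟨by simp [recRep, Prog.regs], by simp [recRep, Prog.arrs]⟩ fun m₁ f₁ r32 => ?_
  have h₁ : Env g m₁ := h'.frame f₁ (by decide) (by decide)
  have hr₁ : HasRead g i m₁ := hr'.frame f₁ (by decide)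
  have hx₁ : m₁.reg 22 = j := (f₁.reg 22 (by decide)).trans hx
  refine Prog.Gen.ite (c := 17) (fun hb => ?_) fun hb => ?_
  · have hb' : g.arr 4 j = g.arr 9 i := by simpa [Test.Holds, r32, hr₁.r27] using hb
    have e₁ := h₁.inpArr
    simp only [List.forall_mem_cons, List.not_mem_nil, IsEmpty.forall_iff, implies_true,
      and_true] at e₁
    refine Prog.Gen.pre (c := 8) (c' := 9) (R := fun m => m.reg 40 = (g.recBoth i j).kind ∧
      m.reg 41 = (g.recBoth i j).src ∧ m.reg 42 = (g.recBoth i j).tgt ∧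
      m.reg 44 = (g.recBoth i j).zs)
      (Prog.WP.run (p := .block [.load 33 3 22, .load 33 16 33, .add 41 33 26, .load 34 6 22,
        .load 34 16 34, .add 42 34 28, .move 40 29, .load 44 5 22])
        (by simp [Prog.block, Prog.LoopFree]) ?_)
      ⟨by simp [recRep, Prog.block, Prog.regs], by simp [recRep, Prog.block, Prog.arrs]⟩
      fun m₂ f₂ r => ?_
    · simp [Prog.block, Prog.run, hx₁, e₁, h₁.arr16 _ (hg j hj).1, h₁.arr16 _ (hg j hj).2, hr₁.r26,
        hr₁.r28, hr₁.r29, h₁.arr5, hj.ne, Store.recBoth]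
    · have h₂ : Env g m₂ := h₁.frame f₂ (by decide) (by decide)
      have hr₂ : HasRead g i m₂ := hr₁.frame f₂ (by decide)
      exact (gen_addRec h₂.r8 h₂.r12 r.1 r.2.1 r.2.2.1 hr₂.r43 r.2.2.2 hr₂.r45).mono le_rfl le_rfl
        fun a => by simp [hb']
  · have hb' : g.arr 4 j ≠ g.arr 9 i := by simpa [Test.Holds, r32, hr₁.r27] using hb
    exact Prog.Gen.skip (by simp [hb']) (by norm_num)

/-- Sets register 34 if the specification accepts the transition read last. -/
def search : Prog :=
  .forLt 24 1 (.block [.load 35 3 24, .load 36 4 24, .load 37 5 24,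
    .ite (.eq 35 22) (.ite (.eq 36 27) (.ite (.eq 29 8) (.ite (.eq 37 44) (.const 34 1) .skip)
      (.const 34 1)) .skip) .skip])

open Classical in
theorem wp_search {g m : Store} {i p z : ℕ} (h : Env g m) (hr : HasRead g i m)
    (h22 : m.reg 22 = p) (h44 : m.reg 44 = z) (h34 : m.reg 34 = 0) :
    Prog.WP search m (g.reg 1 * 14 + 2) fun m' =>
      m'.reg 34 = if g.Accepts i p z (g.reg 1) then 1 else 0 := by
  refine Prog.wp_forLt (c := 12) (fun j m' => m'.reg 34 = if g.Accepts i p z j then 1 else 0)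
    (h.inp 1 (by decide)) h.r8 (by decide) (by decide) (by decide) ?_ ?_ ?_
  · intro j m' v hm
    simpa using hm
  · simp [h34, Store.Accepts]
  · intro j hj m' hx hf hm
    have h' : Env g m' := h.frame hf (by decide) (by decide)
    have hr' : HasRead g i m' := hr.frame hf (by decide)
    have e := h'.inpArr
    simp only [List.forall_mem_cons, List.not_mem_nil, IsEmpty.forall_iff, implies_true,
      and_true] at e
    have e22 : m'.reg 22 = p := (hf.reg 22 (by decide)).trans h22
    have e44 : m'.reg 44 = z := (hf.reg 44 (by decide)).trans h44
    have hacc : g.Accepts i p z (j + 1) ↔ g.Accepts i p z j ∨ (g.arr 3 j = p ∧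
        g.arr 4 j = g.arr 9 i ∧ (g.kindOf (g.arr 9 i) = 1 → g.arr 5 j = z)) := by
      constructor
      · rintro ⟨k, hk, h⟩
        rcases Nat.lt_succ_iff_lt_or_eq.mp hk with hk | rfl
        · exact .inl ⟨k, hk, h⟩
        · exact .inr h
      · rintro (⟨k, hk, h⟩ | h)
        · exact ⟨k, by omega, h⟩
        · exact ⟨j, by omega, h⟩
    refine Prog.WP.mono (Prog.WP.run (by simp [Prog.block, Prog.LoopFree]) (Q := fun m'' =>
      m''.reg 34 = if g.Accepts i p z (j + 1) then 1 else 0) ?_) (by decide) fun _ _ h => h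
    have hj' : m'.arr 5 j = g.arr 5 j := by rw [h'.arr5, if_neg hj.ne]
    simp only [hacc, Prog.block, Prog.run, Store.setReg_reg, Store.setReg_arr, hx, e, e22, e44,
      hr'.r27, hr'.r29, h'.r8]
    by_cases c1 : g.arr 3 j = p <;> by_cases c2 : g.arr 4 j = g.arr 9 i <;>
      by_cases c3 : g.kindOf (g.arr 9 i) = 1 <;> by_cases c4 : g.arr 5 j = z <;>
      simp [c1, c2, c3, c4, hm, hj']

/-- Makes a record of a refused output for the stack entry with the number in register 23. -/
def refusal : Prog :=
  .seq (.block [.load 44 5 23, .const 34 0]) (.seq search (.ite (.eq 34 7)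
    (.seq (.block [.move 42 9, .const 40 2, .ite (.eq 29 8) (.const 40 1) .skip]) addRec) .skip))

theorem gen_refusal {g m : Store} {i p j base : ℕ} (h : Env g m) (hr : HasRead g i m)
    (h22 : m.reg 22 = p) (h23 : m.reg 23 = j)
    (h41 : m.reg 41 = p * g.reg 2 + g.arr 8 i) :
    Prog.Gen (recRep base (g.pairs + 3)) refusal m
      (fun r => ¬ g.Accepts i p (g.entry j) (g.reg 1) ∧ r = g.recRefused i p (g.entry j))
      1 (g.reg 1 * 14 + 19) := by
  refine (Prog.Gen.pre (c := 2) (c' := g.reg 1 * 14 + 2 + 15)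
    (R := fun m => m.reg 44 = g.entry j ∧ m.reg 34 = 0)
    (Prog.WP.run (p := .block [.load 44 5 23, .const 34 0]) (by simp [Prog.block, Prog.LoopFree])
      (by simp [Prog.block, Prog.run, h23, h.arr5, Store.entry]))
    ⟨by simp [recRep, Prog.block, Prog.regs], by simp [recRep, Prog.block, Prog.arrs]⟩
    fun m₁ f₁ r₁ => ?_).mono le_rfl (by omega) fun _ => Iff.rfl
  have h₁ : Env g m₁ := h.frame f₁ (by decide) (by decide)
  have hr₁ : HasRead g i m₁ := hr.frame f₁ (by decide)
  refine Prog.Gen.pre (wp_search h₁ hr₁ ((f₁.reg 22 (by decide)).trans h22) r₁.1 r₁.2)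
    ⟨by simp [recRep]; decide, by simp [recRep]; decide⟩ fun m₂ f₂ r₂ => ?_
  have h₂ : Env g m₂ := h₁.frame f₂ (by decide) (by decide)
  have hr₂ : HasRead g i m₂ := hr₁.frame f₂ (by decide)
  have r44 : m₂.reg 44 = g.entry j := (f₂.reg 44 (by decide)).trans r₁.1
  have r41 : m₂.reg 41 = p * g.reg 2 + g.arr 8 i := by
    rw [f₂.reg 41 (by decide), f₁.reg 41 (by decide), h41]
  refine Prog.Gen.ite (c := 14) (fun hb => ?_) fun hb => ?_
  · have hb' : ¬ g.Accepts i p (g.entry j) (g.reg 1) := by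
      simpa [Test.Holds, r₂, h₂.r7] using hb
    refine (Prog.Gen.pre (c := 5) (c' := 9) (R := fun m => m.reg 42 = g.pairs ∧
      m.reg 40 = if g.kindOf (g.arr 9 i) = 1 then 1 else 2)
      (Prog.WP.mono (Prog.WP.run (p := .block [.move 42 9, .const 40 2,
        .ite (.eq 29 8) (.const 40 1) .skip]) (by simp [Prog.block, Prog.LoopFree]) ?_) (by decide)
        fun _ _ h => h)
      ⟨by simp [recRep, Prog.block, Prog.regs], by simp [recRep, Prog.block, Prog.arrs]⟩
      fun m₃ f₃ r₃ => ?_)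
    · by_cases hk : g.kindOf (g.arr 9 i) = 1 <;>
        simp [Prog.block, Prog.run, h₂.r9, hr₂.r29, h₂.r8, hk]
    · have h₃ : Env g m₃ := h₂.frame f₃ (by decide) (by decide)
      have hr₃ : HasRead g i m₃ := hr₂.frame f₃ (by decide)
      exact (gen_addRec (r := g.recRefused i p (g.entry j)) h₃.r8 h₃.r12 r₃.2
        ((f₃.reg 41 (by decide)).trans r41) r₃.1 hr₃.r43 ((f₃.reg 44 (by decide)).trans r44)
        hr₃.r45).mono le_rfl le_rfl fun a => by simp [hb']
  · have hb' : g.Accepts i p (g.entry j) (g.reg 1) := by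
      simpa [Test.Holds, r₂, h₂.r7] using hb
    exact Prog.Gen.skip (by simp [hb']) (by norm_num)

/-- Makes records of the moves with the transition read last in which the specification does not
take part: internal moves and refused outputs. -/
def soloRecords : Prog :=
  .forLt 22 0 (.seq (.block [.load 33 16 22, .add 41 33 26]) (.ite (.eq 27 7)
    (.seq (.block [.add 42 33 28, .const 40 2, .const 44 0]) addRec)
    (.ite (.eq 31 8) (.forLt 23 20 refusal) .skip)))

def Store.IsSolo (g : Store) (i p : ℕ) (r : Rec) : Prop :=
  g.arr 9 i = 0 ∧ r = g.recInternal i p ∨ g.arr 9 i ≠ 0 ∧ g.arr 1 (g.arr 9 i - 1) = 1 ∧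
    ∃ j < g.reg 1 + 1, ¬ g.Accepts i p (g.entry j) (g.reg 1) ∧ r = g.recRefused i p (g.entry j)

/-- Every state is combined with `m_s + 1` stack entries, each tested by a search through `m_s`
transitions. Over all transitions of `I` this gives the term `n_s m_s² m_i`. -/
theorem gen_soloRecords {g m : Store} {i base : ℕ} (h : Env g m) (hr : HasRead g i m) :
    Prog.Gen (recRep base (g.pairs + 3)) soloRecords m
      (fun r => ∃ p < g.reg 0, g.IsSolo i p r) (g.reg 0 * (g.reg 1 + 1))
      (g.reg 0 * (((g.reg 1 + 1) * (g.reg 1 * 14 + 21) + 18) + 2) + 2) := by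
  refine Prog.Gen.forLt (h.inp 0 (by decide)) h.r8 (by decide) (by decide) (by decide)
    (by simp [recRep]) ?_
  intro p hp m' hx hf
  have h' : Env g m' := h.frame hf (by decide) (by decide)
  have hr' : HasRead g i m' := hr.frame hf (by decide)
  refine (Prog.Gen.pre (c := 2) (c' := ((g.reg 1 + 1) * (g.reg 1 * 14 + 21) + 15) + 1)
    (R := fun m => m.reg 33 = p * g.reg 2 ∧ m.reg 41 = p * g.reg 2 + g.arr 8 i)
    (Prog.WP.run (p := .block [.load 33 16 22, .add 41 33 26]) (by simp [Prog.block, Prog.LoopFree])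
      (by simp [Prog.block, Prog.run, hx, h'.arr16 p hp, hr'.r26]))
    ⟨by simp [recRep, Prog.block, Prog.regs], by simp [recRep, Prog.block, Prog.arrs]⟩
    fun m₁ f₁ r₁ => ?_).mono le_rfl (by omega) fun _ => Iff.rfl
  have h₁ : Env g m₁ := h'.frame f₁ (by decide) (by decide)
  have hr₁ : HasRead g i m₁ := hr'.frame f₁ (by decide)
  refine Prog.Gen.ite (fun hb => ?_) fun hb => ?_
  · have hb' : g.arr 9 i = 0 := by simpa [Test.Holds, hr₁.r27, h₁.r7] using hb
    refine (Prog.Gen.pre (c := 3) (c' := 9) (d := 1) (R := fun m => m.reg 40 = 2 ∧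
      m.reg 42 = p * g.reg 2 + g.arr 11 i ∧ m.reg 44 = 0)
      (Prog.WP.run (p := .block [.add 42 33 28, .const 40 2, .const 44 0])
        (by simp [Prog.block, Prog.LoopFree]) ?_)
      ⟨by simp [recRep, Prog.block, Prog.regs], by simp [recRep, Prog.block, Prog.arrs]⟩
      fun m₂ f₂ r₂ => ?_).mono (by omega) (by omega) fun _ => Iff.rfl
    · simp [Prog.block, Prog.run, r₁.1, hr₁.r28]
    · have h₂ : Env g m₂ := h₁.frame f₂ (by decide) (by decide)
      have hr₂ : HasRead g i m₂ := hr₁.frame f₂ (by decide)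
      exact (gen_addRec (r := g.recInternal i p) h₂.r8 h₂.r12 r₂.1
        ((f₂.reg 41 (by decide)).trans r₁.2) r₂.2.1 hr₂.r43 r₂.2.2 hr₂.r45).mono le_rfl le_rfl
        fun a => by simp [hb', Store.IsSolo]
  · have hb' : g.arr 9 i ≠ 0 := by simpa [Test.Holds, hr₁.r27, h₁.r7] using hb
    refine (Prog.Gen.ite (c := (g.reg 1 + 1) * (g.reg 1 * 14 + 21) + 2) (fun hc => ?_)
      fun hc => ?_).mono le_rfl (by omega) fun _ => Iff.rfl
    · have hc' : g.arr 1 (g.arr 9 i - 1) = 1 := by simpa [Test.Holds, hr₁.r31, h₁.r8] using hc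
      refine (Prog.Gen.forLt (d := 1) (c := g.reg 1 * 14 + 19) (n := g.reg 1 + 1)
        (G := fun j r => ¬ g.Accepts i p (g.entry j) (g.reg 1) ∧ r = g.recRefused i p (g.entry j))
        h₁.r20 h₁.r8 (by decide) (by decide) (by decide) (by simp [recRep]) ?_).mono
        (by omega) (by rfl) fun a => by simp [Store.IsSolo, hb', hc']
      intro j hj m₂ hx₂ f₂
      refine gen_refusal (h₁.frame f₂ (by decide) (by decide)) (hr₁.frame f₂ (by decide)) ?_ hx₂ ?_
      · rw [f₂.reg 22 (by decide), f₁.reg 22 (by decide), hx]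
      · rw [f₂.reg 41 (by decide), r₁.2]
    · have hc' : g.arr 1 (g.arr 9 i - 1) ≠ 1 := by simpa [Test.Holds, hr₁.r31, h₁.r8] using hc
      exact Prog.Gen.skip (by simp [Store.IsSolo, hb', hc']) (by omega)

def records : Prog := .forLt 21 3 (.seq readTrans (.seq jointRecords soloRecords))

/-- The records of the product, in terms of the input. -/
def Store.HasRecord (g : Store) (r : Rec) : Prop :=
  ∃ i < g.reg 3, (∃ j < g.reg 1, g.arr 4 j = g.arr 9 i ∧ r = g.recBoth i j) ∨
    ∃ p < g.reg 0, g.IsSolo i p r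

/-- Repeated records are not removed; the bound for their number counts them. -/
theorem gen_records {g m : Store} {base : ℕ} (h : Env g m)
    (hg : ∀ j < g.reg 1, g.arr 3 j < g.reg 0 ∧ g.arr 6 j < g.reg 0) :
    Prog.Gen (recRep base (g.pairs + 3)) records m g.HasRecord
      (g.reg 3 * (g.reg 1 + g.reg 0 * (g.reg 1 + 1)))
      (g.reg 3 * ((10 + ((g.reg 1 * 21 + 2) +
        (g.reg 0 * (((g.reg 1 + 1) * (g.reg 1 * 14 + 21) + 18) + 2) + 2))) + 2) + 2) := by
  refine Prog.Gen.forLt (h.inp 3 (by decide)) h.r8 (by decide) (by decide) (by decide)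
    (by simp [recRep]) ?_
  intro i hi m' hx hf
  have h' : Env g m' := h.frame hf (by decide) (by decide)
  refine Prog.Gen.pre (wp_readTrans h' hx)
    ⟨by simp [recRep, readTrans, Prog.block, Prog.regs],
      by simp [recRep, readTrans, Prog.block, Prog.arrs]⟩ fun m₁ f₁ hr => ?_
  have h₁ : Env g m₁ := h'.frame f₁ (by decide) (by decide)
  exact (gen_jointRecords h₁ hr hg).seq fun m₂ f₂ =>
    gen_soloRecords (h₁.frame f₂ (by decide) (by decide)) (hr.frame f₂ (by decide))

/-! ## The procedure: clauses -/

open RecSys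

/-- The records of `Y` are in memory. -/
structure HasSys (g : Store) (Y : RecSys) (m : Store) : Prop where
  N : Y.N = g.pairs
  r15 : m.reg 15 = Y.T
  tr : ∀ j, m.recAt j = Y.tr j
  base : ∀ j < Y.T, m.arr 26 j = Y.base + j * Y.nn

theorem HasSys.frame {g m m' : Store} {Y : RecSys} {p : Prog} (h : HasSys g Y m)
    (hf : Prog.Frame p m m') (hr : 15 ∉ p.regs)
    (ha : ∀ a ∈ [20, 21, 22, 23, 24, 25, 26], a ∉ p.arrs) : HasSys g Y m' := by
  refine ⟨h.N, (hf.reg 15 hr).trans h.r15, fun j => ?_, ?_⟩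
  · rw [← h.tr j]
    simp only [Store.recAt, hf.arr 20 (ha _ (by decide)), hf.arr 21 (ha _ (by decide)),
      hf.arr 22 (ha _ (by decide)), hf.arr 23 (ha _ (by decide)), hf.arr 24 (ha _ (by decide)),
      hf.arr 25 (ha _ (by decide))]
  · rw [hf.arr 26 (ha _ (by decide))]; exact h.base

section
variable {g m : Store} {Y : RecSys}

theorem HasSys.nn (h : HasSys g Y m) : Y.nn = g.pairs + 3 := by rw [RecSys.nn, h.N]

theorem HasSys.eps (h : HasSys g Y m) (he : Env g m) : m.reg 13 = Y.eps := by
  rw [he.r13, RecSys.eps, h.nn]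

theorem HasSys.row (h : HasSys g Y m) (he : Env g m) {x : ℕ} (hx : x < Y.nn) :
    m.arr 17 x = x * Y.nn := by
  rw [h.nn] at hx ⊢
  exact he.arr17 x hx

end

def startClause : Prog :=
  .seq (.block [.load 50 17 11, .add 50 50 10, .move 51 13, .move 52 13]) addClause

theorem gen_startClause {g m : Store} {Y : RecSys} (he : Env g m) (hs : HasSys g Y m) :
    Prog.Gen clauseRep startClause m (fun c => c = ⟨Y.item (Y.N + 2) (Y.N + 1), Y.eps, Y.eps⟩)
      1 18 := by
  refine Prog.Gen.pre (c := 4) (c' := 14) (R := fun m => m.reg 50 = Y.item (Y.N + 2) (Y.N + 1) ∧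
    m.reg 51 = Y.eps ∧ m.reg 52 = Y.eps)
    (Prog.WP.run (p := .block [.load 50 17 11, .add 50 50 10, .move 51 13, .move 52 13])
      (by simp [Prog.block, Prog.LoopFree]) ?_)
    ⟨by simp [clauseRep, Prog.block, Prog.regs], by simp [clauseRep, Prog.block, Prog.arrs]⟩
    fun m₁ f₁ r => gen_addClause ((f₁.reg 8 (by decide)).trans he.r8) r.1 r.2.1 r.2.2
  have := hs.row he (x := Y.N + 2) (by simp [RecSys.nn])
  rw [hs.N] at this
  simp [Prog.block, Prog.run, he.r11, he.r10, hs.eps he, item, hs.N, this]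

def initClauses : Prog :=
  .forLt 21 0 (.forLt 22 2 (.seq (.block [.load 33 2 21, .load 34 7 22]) (.ite (.eq 33 8)
    (.ite (.eq 34 8)
      (.seq (.block [.load 35 16 21, .add 35 35 22, .load 50 17 10, .add 50 50 35, .move 51 13,
        .move 52 13]) addClause) .skip) .skip)))

theorem gen_initClauses {g m : Store} {Y : RecSys} (he : Env g m) (hs : HasSys g Y m) :
    Prog.Gen clauseRep initClauses m (fun c => ∃ p < g.reg 0, ∃ q < g.reg 2, g.arr 2 p = 1 ∧
      g.arr 7 q = 1 ∧ c = ⟨Y.item (Y.N + 1) (p * g.reg 2 + q), Y.eps, Y.eps⟩)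
      (g.reg 0 * (g.reg 2 * 1)) (g.reg 0 * (g.reg 2 * (24 + 2) + 2 + 2) + 2) := by
  refine Prog.Gen.forLt (he.inp 0 (by decide)) he.r8 (by decide) (by decide) (by decide)
    (by simp [clauseRep]) ?_
  intro p hp m₁ hx₁ f₁
  have he₁ : Env g m₁ := he.frame f₁ (by decide) (by decide)
  have hs₁ : HasSys g Y m₁ := hs.frame f₁ (by decide) (by decide)
  refine Prog.Gen.forLt (he₁.inp 2 (by decide)) he₁.r8 (by decide) (by decide) (by decide)
    (by simp [clauseRep]) ?_
  intro q hq m₂ hx₂ f₂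
  have he₂ : Env g m₂ := he₁.frame f₂ (by decide) (by decide)
  have hs₂ : HasSys g Y m₂ := hs₁.frame f₂ (by decide) (by decide)
  have h21 : m₂.reg 21 = p := (f₂.reg 21 (by decide)).trans hx₁
  have e := he₂.inpArr
  simp only [List.forall_mem_cons, List.not_mem_nil, IsEmpty.forall_iff, implies_true,
    and_true] at e
  refine Prog.Gen.pre (c := 2) (c' := 22) (R := fun m => m.reg 33 = g.arr 2 p ∧
    m.reg 34 = g.arr 7 q)
    (Prog.WP.run (p := .block [.load 33 2 21, .load 34 7 22]) (by simp [Prog.block, Prog.LoopFree])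
      (by simp [Prog.block, Prog.run, e, h21, hx₂]))
    ⟨by simp [clauseRep, Prog.block, Prog.regs], by simp [clauseRep, Prog.block, Prog.arrs]⟩
    fun m₃ f₃ r => ?_
  have he₃ : Env g m₃ := he₂.frame f₃ (by decide) (by decide)
  have hs₃ : HasSys g Y m₃ := hs₂.frame f₃ (by decide) (by decide)
  refine Prog.Gen.ite (c := 21) (fun hb => Prog.Gen.ite (c := 20) (fun hb' => ?_) fun hb' => ?_)
    fun hb => ?_
  · have h1 : g.arr 2 p = 1 := by simpa [Test.Holds, r.1, he₃.r8] using hb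
    have h2 : g.arr 7 q = 1 := by simpa [Test.Holds, r.2, he₃.r8] using hb'
    have row := hs₃.row he₃ (x := Y.N + 1) (by simp [RecSys.nn])
    rw [hs.N] at row
    have h21' : m₃.reg 21 = p := (f₃.reg 21 (by decide)).trans h21
    have h22' : m₃.reg 22 = q := (f₃.reg 22 (by decide)).trans hx₂
    refine Prog.Gen.pre (c := 6) (c' := 14) (R := fun m =>
      m.reg 50 = Y.item (Y.N + 1) (p * g.reg 2 + q) ∧ m.reg 51 = Y.eps ∧ m.reg 52 = Y.eps)
      (Prog.WP.run (p := .block [.load 35 16 21, .add 35 35 22, .load 50 17 10, .add 50 50 35,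
        .move 51 13, .move 52 13]) (by simp [Prog.block, Prog.LoopFree]) ?_)
      ⟨by simp [clauseRep, Prog.block, Prog.regs], by simp [clauseRep, Prog.block, Prog.arrs]⟩
      fun m₄ f₄ r => ?_
    · simp [Prog.block, Prog.run, he₃.r10, row, item, hs.N, hs₃.eps he₃, h21', h22',
        he₃.arr16 p hp]
    · exact (gen_addClause (c := ⟨Y.item (Y.N + 1) (p * g.reg 2 + q), Y.eps, Y.eps⟩)
        ((f₄.reg 8 (by decide)).trans he₃.r8) r.1 r.2.1 r.2.2).mono le_rfl le_rfl
        fun a => by simp [h1, h2]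
  · have h2 : g.arr 7 q ≠ 1 := by simpa [Test.Holds, r.2, he₃.r8] using hb'
    exact Prog.Gen.skip (by simp [h2]) (by norm_num)
  · have h1 : g.arr 2 p ≠ 1 := by simpa [Test.Holds, r.1, he₃.r8] using hb
    exact Prog.Gen.skip (by simp [h1]) (by norm_num)

def transClauses : Prog :=
  .forLt 21 12 (.seq (.block [.load 33 17 21, .add 50 33 21, .move 51 13, .move 52 13])
    (.seq addClause (.forLt 22 12 (.seq (.block [.load 34 17 22, .add 35 33 22])
      (.forLt 23 12 (.seq (.block [.add 50 33 23, .move 51 35, .add 52 34 23]) addClause))))))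

/-- The three nested loops are the source of the term `n_s³ n_i³`. -/
theorem gen_transClauses {g m : Store} {Y : RecSys} (he : Env g m) (hs : HasSys g Y m) :
    Prog.Gen clauseRep transClauses m (fun c => ∃ x < Y.nn, c = ⟨Y.item x x, Y.eps, Y.eps⟩ ∨
      ∃ y < Y.nn, ∃ z < Y.nn, c = ⟨Y.item x z, Y.item x y, Y.item y z⟩)
      (Y.nn * (1 + Y.nn * (Y.nn * 1)))
      (Y.nn * (4 + (14 + (Y.nn * (2 + (Y.nn * (17 + 2) + 2) + 2) + 2)) + 2) + 2) := by
  refine Prog.Gen.forLt (he.r12.trans hs.nn.symm) he.r8 (by decide) (by decide) (by decide)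
    (by simp [clauseRep]) ?_
  intro x hx m₁ hx₁ f₁
  have he₁ : Env g m₁ := he.frame f₁ (by decide) (by decide)
  have hs₁ : HasSys g Y m₁ := hs.frame f₁ (by decide) (by decide)
  refine Prog.Gen.pre (c := 4) (R := fun m => m.reg 33 = x * Y.nn ∧ m.reg 50 = Y.item x x ∧
    m.reg 51 = Y.eps ∧ m.reg 52 = Y.eps)
    (Prog.WP.run (p := .block [.load 33 17 21, .add 50 33 21, .move 51 13, .move 52 13])
      (by simp [Prog.block, Prog.LoopFree])
      (by simp [Prog.block, Prog.run, hx₁, hs₁.row he₁ hx, hs₁.eps he₁, item]))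
    ⟨by simp [clauseRep, Prog.block, Prog.regs], by simp [clauseRep, Prog.block, Prog.arrs]⟩
    fun m₂ f₂ r₂ => ?_
  have he₂ : Env g m₂ := he₁.frame f₂ (by decide) (by decide)
  have hs₂ : HasSys g Y m₂ := hs₁.frame f₂ (by decide) (by decide)
  refine (gen_addClause (c := ⟨Y.item x x, Y.eps, Y.eps⟩) he₂.r8 r₂.2.1 r₂.2.2.1 r₂.2.2.2).seq
    fun m₃ f₃ => ?_
  have he₃ : Env g m₃ := he₂.frame f₃ (by decide) (by decide)
  have hs₃ : HasSys g Y m₃ := hs₂.frame f₃ (by decide) (by decide)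
  refine Prog.Gen.forLt (he₃.r12.trans hs.nn.symm) he₃.r8 (by decide) (by decide) (by decide)
    (by simp [clauseRep]) ?_
  intro y hy m₄ hx₄ f₄
  have he₄ : Env g m₄ := he₃.frame f₄ (by decide) (by decide)
  have hs₄ : HasSys g Y m₄ := hs₃.frame f₄ (by decide) (by decide)
  have h33 : m₄.reg 33 = x * Y.nn := by
    rw [f₄.reg 33 (by decide), f₃.reg 33 (by decide), r₂.1]
  refine Prog.Gen.pre (c := 2) (R := fun m => m.reg 34 = y * Y.nn ∧ m.reg 35 = Y.item x y)
    (Prog.WP.run (p := .block [.load 34 17 22, .add 35 33 22]) (by simp [Prog.block, Prog.LoopFree])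
      (by simp [Prog.block, Prog.run, hx₄, hs₄.row he₄ hy, h33, item]))
    ⟨by simp [clauseRep, Prog.block, Prog.regs], by simp [clauseRep, Prog.block, Prog.arrs]⟩
    fun m₅ f₅ r₅ => ?_
  have he₅ : Env g m₅ := he₄.frame f₅ (by decide) (by decide)
  refine Prog.Gen.forLt (he₅.r12.trans hs.nn.symm) he₅.r8 (by decide) (by decide) (by decide)
    (by simp [clauseRep]) ?_
  intro z hz m₆ hx₆ f₆
  have he₆ : Env g m₆ := he₅.frame f₆ (by decide) (by decide)
  have h33' : m₆.reg 33 = x * Y.nn := by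
    rw [f₆.reg 33 (by decide), f₅.reg 33 (by decide), h33]
  have h34 : m₆.reg 34 = y * Y.nn := (f₆.reg 34 (by decide)).trans r₅.1
  have h35 : m₆.reg 35 = Y.item x y := (f₆.reg 35 (by decide)).trans r₅.2
  refine Prog.Gen.pre (c := 3) (c' := 14) (R := fun m => m.reg 50 = Y.item x z ∧
    m.reg 51 = Y.item x y ∧ m.reg 52 = Y.item y z)
    (Prog.WP.run (p := .block [.add 50 33 23, .move 51 35, .add 52 34 23])
      (by simp [Prog.block, Prog.LoopFree])
      (by simp [Prog.block, Prog.run, hx₆, h33', h34, h35, item]))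
    ⟨by simp [clauseRep, Prog.block, Prog.regs], by simp [clauseRep, Prog.block, Prog.arrs]⟩
    fun m₇ f₇ r₇ => gen_addClause ((f₇.reg 8 (by decide)).trans he₆.r8) r₇.1 r₇.2.1 r₇.2.2

/-- Reads the record in register 21, and looks for the source from which it is applied. -/
def readRec : Prog :=
  .block [.load 25 20 21, .load 26 21 21, .load 27 22 21, .load 28 23 21, .load 29 24 21,
    .load 30 25 21, .const 31 0, .const 33 2,
    .ite (.eq 25 33) (.block [.move 32 26, .const 31 1])
      (.ite (.eq 25 7) (.block [.move 32 11, .const 31 1])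
        (.ite (.eq 25 8) (.ite (.eq 29 8) (.ite (.eq 30 8)
          (.block [.move 32 10, .const 31 1]) .skip) .skip) .skip))]

structure HasRec (r : Rec) (m : Store) : Prop where
  r25 : m.reg 25 = r.kind
  r26 : m.reg 26 = r.src
  r27 : m.reg 27 = r.tgt
  r28 : m.reg 28 = r.lit
  r29 : m.reg 29 = r.zs
  r30 : m.reg 30 = r.zi

theorem HasRec.frame {r : Rec} {m m' : Store} {p : Prog} (h : HasRec r m) (hf : Prog.Frame p m m')
    (hp : ∀ x ∈ [25, 26, 27, 28, 29, 30], x ∉ p.regs) : HasRec r m' :=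
  ⟨(hf.reg 25 (hp _ (by decide))).trans h.r25, (hf.reg 26 (hp _ (by decide))).trans h.r26,
    (hf.reg 27 (hp _ (by decide))).trans h.r27, (hf.reg 28 (hp _ (by decide))).trans h.r28,
    (hf.reg 29 (hp _ (by decide))).trans h.r29, (hf.reg 30 (hp _ (by decide))).trans h.r30⟩

/-- The kind of a record admits at most one alternative of `SingleSource`, so a flag in register 31
and one value in register 32 suffice. -/
theorem wp_readRec {g m : Store} {Y : RecSys} {t : ℕ} (he : Env g m) (hs : HasSys g Y m)
    (h21 : m.reg 21 = t) : Prog.WP readRec m 23 fun m' => HasRec (Y.tr t) m' ∧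
      (m'.reg 31 = 1 ∧ (∀ u, Y.SingleSource (Y.tr t) u ↔ u = m'.reg 32) ∨
        m'.reg 31 = 0 ∧ ∀ u, ¬ Y.SingleSource (Y.tr t) u) := by
  have hr := hs.tr t
  have e20 : m.arr 20 t = (Y.tr t).kind := by rw [← hr]; rfl
  have e21 : m.arr 21 t = (Y.tr t).src := by rw [← hr]; rfl
  have e22 : m.arr 22 t = (Y.tr t).tgt := by rw [← hr]; rfl
  have e23 : m.arr 23 t = (Y.tr t).lit := by rw [← hr]; rfl
  have e24 : m.arr 24 t = (Y.tr t).zs := by rw [← hr]; rfl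
  have e25 : m.arr 25 t = (Y.tr t).zi := by rw [← hr]; rfl
  refine (Prog.WP.run (p := readRec) (by simp [readRec, Prog.block, Prog.LoopFree]) ?_).mono
    (by decide) fun _ _ h => h
  have e11 : m.reg 11 = Y.N + 2 := by rw [he.r11, hs.N]
  have e10 : m.reg 10 = Y.N + 1 := by rw [he.r10, hs.N]
  generalize Y.tr t = r at *
  have main : ∀ m' : Store, readRec.run m = m' → HasRec r m' ∧
      (m'.reg 31 = 1 ∧ (∀ u, Y.SingleSource r u ↔ u = m'.reg 32) ∨
        m'.reg 31 = 0 ∧ ∀ u, ¬ Y.SingleSource r u) := by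
    intro m' hm'
    simp only [readRec, Prog.block, Prog.run, Store.setReg_reg, Store.setReg_arr, h21, e20,
      he.r7, he.r8] at hm'
    by_cases k2 : r.kind = 2
    · simp [k2] at hm'
      subst hm'
      exact ⟨by constructor <;> simp [e21, e22, e23, e24, e25, k2],
        .inl ⟨by simp, by simp [SingleSource, k2, e21]⟩⟩
    by_cases k0 : r.kind = 0
    · simp [k0] at hm'
      subst hm'
      exact ⟨by constructor <;> simp [e21, e22, e23, e24, e25, k0],
        .inl ⟨by simp, by simp [SingleSource, k0, e11]⟩⟩
    by_cases k1 : r.kind = 1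
    · by_cases z1 : r.zs = 1
      · by_cases z2 : r.zi = 1
        · simp only [k1, if_true] at hm'
          subst hm'
          exact ⟨by constructor <;> simp [e21, e22, e23, e24, e25, k1, z1, z2],
            .inl ⟨by simp [e24, e25, z1, z2], by simp [SingleSource, k1, z1, z2, e10, e24, e25]⟩⟩
        · simp only [k1, if_true] at hm'
          subst hm'
          exact ⟨by constructor <;> simp [e21, e22, e23, e24, e25, k1, z1, z2],
            .inr ⟨by simp [e24, e25, z1, z2], by simp [SingleSource, k1, z2]⟩⟩
      · simp only [k1, if_true] at hm'
        subst hm'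
        exact ⟨by constructor <;> simp [e21, e22, e23, e24, e25, k1, z1],
          .inr ⟨by simp [e24, e25, z1], by simp [SingleSource, k1, z1]⟩⟩
    · simp [k0, k1, k2] at hm'
      subst hm'
      exact ⟨by constructor <;> simp [e21, e22, e23, e24, e25],
        .inr ⟨by simp, by simp [SingleSource, k0, k1, k2]⟩⟩
  exact main _ rfl

def singleClause : Prog :=
  .ite (.eq 31 8) (.seq (.block [.load 34 17 32, .add 50 34 27, .add 51 34 26, .move 52 28])
    addClause) .skip

theorem gen_singleClause {g m : Store} {Y : RecSys} {t : ℕ} (he : Env g m) (hs : HasSys g Y m)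
    (hv : Y.Valid) (ht : t < Y.T) (hr : HasRec (Y.tr t) m)
    (h : m.reg 31 = 1 ∧ (∀ u, Y.SingleSource (Y.tr t) u ↔ u = m.reg 32) ∨
        m.reg 31 = 0 ∧ ∀ u, ¬ Y.SingleSource (Y.tr t) u) :
    Prog.Gen clauseRep singleClause m (fun c => ∃ u, Y.SingleSource (Y.tr t) u ∧
      c = ⟨Y.item u (Y.tr t).tgt, Y.item u (Y.tr t).src, (Y.tr t).lit⟩) 1 19 := by
  refine Prog.Gen.ite (c := 18) (fun hb => ?_) fun hb => ?_
  · rcases h with ⟨-, h⟩ | ⟨h, -⟩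
    · have hlt : m.reg 32 < Y.nn := by
        have := hv.src_lt t ht
        rcases (h _).mpr rfl with ⟨-, h⟩ | ⟨-, h⟩ | ⟨-, -, -, h⟩ <;> rw [h] <;>
          simp only [RecSys.nn] <;> omega
      refine Prog.Gen.pre (c := 4) (c' := 14) (R := fun m' =>
        m'.reg 50 = Y.item (m.reg 32) (Y.tr t).tgt ∧ m'.reg 51 = Y.item (m.reg 32) (Y.tr t).src ∧
        m'.reg 52 = (Y.tr t).lit)
        (Prog.WP.run (p := .block [.load 34 17 32, .add 50 34 27, .add 51 34 26, .move 52 28])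
          (by simp [Prog.block, Prog.LoopFree])
          (by simp [Prog.block, Prog.run, hs.row he hlt, hr.r26, hr.r27, hr.r28, item]))
        ⟨by simp [clauseRep, Prog.block, Prog.regs], by simp [clauseRep, Prog.block, Prog.arrs]⟩
        fun m₁ f₁ r₁ => ?_
      exact (gen_addClause (c := ⟨Y.item (m.reg 32) (Y.tr t).tgt, Y.item (m.reg 32) (Y.tr t).src,
        (Y.tr t).lit⟩) ((f₁.reg 8 (by decide)).trans he.r8) r₁.1 r₁.2.1 r₁.2.2).mono le_rfl le_rfl
        fun c => by simp [h]
    · simp [Test.Holds, h, he.r8] at hb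
  · rcases h with ⟨h, -⟩ | ⟨-, h⟩
    · simp [Test.Holds, h, he.r8] at hb
    · exact Prog.Gen.skip (by simp [h]) (by norm_num)

/-- The clauses for the record read last, as a push, and the record in register 22. -/
def matchClauses : Prog :=
  .seq (.block [.load 35 20 22, .load 36 21 22, .load 37 22 22, .load 38 23 22, .load 39 24 22,
    .load 40 25 22, .load 41 26 22]) (.ite (.eq 35 8) (.ite (.eq 39 29) (.ite (.eq 40 30)
      (.seq (.block [.add 50 41 27, .load 42 17 27, .add 51 42 36, .move 52 38]) (.seq addClause
        (.seq (.block [.load 42 17 26, .add 50 42 37, .move 51 28, .add 52 41 27]) addClause)))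
      .skip) .skip) .skip)

def RecSys.MatchClause (Y : RecSys) (t t' : ℕ) (c : Clause) : Prop :=
  c = ⟨Y.mid t' (Y.tr t).tgt, Y.item (Y.tr t).tgt (Y.tr t').src, (Y.tr t').lit⟩ ∨
    c = ⟨Y.item (Y.tr t).src (Y.tr t').tgt, (Y.tr t).lit, Y.mid t' (Y.tr t).tgt⟩

theorem gen_matchClauses {g m : Store} {Y : RecSys} {t t' : ℕ} (he : Env g m) (hs : HasSys g Y m)
    (hv : Y.Valid) (ht : t < Y.T) (ht' : t' < Y.T) (hr : HasRec (Y.tr t) m) (h22 : m.reg 22 = t')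
    (hk : (Y.tr t).kind = 0) :
    Prog.Gen clauseRep matchClauses m (fun c => Match (Y.tr t) (Y.tr t') ∧ Y.MatchClause t t' c)
      2 46 := by
  have hrt := hs.tr t'
  have e20 : m.arr 20 t' = (Y.tr t').kind := by rw [← hrt]; rfl
  have e21 : m.arr 21 t' = (Y.tr t').src := by rw [← hrt]; rfl
  have e22 : m.arr 22 t' = (Y.tr t').tgt := by rw [← hrt]; rfl
  have e23 : m.arr 23 t' = (Y.tr t').lit := by rw [← hrt]; rfl
  have e24 : m.arr 24 t' = (Y.tr t').zs := by rw [← hrt]; rfl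
  have e25 : m.arr 25 t' = (Y.tr t').zi := by rw [← hrt]; rfl
  have e26 := hs.base t' ht'
  refine Prog.Gen.pre (c := 7) (c' := 39) (R := fun m => m.reg 35 = (Y.tr t').kind ∧
    m.reg 36 = (Y.tr t').src ∧ m.reg 37 = (Y.tr t').tgt ∧ m.reg 38 = (Y.tr t').lit ∧
    m.reg 39 = (Y.tr t').zs ∧ m.reg 40 = (Y.tr t').zi ∧ m.reg 41 = Y.base + t' * Y.nn)
    (Prog.WP.run (p := .block [.load 35 20 22, .load 36 21 22, .load 37 22 22, .load 38 23 22,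
      .load 39 24 22, .load 40 25 22, .load 41 26 22]) (by simp [Prog.block, Prog.LoopFree])
      (by simp [Prog.block, Prog.run, h22, e20, e21, e22, e23, e24, e25, e26]))
    ⟨by simp [clauseRep, Prog.block, Prog.regs], by simp [clauseRep, Prog.block, Prog.arrs]⟩
    fun m₁ f₁ r => ?_
  obtain ⟨r35, r36, r37, r38, r39, r40, r41⟩ := r
  have he₁ : Env g m₁ := he.frame f₁ (by decide) (by decide)
  have hs₁ : HasSys g Y m₁ := hs.frame f₁ (by decide) (by decide)
  have hr₁ : HasRec (Y.tr t) m₁ := hr.frame f₁ (by decide)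
  have hsrc := hv.src_lt t ht
  have htgt := hv.tgt_le t ht
  have hnn : Y.nn = Y.N + 3 := rfl
  refine Prog.Gen.ite (c := 38) (fun hb1 => Prog.Gen.ite (c := 37) (fun hb2 =>
    Prog.Gen.ite (c := 36) (fun hb3 => ?_) fun hb3 => ?_) fun hb2 => ?_) fun hb1 => ?_
  · have hM : Match (Y.tr t) (Y.tr t') := by
      simp only [Test.Holds, r35, r39, r40, he₁.r8, hr₁.r29, hr₁.r30] at hb1 hb2 hb3
      exact ⟨hk, hb1, hb2.symm, hb3.symm⟩
    refine (Prog.Gen.pre (c := 4) (c' := 32) (d := 2) (R := fun m =>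
      m.reg 50 = Y.mid t' (Y.tr t).tgt ∧ m.reg 51 = Y.item (Y.tr t).tgt (Y.tr t').src ∧
      m.reg 52 = (Y.tr t').lit)
      (Prog.WP.run (p := .block [.add 50 41 27, .load 42 17 27, .add 51 42 36, .move 52 38])
        (by simp [Prog.block, Prog.LoopFree]) (by
          simp [Prog.block, Prog.run, r41, r36, r38, hr₁.r27, item, mid,
            hs₁.row he₁ (show (Y.tr t).tgt < Y.nn by omega)]))
      ⟨by simp [clauseRep, Prog.block, Prog.regs], by simp [clauseRep, Prog.block, Prog.arrs]⟩
      fun m₂ f₂ r₂ => (gen_addClause (c := ⟨Y.mid t' (Y.tr t).tgt,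
        Y.item (Y.tr t).tgt (Y.tr t').src, (Y.tr t').lit⟩) ((f₂.reg 8 (by decide)).trans he₁.r8)
        r₂.1 r₂.2.1 r₂.2.2).seq (d' := 1) (c' := 18) (G' := fun c => c =
          ⟨Y.item (Y.tr t).src (Y.tr t').tgt, (Y.tr t).lit, Y.mid t' (Y.tr t).tgt⟩)
        fun m₃ f₃ => ?_).mono le_rfl le_rfl
      fun c => by simp only [hM, MatchClause, true_and]
    have he₃ : Env g m₃ := (he₁.frame f₂ (by decide) (by decide)).frame f₃ (by decide) (by decide)
    have hs₃ : HasSys g Y m₃ :=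
      (hs₁.frame f₂ (by decide) (by decide)).frame f₃ (by decide) (by decide)
    have hr₃ : HasRec (Y.tr t) m₃ := (hr₁.frame f₂ (by decide)).frame f₃ (by decide)
    have r37' : m₃.reg 37 = (Y.tr t').tgt := by
      rw [f₃.reg 37 (by decide), f₂.reg 37 (by decide), r37]
    have r41' : m₃.reg 41 = Y.base + t' * Y.nn := by
      rw [f₃.reg 41 (by decide), f₂.reg 41 (by decide), r41]
    refine Prog.Gen.pre (c := 4) (c' := 14) (R := fun m =>
      m.reg 50 = Y.item (Y.tr t).src (Y.tr t').tgt ∧ m.reg 51 = (Y.tr t).lit ∧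
      m.reg 52 = Y.mid t' (Y.tr t).tgt)
      (Prog.WP.run (p := .block [.load 42 17 26, .add 50 42 37, .move 51 28, .add 52 41 27])
        (by simp [Prog.block, Prog.LoopFree]) (by
          simp [Prog.block, Prog.run, r41', r37', hr₃.r26, hr₃.r27, hr₃.r28, item, mid,
            hs₃.row he₃ (show (Y.tr t).src < Y.nn by omega)]))
      ⟨by simp [clauseRep, Prog.block, Prog.regs], by simp [clauseRep, Prog.block, Prog.arrs]⟩
      fun m₄ f₄ r₄ => gen_addClause ((f₄.reg 8 (by decide)).trans he₃.r8) r₄.1 r₄.2.1 r₄.2.2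
  · have : (Y.tr t').zi ≠ (Y.tr t).zi := by simpa [Test.Holds, r40, hr₁.r30] using hb3
    exact Prog.Gen.skip (by simp [Match, this.symm]) (by norm_num)
  · have : (Y.tr t').zs ≠ (Y.tr t).zs := by simpa [Test.Holds, r39, hr₁.r29] using hb2
    exact Prog.Gen.skip (by simp [Match, this.symm]) (by norm_num)
  · have : (Y.tr t').kind ≠ 1 := by simpa [Test.Holds, r35, he₁.r8] using hb1
    exact Prog.Gen.skip (by simp [Match, this]) (by norm_num)

def recordClauses : Prog :=
  .forLt 21 15 (.seq readRec (.seq singleClause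
    (.ite (.eq 25 7) (.forLt 22 15 matchClauses) .skip)))

/-- Comparing all pairs of a push and another record is quadratic in the number of records, which is
the source of the term `n_s² m_s⁴ m_i²`. -/
theorem gen_recordClauses {g m : Store} {Y : RecSys} (he : Env g m) (hs : HasSys g Y m)
    (hv : Y.Valid) : Prog.Gen clauseRep recordClauses m (fun c => ∃ t < Y.T,
      (∃ u, Y.SingleSource (Y.tr t) u ∧
        c = ⟨Y.item u (Y.tr t).tgt, Y.item u (Y.tr t).src, (Y.tr t).lit⟩) ∨
      ∃ t' < Y.T, Match (Y.tr t) (Y.tr t') ∧ Y.MatchClause t t' c)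
      (Y.T * (1 + Y.T * 2)) (Y.T * (23 + (19 + ((Y.T * (46 + 2) + 2) + 1)) + 2) + 2) := by
  refine Prog.Gen.forLt hs.r15 he.r8 (by decide) (by decide) (by decide) (by simp [clauseRep]) ?_
  intro t ht m₁ hx₁ f₁
  have he₁ : Env g m₁ := he.frame f₁ (by decide) (by decide)
  have hs₁ : HasSys g Y m₁ := hs.frame f₁ (by decide) (by decide)
  refine Prog.Gen.pre (wp_readRec he₁ hs₁ hx₁)
    ⟨by simp [clauseRep, readRec, Prog.block, Prog.regs],
      by simp [clauseRep, readRec, Prog.block, Prog.arrs]⟩ fun m₂ f₂ r₂ => ?_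
  have he₂ : Env g m₂ := he₁.frame f₂ (by decide) (by decide)
  have hs₂ : HasSys g Y m₂ := hs₁.frame f₂ (by decide) (by decide)
  refine (gen_singleClause he₂ hs₂ hv ht r₂.1 r₂.2).seq fun m₃ f₃ => ?_
  have he₃ : Env g m₃ := he₂.frame f₃ (by decide) (by decide)
  have hs₃ : HasSys g Y m₃ := hs₂.frame f₃ (by decide) (by decide)
  have hr₃ : HasRec (Y.tr t) m₃ := r₂.1.frame f₃ (by decide)
  refine Prog.Gen.ite (fun hb => ?_) fun hb => ?_
  · have hk : (Y.tr t).kind = 0 := by simpa [Test.Holds, hr₃.r25, he₃.r7] using hb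
    refine Prog.Gen.forLt hs₃.r15 he₃.r8 (by decide) (by decide) (by decide)
      (by simp [clauseRep]) ?_
    intro t' ht' m₄ hx₄ f₄
    exact gen_matchClauses (he₃.frame f₄ (by decide) (by decide))
      (hs₃.frame f₄ (by decide) (by decide)) hv ht ht' (hr₃.frame f₄ (by decide)) hx₄ hk
  · have hk : (Y.tr t).kind ≠ 0 := by simpa [Test.Holds, hr₃.r25, he₃.r7] using hb
    exact Prog.Gen.skip (by simp [Match, hk]) (by omega)

def clauses : Prog := .seq startClause (.seq initClauses (.seq transClauses recordClauses))

theorem gen_clauses {g m : Store} {Y : RecSys} (he : Env g m) (hs : HasSys g Y m)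
    (hv : Y.Valid) (hi : ∀ x, Y.init x ↔ ∃ p < g.reg 0, ∃ q < g.reg 2, g.arr 2 p = 1 ∧
      g.arr 7 q = 1 ∧ x = p * g.reg 2 + q) :
    Prog.Gen clauseRep clauses m Y.IsClause
      (1 + (g.reg 0 * (g.reg 2 * 1) + (Y.nn * (1 + Y.nn * (Y.nn * 1)) + Y.T * (1 + Y.T * 2))))
      (18 + ((g.reg 0 * (g.reg 2 * (24 + 2) + 2 + 2) + 2) +
        ((Y.nn * (4 + (14 + (Y.nn * (2 + (Y.nn * (17 + 2) + 2) + 2) + 2)) + 2) + 2) +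
          (Y.T * (23 + (19 + ((Y.T * (46 + 2) + 2) + 1)) + 2) + 2)))) := by
  refine ((gen_startClause he hs).seq fun m₁ f₁ =>
    (gen_initClauses (he.frame f₁ (by decide) (by decide))
      (hs.frame f₁ (by decide) (by decide))).seq fun m₂ f₂ =>
    (gen_transClauses ((he.frame f₁ (by decide) (by decide)).frame f₂ (by decide) (by decide))
      ((hs.frame f₁ (by decide) (by decide)).frame f₂ (by decide) (by decide))).seq fun m₃ f₃ =>
    gen_recordClauses (((he.frame f₁ (by decide) (by decide)).frame f₂ (by decide)
      (by decide)).frame f₃ (by decide) (by decide))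
      (((hs.frame f₁ (by decide) (by decide)).frame f₂ (by decide) (by decide)).frame f₃ (by decide)
        (by decide)) hv).mono le_rfl le_rfl fun c => ?_
  constructor
  · rintro (rfl | ⟨p, hp, q, hq, h1, h2, rfl⟩ | ⟨x, hx, rfl | ⟨y, hy, z, hz, rfl⟩⟩ |
      ⟨t, ht, ⟨u, hu, rfl⟩ | ⟨t', ht', hM, rfl | rfl⟩⟩)
    · exact .start
    · exact .init _ ((hi _).mpr ⟨p, hp, q, hq, h1, h2, rfl⟩)
    · exact .refl x hx
    · exact .trans x y z hx hy hz
    · exact .single t u ht hu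
    · exact .inner t t' ht ht' hM
    · exact .outer t t' ht ht' hM
  · intro h
    cases h with
    | start => exact .inl rfl
    | refl x hx => exact .inr (.inr (.inl ⟨x, hx, .inl rfl⟩))
    | init x hx =>
      obtain ⟨p, hp, q, hq, h1, h2, rfl⟩ := (hi x).mp hx
      exact .inr (.inl ⟨p, hp, q, hq, h1, h2, rfl⟩)
    | trans x y z hx hy hz => exact .inr (.inr (.inl ⟨x, hx, .inr ⟨y, hy, z, hz, rfl⟩⟩))
    | single t u ht hu => exact .inr (.inr (.inr ⟨t, ht, .inl ⟨u, hu, rfl⟩⟩))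
    | inner t t' ht ht' hM =>
      exact .inr (.inr (.inr ⟨t, ht, .inr ⟨t', ht', hM, .inl rfl⟩⟩))
    | outer t t' ht ht' hM =>
      exact .inr (.inr (.inr ⟨t, ht, .inr ⟨t', ht', hM, .inr rfl⟩⟩))

/-! ## The procedure: letters, saturation and verdict -/

open RecSys

/-- The item of the empty word needs no rule to be written: its entry in array 12 is still 0. -/
def initLetters : Prog := .block [.const 66 0, .store 19 66 13, .store 18 13 8, .const 18 1]

/-- Only letters on transitions of `I` are entered, so the size of the alphabet does not affect the
time. The code 0 of the internal action gives the item of the empty word, which is already marked.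
-/
def letterRules : Prog :=
  .forLt 21 3 (.seq (.block [.load 27 9 21, .add 60 13 27, .load 63 18 60]) (.ite (.lt 63 8)
    (.block [.store 18 60 8, .const 66 1, .store 12 60 66, .sub 66 27 8, .store 13 60 66,
      .store 19 18 60, .add 18 18 8]) .skip))

/-- Starts the search with the items of the empty word and of the letters. -/
def letters : Prog := .seq initLetters letterRules

theorem wp_letters {g m : Store} {Y : RecSys} (he : Env g m) (hs : HasSys g Y m)
    (hL : ∀ i < g.reg 3, g.arr 9 i ≤ Y.nL) (h12 : ∀ j, m.arr 12 j = 0) (h18 : ∀ j, m.arr 18 j = 0) :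
    Prog.WP letters m (g.reg 3 * 13 + 6) fun m' => ∃ q, m'.Found Y.Sem q ∧ Y.eps ∈ q ∧
      (∀ i < g.reg 3, Y.eps + g.arr 9 i ∈ q) ∧ q.length ≤ g.reg 3 + 1 := by
  have h1 : Prog.WP initLetters m 4 fun m' => m'.Found Y.Sem [Y.eps] := by
    refine Prog.WP.run (p := initLetters) (by simp [initLetters, Prog.block, Prog.LoopFree]) ?_
    have e13 := hs.eps he
    have e12 : (initLetters.run m).arr 12 Y.eps = 0 := by
      simp [initLetters, Prog.block, Prog.run, h12]
    refine ⟨by simp [initLetters, Prog.block, Prog.run], ?_, by simp, fun i => ?_, ?_⟩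
    · intro j hj
      obtain rfl : j = 0 := by simpa using hj
      simp [initLetters, Prog.block, Prog.run, e13]
    · simp [initLetters, Prog.block, Prog.run, e13, he.r8, h18]
    · intro i hi
      obtain rfl : i = Y.eps := by simpa using hi
      refine ⟨[], .empty (by simp) e12, ?_⟩
      have := Sem.lit (Y := Y) (a := Y.eps) le_rfl (by unfold base; omega)
      rwa [word_eps] at this
  refine (h1.seq (c₂ := g.reg 3 * (11 + 2) + 2) fun m₁ f₁ h => ?_).mono (by omega) fun _ _ h => h
  have he₁ : Env g m₁ := he.frame f₁ (by decide) (by decide)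
  have hs₁ : HasSys g Y m₁ := hs.frame f₁ (by decide) (by decide)
  refine Prog.wp_forLt (fun n m' => ∃ q, m'.Found Y.Sem q ∧ Y.eps ∈ q ∧
      (∀ i < n, Y.eps + g.arr 9 i ∈ q) ∧ q.length ≤ n + 1)
    (he₁.inp 3 (by decide)) he₁.r8 (by decide) (by decide) (by decide) ?_ ⟨_, h, by simp⟩ ?_
  · rintro i m' v ⟨q, hq, h⟩
    exact ⟨q, hq.congr (by simp) (by simp), h⟩
  · rintro i hi m₂ hx f₂ ⟨q, hq, heq, hall, hlen⟩
    have he₂ : Env g m₂ := he₁.frame f₂ (by decide) (by decide)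
    have hs₂ : HasSys g Y m₂ := hs₁.frame f₂ (by decide) (by decide)
    have e13 := hs₂.eps he₂
    have e9 := he₂.inpArr 9 (by decide)
    refine (Prog.WP.run (p := .block [.load 27 9 21, .add 60 13 27, .load 63 18 60])
      (Q := fun m' => m'.reg 27 = g.arr 9 i ∧ m'.reg 60 = Y.eps + g.arr 9 i ∧
        m'.reg 63 = m₂.arr 18 (Y.eps + g.arr 9 i)) (by simp [Prog.block, Prog.LoopFree])
      (by simp [Prog.block, Prog.run, hx, e9, e13])).seq (c₂ := 8) fun m₃ f₃ r => ?_
    have he₃ : Env g m₃ := he₂.frame f₃ (by decide) (by decide)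
    have a3 : ∀ a, m₃.arr a = m₂.arr a := fun a => f₃.arr a (by simp [Prog.block, Prog.arrs])
    have hq₃ : m₃.Found Y.Sem q := hq.congr (f₃.reg 18 (by decide)) fun a _ => a3 a
    have hall' : ∀ q' : List ℕ, q ⊆ q' → Y.eps + g.arr 9 i ∈ q' →
        ∀ j < i + 1, Y.eps + g.arr 9 j ∈ q' := by
      intro q' hsub hmem j hj
      rcases Nat.lt_succ_iff_lt_or_eq.mp hj with hj | rfl
      · exact hsub (hall j hj)
      · exact hmem
    refine Prog.WP.ite (c := 7) (fun hb => ?_) fun hb => ?_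
    · have hnot : Y.eps + g.arr 9 i ∉ q := by
        intro hmem
        simp [Test.Holds, r.2.2, he₃.r8, hq.mark, hmem] at hb
      have ha : 1 ≤ g.arr 9 i := by
        by_contra h0
        exact hnot (by rwa [show g.arr 9 i = 0 by omega])
      refine Prog.WP.run (p := .block [.store 18 60 8, .const 66 1, .store 12 60 66, .sub 66 27 8,
        .store 13 60 66, .store 19 18 60, .add 18 18 8]) (by simp [Prog.block, Prog.LoopFree])
        ⟨q ++ [Y.eps + g.arr 9 i], hq₃.push hnot ?_ ?_ ?_ ?_ ?_, ?_, hall' _ (by simp) (by simp), ?_⟩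
      · simp [Prog.block, Prog.run, he₃.r8]
      · intro j; simp [Prog.block, Prog.run, r.2.1]
      · intro j; simp [Prog.block, Prog.run, r.2.1, he₃.r8]
      · intro j hj; simp [Prog.block, Prog.run, r.2.1, hj]
      · intro _
        have hlt : Y.eps + g.arr 9 i < Y.base := by
          have := hL i hi
          unfold base; omega
        have hw := Sem.lit (Y := Y) (Nat.le_add_right Y.eps (g.arr 9 i)) hlt
        have e : Y.word (Y.eps + g.arr 9 i) = [g.arr 9 i - 1] := by
          rw [word, if_neg (by omega), Nat.add_sub_cancel_left]
        rw [e] at hw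
        refine ⟨_, ?_, hw⟩
        have hd := Store.DerivesIn.letter (m := (Prog.block [.store 18 60 8, .const 66 1,
          .store 12 60 66, .sub 66 27 8, .store 13 60 66, .store 19 18 60, .add 18 18 8]).run m₃)
          (T := (· ∈ q ++ [Y.eps + g.arr 9 i])) (i := Y.eps + g.arr 9 i) (by simp)
          (by simp [Prog.block, Prog.run, r.2.1])
        convert hd using 2
        simp [Prog.block, Prog.run, r.2.1, r.1, he₃.r8]
      · exact List.mem_append_left _ heq
      · simpa using hlen
    · have hmem : Y.eps + g.arr 9 i ∈ q := by
        by_contra hnot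
        simp [Test.Holds, r.2.2, he₃.r8, hq.mark, hnot] at hb
      exact ⟨1, m₃, .skip _, by omega, q, hq₃, heq, hall' q (fun _ h => h) hmem, by omega⟩

/-- The pair of `N + 2` and the sink is both the item to be tested and the start symbol of the
grammar. -/
def verdict : Prog := .block [.load 1 17 11, .add 1 1 9, .load 30 18 1, .sub 0 8 30]

theorem wp_verdict {g m : Store} {Y : RecSys} {q : List ℕ} (he : Env g m) (hN : Y.N = g.pairs)
    (hq : m.Found Y.Sem q) : Prog.WP verdict m 4 fun m' =>
      m'.reg 1 = Y.item (Y.N + 2) Y.N ∧ m'.Found Y.Sem q ∧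
      m'.reg 0 = if Y.item (Y.N + 2) Y.N ∈ q then 0 else 1 := by
  refine Prog.WP.run (p := verdict) (by simp [verdict, Prog.block, Prog.LoopFree]) ?_
  have e : m.arr 17 (g.pairs + 2) + g.pairs = Y.item (Y.N + 2) Y.N := by
    rw [he.arr17 _ (by omega), item, nn, hN]
  refine ⟨?_, hq.congr ?_ fun a _ => ?_, ?_⟩
  · simp [verdict, Prog.block, Prog.run, he.r11, he.r9, e]
  · simp [verdict, Prog.block, Prog.run]
  · simp [verdict, Prog.block, Prog.run]
  · simp only [verdict, Prog.block, Prog.run, Store.setReg_reg, Store.setReg_arr]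
    simp [he.r11, he.r9, e, he.r8, hq.mark]
    split <;> rfl

/-! ### The whole decision procedure. -/

def check : Prog :=
  .seq setup (.seq records (.seq clauses (.seq letters (.seq saturate verdict))))

/-- The number of records is at most `g.maxRecords`. -/
def Store.maxRecords (g : Store) : ℕ := g.reg 3 * (g.reg 1 + g.reg 0 * (g.reg 1 + 1))

/-- The number of clauses for `T` records is at most `g.maxClauses T`. -/
def Store.maxClauses (g : Store) (T : ℕ) : ℕ :=
  1 + (g.reg 0 * (g.reg 2 * 1) + ((g.pairs + 3) * (1 + (g.pairs + 3) * ((g.pairs + 3) * 1)) +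
    T * (1 + T * 2)))

/-- The bounds of the phases, bracketed as `WP.seq` adds them. -/
def Store.maxSteps (g : Store) : ℕ :=
  (4 * g.reg 0 + 4 * g.pairs + 24) +
    ((g.reg 3 * ((10 + ((g.reg 1 * 21 + 2) +
        (g.reg 0 * (((g.reg 1 + 1) * (g.reg 1 * 14 + 21) + 18) + 2) + 2))) + 2) + 2) +
      ((18 + ((g.reg 0 * (g.reg 2 * (24 + 2) + 2 + 2) + 2) +
        (((g.pairs + 3) * (4 + (14 + ((g.pairs + 3) * (2 + ((g.pairs + 3) * (17 + 2) + 2) + 2) + 2))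
            + 2) + 2) +
          (g.maxRecords * (23 + (19 + ((g.maxRecords * (46 + 2) + 2) + 1)) + 2) + 2)))) +
        ((g.reg 3 * 13 + 6) +
          ((5 * (g.reg 3 + 1) + 39 * g.maxClauses g.maxRecords + 1) + 4))))

theorem Store.maxClauses_mono (g : Store) {T T' : ℕ} (h : T ≤ T') :
    g.maxClauses T ≤ g.maxClauses T' := by
  unfold Store.maxClauses; gcongr

/-- The procedure saturates the clauses of the product. -/
theorem wp_check {g : Store} (hg : g.Blank)
    (hst : ∀ j < g.reg 1, g.arr 3 j < g.reg 0 ∧ g.arr 6 j < g.reg 0)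
    (hL : ∀ i < g.reg 3, g.arr 9 i ≤ g.reg 4)
    (hV : ∀ Y : RecSys, Y.N = g.pairs → Y.nL = g.reg 4 →
      (∀ x, Y.init x ↔ ∃ p < g.reg 0, ∃ q < g.reg 2, g.arr 2 p = 1 ∧ g.arr 7 q = 1 ∧
        x = p * g.reg 2 + q) → (∀ r, (∃ t < Y.T, Y.tr t = r) ↔ g.HasRecord r) → Y.Valid) :
    Prog.WP check g g.maxSteps fun m => ∃ (Y : RecSys) (q : List ℕ), Y.N = g.pairs ∧
      Y.nL = g.reg 4 ∧ (∀ x, Y.init x ↔ ∃ p < g.reg 0, ∃ q < g.reg 2, g.arr 2 p = 1 ∧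
        g.arr 7 q = 1 ∧ x = p * g.reg 2 + q) ∧
      (∀ r, (∃ t < Y.T, Y.tr t = r) ↔ g.HasRecord r) ∧
      m.reg 1 = Y.item (Y.N + 2) Y.N ∧ m.Found Y.Sem q ∧
      (m.reg 0 = if Y.item (Y.N + 2) Y.N ∈ q then 0 else 1) ∧ Y.eps ∈ q ∧
      (∀ i < g.reg 3, Y.eps + g.arr 9 i ∈ q) ∧
      ∀ c, Y.IsClause c → c.left ∈ q → c.right ∈ q → c.head ∈ q := by
  refine (wp_setup hg).seq fun m₁ f₁ ⟨he₁, h16⟩ => ?_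
  have hrec : (recRep (g.epsItem + g.reg 4 + 1) (g.pairs + 3)).rep (fun _ => False) 0 m₁ := by
    have : m₁.reg 15 = 0 := (f₁.reg 15 (by decide)).trans (hg.reg 15 (by decide))
    refine ⟨this.le, ?_, ?_, ?_⟩
    · rw [this, h16, Store.epsItem]; ring
    · simp [this]
    · simp [this]
  refine (gen_records he₁ hst _ _ hrec).seq fun m₂ f₂ h₂ => ?_
  have he₂ : Env g m₂ := he₁.frame f₂ (by decide) (by decide)
  obtain ⟨hT, -, hrecs, hbase⟩ := h₂
  -- The system is read off the memory, in the order in which the records happen to lie there.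
  let Y : RecSys := ⟨g.pairs, g.reg 4, m₂.reg 15, fun x => ∃ p < g.reg 0, ∃ q < g.reg 2,
    g.arr 2 p = 1 ∧ g.arr 7 q = 1 ∧ x = p * g.reg 2 + q, m₂.recAt⟩
  have hY : ∀ r, (∃ t < Y.T, Y.tr t = r) ↔ g.HasRecord r := fun r => by
    simpa only [false_or] using (hrecs r).symm
  have hv : Y.Valid := hV Y rfl rfl (fun _ => Iff.rfl) hY
  have hs₂ : HasSys g Y m₂ := ⟨rfl, rfl, fun _ => rfl, hbase⟩
  have hT' : Y.T ≤ g.maxRecords := by simpa [Store.maxRecords] using hT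
  have hcl : clauseRep.rep (fun _ => False) 0 m₂ := by
    refine ⟨[], by simp, le_rfl, fun i => ?_⟩
    show m₂.arr 31 i = 0
    rw [f₂.arr 31 (by decide), f₁.arr 31 (by decide), hg.arr 31 (by decide)]
  -- The actual number of records is known only at run time; in the step bound it is replaced by its
  -- maximum.
  refine (((gen_clauses he₂ hs₂ hv fun _ => Iff.rfl).mono (d' := g.maxClauses Y.T)
    (c' := 18 + ((g.reg 0 * (g.reg 2 * (24 + 2) + 2 + 2) + 2) +
        (((g.pairs + 3) * (4 + (14 + ((g.pairs + 3) * (2 + ((g.pairs + 3) * (17 + 2) + 2) + 2) + 2))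
            + 2) + 2) +
          (g.maxRecords * (23 + (19 + ((g.maxRecords * (46 + 2) + 2) + 1)) + 2) + 2))))
    le_rfl ?_ fun _ => Iff.rfl) _ _ hcl).seq fun m₃ f₃ h₃ => ?_
  · have : Y.nn = g.pairs + 3 := rfl
    rw [this]
    gcongr
  have he₃ : Env g m₃ := he₂.frame f₃ (by decide) (by decide)
  have hs₃ : HasSys g Y m₃ := hs₂.frame f₃ (by decide) (by decide)
  have hz : ∀ a ∈ [12, 18], ∀ j, m₃.arr a j = 0 := by
    intro a ha j
    rw [f₃.arr a (by revert a; decide), f₂.arr a (by revert a; decide),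
      f₁.arr a (by revert a; decide), hg.arr a (by revert a; decide)]
  refine (wp_letters he₃ hs₃ hL (hz 12 (by decide)) (hz 18 (by decide))).seq fun m₄ f₄ h₄ => ?_
  obtain ⟨q₀, hq₀, heps, hlit, hlen⟩ := h₄
  have he₄ : Env g m₄ := he₃.frame f₄ (by decide) (by decide)
  obtain ⟨E, hE, hElen, hch⟩ :=
    (show Prog.Indep clauseRep letters from ⟨by simp [clauseRep]; decide, by
      simp [clauseRep]; decide⟩).rep f₄ h₃
  have hE' : ∀ c, Y.IsClause c ↔ c ∈ E := fun c => by simpa only [false_or] using hE c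
  refine ((wp_saturate (q₀ := q₀) he₄.r7 he₄.r8 ?_
    (fun c hc u v hu hw => ((hE' c).mpr hc).sound hv hu hw) hch hq₀).mono ?_
      fun _ _ h => h).seq fun m₅ f₅ h₅ => ?_
  · rw [f₄.reg 17 (by decide), f₃.reg 17 (by decide), f₂.reg 17 (by decide), f₁.reg 17 (by decide),
      hg.reg 17 (by decide)]
  · have := g.maxClauses_mono hT'
    have : E.length ≤ g.maxClauses g.maxRecords := by
      rw [Nat.zero_add] at hElen
      exact hElen.trans this
    omega
  obtain ⟨q, hq, hpre, hclosed⟩ := h₅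
  refine (wp_verdict (he₄.frame f₅ (by decide) (by decide)) rfl hq).mono le_rfl fun m _ h => ?_
  exact ⟨Y, q, rfl, rfl, fun _ => Iff.rfl, hY, h.1, h.2.1, h.2.2, hpre.subset heps,
    fun i hi => hpre.subset (hlit i hi), fun c hc h1 h2 => hclosed c ((hE' c).mp hc) h1 h2⟩

/-! ## The input of the procedure -/

open RecSys IOVPTS

theorem listTable_of_getElem? {X : Type*} {l : List X} {f : X → ℕ} {j : ℕ} {t : X}
    (h : l[j]? = some t) : listTable l f j = f t := by
  simp [listTable, h]

theorem numTable_apply {X : Type*} [Fintype X] (e : X ≃ Fin (Fintype.card X)) (f : X → ℕ) (x : X) :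
    numTable e f (e x) = f x := by
  simp [numTable]

theorem actCode_injective {L : Type*} [Fintype L] (e : L ≃ Fin (Fintype.card L)) :
    Function.Injective (actCode e) := by
  rintro (_ | a) (_ | b) h
  · rfl
  · simp [actCode] at h
  · simp [actCode] at h
  · simp only [actCode, Nat.add_right_cancel_iff] at h
    rw [e.injective (Fin.ext h)]

namespace IOVPTS.Listing

variable {L Q Γ : Type*} {A : IOAlphabet L} [Fintype Q] [Fintype Γ] {V : IOVPTS A Q Γ}

theorem length_list (l : V.Listing) : l.list.length = V.trans.card := by
  classical
  rw [← List.toFinset_card_of_nodup l.nodup]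
  congr 1
  ext t
  rw [List.mem_toFinset, l.mem_list]

theorem exists_getElem? (l : V.Listing) {j : ℕ} (hj : j < V.trans.card) :
    ∃ t ∈ V.trans, l.list[j]? = some t := by
  rw [← l.length_list] at hj
  exact ⟨l.list[j], (l.mem_list _).mp (List.getElem_mem hj), List.getElem?_eq_getElem hj⟩

theorem exists_index (l : V.Listing) {t : Transition Q L Γ} (ht : t ∈ V.trans) :
    ∃ j < V.trans.card, l.list[j]? = some t := by
  obtain ⟨j, hj, h⟩ := List.mem_iff_getElem.mp ((l.mem_list t).mpr ht)
  exact ⟨j, l.length_list ▸ hj, by rw [List.getElem?_eq_getElem hj, h]⟩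

theorem exists_state (l : V.Listing) {p : ℕ} (hp : p < Fintype.card Q) :
    ∃ q : Q, (l.stateNum q : ℕ) = p :=
  ⟨l.stateNum.symm ⟨p, hp⟩, by simp⟩

end IOVPTS.Listing

theorem inputStore_blank {L Q₁ Γ₁ Q₂ Γ₂ : Type*} [Fintype L] [Fintype Q₁] [Fintype Γ₁]
    [Fintype Q₂] [Fintype Γ₂] {A : IOAlphabet L} {S : IOVPTS A Q₁ Γ₁} {I : IOVPTS A Q₂ Γ₂}
    (e : L ≃ Fin (Fintype.card L)) (lS : S.Listing) (lI : I.Listing) :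
    (inputStore e lS lI).Blank := by
  constructor
  · intro x hx
    obtain ⟨k, rfl⟩ := Nat.exists_eq_add_of_le' hx
    rfl
  · intro a ha j
    obtain ⟨k, rfl⟩ := Nat.exists_eq_add_of_le' ha
    rfl

section

variable {L Qs Γs Qi Γi : Type} [Fintype L] [Fintype Qs] [Fintype Γs] [Fintype Qi] [Fintype Γi]
  {A : IOAlphabet L} {S : IOVPTS A Qs Γs} {I : IOVPTS A Qi Γi}
  {e : L ≃ Fin (Fintype.card L)} {lS : S.Listing} {lI : I.Listing}

theorem inputStore_spec {j : ℕ} {t : Transition Qs L Γs} (h : lS.list[j]? = some t) :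
    (inputStore e lS lI).arr 3 j = lS.stateNum t.src ∧
    (inputStore e lS lI).arr 4 j = actCode e t.act ∧
    (inputStore e lS lI).arr 5 j = stackCode lS.stackNum t ∧
    (inputStore e lS lI).arr 6 j = lS.stateNum t.tgt :=
  ⟨listTable_of_getElem? h, listTable_of_getElem? h, listTable_of_getElem? h,
    listTable_of_getElem? h⟩

theorem inputStore_impl {j : ℕ} {u : Transition Qi L Γi} (h : lI.list[j]? = some u) :
    (inputStore e lS lI).arr 8 j = lI.stateNum u.src ∧
    (inputStore e lS lI).arr 9 j = actCode e u.act ∧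
    (inputStore e lS lI).arr 10 j = stackCode lI.stackNum u ∧
    (inputStore e lS lI).arr 11 j = lI.stateNum u.tgt :=
  ⟨listTable_of_getElem? h, listTable_of_getElem? h, listTable_of_getElem? h,
    listTable_of_getElem? h⟩

theorem inputStore_kindOf (x : Option L) :
    (inputStore e lS lI).kindOf (actCode e x) = kindCode A x := by
  cases x with
  | none => rfl
  | some a => exact numTable_apply e (fun a => (A.kind a).code) a

theorem inputStore_dir (a : L) :
    (inputStore e lS lI).arr 1 (actCode e (some a) - 1) = 1 ↔ A.dir a = .output := by
  have : (inputStore e lS lI).arr 1 (actCode e (some a) - 1) = (A.dir a).code :=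
    numTable_apply e (fun a => (A.dir a).code) a
  rw [this]
  cases A.dir a <;> simp [Direction.code]

theorem inputStore_refuses {i : ℕ} {u : Transition Qi L Γi} (hu : lI.list[i]? = some u) {ℓ : L}
    (hact : u.act = some ℓ) (p : Qs) (z : ℕ) :
    ¬ (inputStore e lS lI).Accepts i (lS.stateNum p) z ((inputStore e lS lI).reg 1) ↔
      Refuses lS p ℓ z := by
  have hk : (inputStore e lS lI).kindOf ((inputStore e lS lI).arr 9 i) = 1 ↔ A.kind ℓ = .ret := by
    rw [(inputStore_impl hu).2.1, inputStore_kindOf, hact, kindCode]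
    cases A.kind ℓ <;> simp [ActionKind.code]
  rw [Store.Accepts, hk]
  constructor
  · intro h t ht h1 h2
    obtain ⟨j, hj, hget⟩ := lS.exists_index ht
    obtain ⟨r3, r4, r5, -⟩ := inputStore_spec (e := e) (lI := lI) hget
    by_contra hcon
    refine h ⟨j, hj, by rw [r3, h1], by rw [r4, (inputStore_impl hu).2.1, h2, hact], fun hr => ?_⟩
    rw [r5]
    by_contra hz
    exact hcon ⟨hr, hz⟩
  · rintro h ⟨j, hj, h1, h2, h3⟩
    obtain ⟨t, ht, hget⟩ := lS.exists_getElem? (show j < S.trans.card from hj)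
    obtain ⟨r3, r4, r5, -⟩ := inputStore_spec (e := e) (lI := lI) hget
    rw [r3] at h1
    rw [r4, (inputStore_impl hu).2.1] at h2
    obtain ⟨hr, hz⟩ := h t ht (lS.stateNum.injective (Fin.ext h1))
      ((actCode_injective e h2).trans hact)
    exact hz (r5 ▸ h3 hr)

/-- The entry 0 of simple transitions is among the candidates too. It does no harm: on a return
symbol it matches no reachable joint stack, and otherwise `z` plays no role. -/
theorem inputStore_entry (z : ℕ) :
    (∃ j < (inputStore e lS lI).reg 1 + 1, (inputStore e lS lI).entry j = z) ↔
      z = 1 ∨ ∃ t ∈ S.trans, stackCode lS.stackNum t = z := by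
  have h1 : (inputStore e lS lI).reg 1 = S.trans.card := rfl
  rw [h1]
  constructor
  · rintro ⟨j, hj, rfl⟩
    rcases Nat.lt_succ_iff_lt_or_eq.mp hj with hj | rfl
    · obtain ⟨t, ht, hget⟩ := lS.exists_getElem? hj
      refine .inr ⟨t, ht, ?_⟩
      rw [Store.entry, h1, if_neg hj.ne, (inputStore_spec hget).2.2.1]
    · exact .inl (by rw [Store.entry, h1, if_pos rfl])
  · rintro (rfl | ⟨t, ht, rfl⟩)
    · exact ⟨S.trans.card, Nat.lt_succ_self _, by rw [Store.entry, h1, if_pos rfl]⟩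
    · obtain ⟨j, hj, hget⟩ := lS.exists_index ht
      exact ⟨j, by omega, by rw [Store.entry, h1, if_neg hj.ne, (inputStore_spec hget).2.2.1]⟩

theorem inputStore_recBoth {i j : ℕ} {t : Transition Qs L Γs} {u : Transition Qi L Γi}
    (ht : lS.list[j]? = some t) (hu : lI.list[i]? = some u) :
    (inputStore e lS lI).recBoth i j = ⟨kindCode A u.act, pairCode lS lI t.src u.src,
        pairCode lS lI t.tgt u.tgt, (inputStore e lS lI).epsItem + actCode e u.act,
        stackCode lS.stackNum t, stackCode lI.stackNum u⟩ := by
  obtain ⟨r3, r4, r5, r6⟩ := inputStore_spec (e := e) (lI := lI) ht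
  obtain ⟨r8, r9, r10, r11⟩ := inputStore_impl (e := e) (lS := lS) hu
  rw [Store.recBoth, r3, r5, r6, r8, r9, r10, r11, inputStore_kindOf]
  rfl

theorem inputStore_recInternal {i : ℕ} {u : Transition Qi L Γi}
    (hu : lI.list[i]? = some u) (hact : u.act = none) (p : Qs) :
    (inputStore e lS lI).recInternal i (lS.stateNum p) = ⟨2, pairCode lS lI p u.src,
      pairCode lS lI p u.tgt, (inputStore e lS lI).epsItem, 0, stackCode lI.stackNum u⟩ := by
  obtain ⟨r8, r9, r10, r11⟩ := inputStore_impl (e := e) (lS := lS) hu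
  rw [Store.recInternal, r8, r9, r10, r11, hact]
  rfl

theorem inputStore_recRefused {i : ℕ} {u : Transition Qi L Γi} {ℓ : L}
    (hu : lI.list[i]? = some u) (hact : u.act = some ℓ) (p : Qs) (z : ℕ) :
    (inputStore e lS lI).recRefused i (lS.stateNum p) z =
      ⟨if (A.kind ℓ).code = 1 then 1 else 2, pairCode lS lI p u.src, (inputStore e lS lI).pairs,
        (inputStore e lS lI).epsItem + actCode e (some ℓ), z, stackCode lI.stackNum u⟩ := by
  obtain ⟨r8, r9, r10, r11⟩ := inputStore_impl (e := e) (lS := lS) hu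
  rw [Store.recRefused, r8, r9, r10, inputStore_kindOf, hact]
  rfl

theorem inputStore_hasRecord (r : Rec) : (inputStore e lS lI).HasRecord r ↔
    IsRecord e lS lI (inputStore e lS lI).pairs (inputStore e lS lI).epsItem r := by
  constructor
  · rintro ⟨i, hi, h⟩
    obtain ⟨u, hu, hgu⟩ := lI.exists_getElem? (show i < I.trans.card from hi)
    have r9 := (inputStore_impl (e := e) (lS := lS) hgu).2.1
    rcases h with ⟨j, hj, h1, rfl⟩ | ⟨p, hp, h⟩
    · obtain ⟨t, ht, hgt⟩ := lS.exists_getElem? (show j < S.trans.card from hj)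
      rw [inputStore_recBoth hgt hgu]
      rw [(inputStore_spec hgt).2.1, r9] at h1
      exact .both t u ht hu (actCode_injective e h1)
    · obtain ⟨s, rfl⟩ := lS.exists_state (show p < Fintype.card Qs from hp)
      rcases h with ⟨h1, rfl⟩ | ⟨h1, h2, j, hj, h3, rfl⟩
      · have hact : u.act = none := actCode_injective e (r9.symm.trans h1)
        rw [inputStore_recInternal hgu hact]
        exact .internal s u hu hact
      · obtain ⟨ℓ, hact⟩ : ∃ ℓ, u.act = some ℓ := by
          cases h : u.act with
          | none => rw [r9, h] at h1; exact (h1 rfl).elim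
          | some ℓ => exact ⟨ℓ, rfl⟩
        rw [inputStore_recRefused hgu hact]
        rw [r9, hact, inputStore_dir] at h2
        exact .refused s u ℓ _ hu hact h2 (inputStore_entry (e := e) (lI := lI) _ |>.mp
          ⟨j, hj, rfl⟩) ((inputStore_refuses hgu hact s _).mp h3)
  · intro h
    cases h with
    | both t u ht hu htu =>
      obtain ⟨j, hj, hgt⟩ := lS.exists_index ht
      obtain ⟨i, hi, hgu⟩ := lI.exists_index hu
      refine ⟨i, hi, .inl ⟨j, hj, ?_, (inputStore_recBoth hgt hgu).symm⟩⟩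
      rw [(inputStore_spec hgt).2.1, (inputStore_impl hgu).2.1, htu]
    | internal p u hu hact =>
      obtain ⟨i, hi, hgu⟩ := lI.exists_index hu
      refine ⟨i, hi, .inr ⟨lS.stateNum p, (lS.stateNum p).isLt,
        .inl ⟨?_, (inputStore_recInternal hgu hact p).symm⟩⟩⟩
      rw [(inputStore_impl hgu).2.1, hact]; rfl
    | refused p u ℓ z hu hact hdir hz href =>
      obtain ⟨i, hi, hgu⟩ := lI.exists_index hu
      obtain ⟨j, hj, rfl⟩ := (inputStore_entry (e := e) (lI := lI) z).mpr hz
      have r9 := (inputStore_impl (e := e) (lS := lS) hgu).2.1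
      rw [hact] at r9
      refine ⟨i, hi, .inr ⟨lS.stateNum p, (lS.stateNum p).isLt, .inr ⟨?_, ?_, j, hj, ?_,
        (inputStore_recRefused hgu hact p _).symm⟩⟩⟩
      · rw [r9]; simp [actCode]
      · rw [r9]; exact (inputStore_dir ℓ).mpr hdir
      · exact (inputStore_refuses hgu hact p _).mpr href

theorem inputStore_init (x : ℕ) :
    (∃ p < (inputStore e lS lI).reg 0, ∃ q < (inputStore e lS lI).reg 2,
      (inputStore e lS lI).arr 2 p = 1 ∧ (inputStore e lS lI).arr 7 q = 1 ∧
        x = p * (inputStore e lS lI).reg 2 + q) ↔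
      ∃ p ∈ S.init, ∃ q ∈ I.init, x = pairCode lS lI p q := by
  classical
  have h2 : ∀ p, (inputStore e lS lI).arr 2 (lS.stateNum p) = 1 ↔ p ∈ S.init := fun p => by
    refine (iff_of_eq (congrArg (· = 1)
      (numTable_apply lS.stateNum (fun q => if q ∈ S.init then 1 else 0) p))).trans ?_
    split_ifs with h <;> simp [h]
  have h7 : ∀ p, (inputStore e lS lI).arr 7 (lI.stateNum p) = 1 ↔ p ∈ I.init := fun p => by
    refine (iff_of_eq (congrArg (· = 1)
      (numTable_apply lI.stateNum (fun q => if q ∈ I.init then 1 else 0) p))).trans ?_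
    split_ifs with h <;> simp [h]
  constructor
  · rintro ⟨p, hp, q, hq, hp', hq', rfl⟩
    obtain ⟨s, rfl⟩ := lS.exists_state (show p < Fintype.card Qs from hp)
    obtain ⟨s', rfl⟩ := lI.exists_state (show q < Fintype.card Qi from hq)
    exact ⟨s, (h2 s).mp hp', s', (h7 s').mp hq', rfl⟩
  · rintro ⟨p, hp, q, hq, rfl⟩
    exact ⟨lS.stateNum p, (lS.stateNum p).isLt, lI.stateNum q, (lI.stateNum q).isLt,
      (h2 p).mpr hp, (h7 q).mpr hq, rfl⟩

theorem inputStore_isProduct {Y : RecSys} (hN : Y.N = (inputStore e lS lI).pairs)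
    (hL : Y.nL = (inputStore e lS lI).reg 4)
    (hi : ∀ x, Y.init x ↔ ∃ p < (inputStore e lS lI).reg 0, ∃ q < (inputStore e lS lI).reg 2,
      (inputStore e lS lI).arr 2 p = 1 ∧ (inputStore e lS lI).arr 7 q = 1 ∧
        x = p * (inputStore e lS lI).reg 2 + q)
    (ht : ∀ r, (∃ t < Y.T, Y.tr t = r) ↔ (inputStore e lS lI).HasRecord r) :
    IsProduct e lS lI Y where
  N := hN
  nL := hL
  init x := (hi x).trans (inputStore_init x)
  tr r := by
    rw [ht, inputStore_hasRecord, hN]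
    have : (inputStore e lS lI).epsItem = Y.eps := by rw [eps, nn, hN]; rfl
    rw [this]

/-- `I` takes part in every joint move, so the letters on its transitions are the only ones that the
clauses need. -/
theorem inputStore_lit {Y : RecSys} (hY : IsProduct e lS lI Y) {t : ℕ} (ht : t < Y.T) :
    ∃ i < (inputStore e lS lI).reg 3, (Y.tr t).lit = Y.eps + (inputStore e lS lI).arr 9 i := by
  have h := (hY.tr _).mp ⟨t, ht, rfl⟩
  suffices ∃ u ∈ I.trans, (Y.tr t).lit = Y.eps + actCode e u.act by
    obtain ⟨u, hu, hlit⟩ := this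
    obtain ⟨i, hi, hgu⟩ := lI.exists_index hu
    exact ⟨i, hi, by rw [hlit, (inputStore_impl hgu).2.1]⟩
  generalize Y.tr t = r at h
  cases h with
  | both t u ht hu htu => exact ⟨u, hu, rfl⟩
  | internal p u hu hact => exact ⟨u, hu, by rw [hact]; rfl⟩
  | refused p u ℓ z hu hact => exact ⟨u, hu, by rw [hact]⟩

/-- The verdict of the procedure, and the grammar it leaves in memory. -/
theorem wp_check_inputStore (hS : S.Deterministic) (e : L ≃ Fin (Fintype.card L)) (lS : S.Listing)
    (lI : I.Listing) : Prog.WP check (inputStore e lS lI) (inputStore e lS lI).maxSteps fun m =>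
      (I.IocoLike S → m.reg 0 = 1) ∧ (¬ I.IocoLike S → m.reg 0 = 0 ∧ ∃ w : List L,
        I.IsWitness S w ∧ m.Derives (m.reg 1) (w.map fun a => (e a : ℕ))) := by
  refine (wp_check (inputStore_blank e lS lI) (fun j hj => ?_) (fun i hi => ?_)
    fun Y h1 h2 h3 h4 => (inputStore_isProduct h1 h2 h3 h4).valid).mono le_rfl ?_
  · obtain ⟨t, ht, hget⟩ := lS.exists_getElem? (show j < S.trans.card from hj)
    obtain ⟨r3, r4, r5, r6⟩ := inputStore_spec (e := e) (lI := lI) hget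
    rw [r3, r6]
    exact ⟨(lS.stateNum t.src).isLt, (lS.stateNum t.tgt).isLt⟩
  · obtain ⟨u, hu, hget⟩ := lI.exists_getElem? (show i < I.trans.card from hi)
    rw [(inputStore_impl hget).2.1]
    exact actCode_le u.act
  · rintro m - ⟨Y, q, h1, h2, h3, h4, r1, hq, r0, heps, hlit, hcl⟩
    have hY := inputStore_isProduct h1 h2 h3 h4
    have hfail : Y.item (Y.N + 2) Y.N ∈ q → ∃ w : List L,
        I.IsWitness S w ∧ m.Derives (m.reg 1) (w.map fun a => (e a : ℕ)) := by
      intro hmem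
      obtain ⟨w, hd, hsem⟩ := hq.sound _ hmem
      -- The word derived in memory belongs to a run into the sink, which makes this very word a
      -- witness.
      obtain ⟨x, γ, hx, hr⟩ :=
        (hsem.of_item rfl (by simp [nn]) (by simp [nn])).of_eq_top rfl le_rfl
      obtain ⟨v, hv, rfl⟩ := hY.witness_of_reads hS hx hr
      exact ⟨v, hv, r1 ▸ hd.derives⟩
    refine ⟨fun hio => ?_, fun hio => ?_⟩
    · rw [r0, if_neg]
      intro hmem
      obtain ⟨w, hw, -⟩ := hfail hmem
      exact hw.not_iocoLike hio
    · obtain ⟨x, w, γ, hx, hr⟩ := hY.reads_of_not_iocoLike hS hio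
      have hmem : Y.item (Y.N + 2) Y.N ∈ q := by
        -- The final queue is closed under the clauses, which is all that completeness asks for.
        refine hr.derivable hY.valid (q := (· ∈ q)) heps (fun t ht => ?_) hcl hx le_rfl
        obtain ⟨i, hi, h⟩ := inputStore_lit hY ht
        rw [h]
        exact hlit i hi
      exact ⟨by rw [r0, if_pos hmem], hfail hmem⟩

end

/-! ## The number of steps -/

/-- In terms of `N = n_s n_i` and `X = n_s m_s² m_i` the target is `N ^ 3 + X ^ 2`. Since `n_s`,
`n_i` and `m_s` are positive, smaller monomials are absorbed into powers of `N` or `X`, and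
constants into `N ^ 3 ≥ 1`, also when `X = 0`. The factor 100000 is generous. -/
theorem Store.maxSteps_le (g : Store) (h0 : 1 ≤ g.reg 0) (h1 : 1 ≤ g.reg 1) (h2 : 1 ≤ g.reg 2) :
    g.maxSteps ≤ 100000 * (g.reg 0 ^ 3 * g.reg 2 ^ 3 + g.reg 0 ^ 2 * g.reg 1 ^ 4 * g.reg 3 ^ 2) := by
  set a := g.reg 0
  set b := g.reg 1
  set c := g.reg 2
  set d := g.reg 3
  obtain ⟨N, hN⟩ : ∃ N, N = a * c := ⟨_, rfl⟩
  obtain ⟨X, hX⟩ : ∃ X, X = a * b ^ 2 * d := ⟨_, rfl⟩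
  have e : a ^ 3 * c ^ 3 + a ^ 2 * b ^ 4 * d ^ 2 = N ^ 3 + X ^ 2 := by rw [hN, hX]; ring
  have hN1 : 1 ≤ N := hN ▸ Nat.mul_pos h0 h2
  have ha : a ≤ N := hN ▸ Nat.le_mul_of_pos_right a h2
  have hd : d ≤ X := by
    rw [hX]; exact Nat.le_mul_of_pos_left d (by positivity)
  have hdb : d * b ≤ X := by
    calc d * b = 1 * (b * 1) * d := by ring
      _ ≤ a * (b * b) * d := by gcongr
      _ = X := by rw [hX]; ring
  have had : d * a ≤ X := by
    calc d * a = a * (1 * 1) * d := by ring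
      _ ≤ a * (b * b) * d := by gcongr
      _ = X := by rw [hX]; ring
  have hdab : d * (a * b) ≤ X := by
    calc d * (a * b) = a * (b * 1) * d := by ring
      _ ≤ a * (b * b) * d := by gcongr
      _ = X := by rw [hX]; ring
  have hdabb : d * (a * (b * b)) = X := by rw [hX]; ring
  have hN3 : N ≤ N ^ 3 := Nat.le_self_pow (by norm_num) N
  have hN2 : N ^ 2 ≤ N ^ 3 := Nat.pow_le_pow_right hN1 (by norm_num)
  have hX2 : X ≤ X ^ 2 := Nat.le_self_pow (by norm_num) X
  have hT : g.maxRecords ≤ 3 * X := by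
    have : g.maxRecords = d * b + d * (a * b) + d * a := by
      simp only [Store.maxRecords]; ring
    omega
  have hpairs : g.pairs = N := hN.symm
  have hN0 : 1 ≤ N ^ 3 := Nat.one_le_pow _ _ hN1
  have hmC : g.maxClauses g.maxRecords ≤ 100 * (N ^ 3 + X ^ 2) := by
    calc g.maxClauses g.maxRecords ≤ g.maxClauses (3 * X) := g.maxClauses_mono hT
      _ = 1 + (N + ((N + 3) * (1 + (N + 3) * ((N + 3) * 1)) + 3 * X * (1 + 3 * X * 2))) := by
        simp only [Store.maxClauses, hpairs]
        rw [hN]; ring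
      _ = N ^ 3 + 9 * N ^ 2 + 29 * N + 31 + 18 * X ^ 2 + 3 * X := by ring
      _ ≤ _ := by omega
  have hrec : d * ((10 + ((b * 21 + 2) + (a * (((b + 1) * (b * 14 + 21) + 18) + 2) + 2))) + 2) + 2
      ≤ 200 * X + 2 := by
    have : d * ((10 + ((b * 21 + 2) + (a * (((b + 1) * (b * 14 + 21) + 18) + 2) + 2))) + 2) + 2 =
      16 * d + 21 * (d * b) + 14 * (d * (a * (b * b))) + 35 * (d * (a * b)) + 41 * (d * a) + 2 := by
      ring
    omega
  have hcl : (18 + ((a * (c * (24 + 2) + 2 + 2) + 2) +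
        (((g.pairs + 3) * (4 + (14 + ((g.pairs + 3) * (2 + ((g.pairs + 3) * (17 + 2) + 2) + 2) + 2))
            + 2) + 2) +
          (g.maxRecords * (23 + (19 + ((g.maxRecords * (46 + 2) + 2) + 1)) + 2) + 2))))
      ≤ 3000 * (N ^ 3 + X ^ 2) := by
    calc _ ≤ (18 + ((a * (c * (24 + 2) + 2 + 2) + 2) +
          (((N + 3) * (4 + (14 + ((N + 3) * (2 + ((N + 3) * (17 + 2) + 2) + 2) + 2)) + 2) + 2) +
          ((3 * X) * (23 + (19 + (((3 * X) * (46 + 2) + 2) + 1)) + 2) + 2)))) := by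
            rw [hpairs]; gcongr
      _ = 26 * N + 4 * a + (19 * N ^ 3 + 177 * N ^ 2 + 571 * N) + 657 + 432 * X ^ 2 + 141 * X := by
            rw [hN]; ring
      _ ≤ _ := by omega
  rw [e]
  calc g.maxSteps ≤ (4 * a + 4 * N + 24) + ((200 * X + 2) + (3000 * (N ^ 3 + X ^ 2) +
        ((d * 13 + 6) + ((5 * (d + 1) + 39 * (100 * (N ^ 3 + X ^ 2)) + 1) + 4)))) := by
        refine Nat.add_le_add (by rw [hpairs]) (Nat.add_le_add hrec (Nat.add_le_add hcl
          (Nat.add_le_add le_rfl (Nat.add_le_add ?_ le_rfl))))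
        gcongr
    _ ≤ _ := by omega

/-- A single procedure, `check` followed by `write`. The part `check` halts within the stated number
of steps, with the verdict in register 0 and, if conformance fails, a straight-line grammar for a
witness string whose start symbol is in register 1. In that case the part `write` then spells the
witness out in array 15, its length being in register 0. -/
theorem mainTheorem1 :
    ∃ (check write : Prog) (C : ℕ),
      ∀ (L Qs Γs Qi Γi : Type) [Fintype L] [Fintype Qs] [Fintype Γs] [Fintype Qi] [Fintype Γi]
        [Nonempty Qs] [Nonempty Qi] (A : IOAlphabet L)
        (S : IOVPTS A Qs Γs) (I : IOVPTS A Qi Γi),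
        S.Deterministic → 1 ≤ S.trans.card →
        ∀ (e : L ≃ Fin (Fintype.card L)) (lS : S.Listing) (lI : I.Listing),
          ∃ (t : ℕ) (m : Store),
            Exec check (inputStore e lS lI) t m ∧
            t ≤ C * (Fintype.card Qs ^ 3 * Fintype.card Qi ^ 3 +
              Fintype.card Qs ^ 2 * S.trans.card ^ 4 * I.trans.card ^ 2) ∧
            (I.IocoLike S → m.reg 0 = 1) ∧
            (¬ I.IocoLike S →
              m.reg 0 = 0 ∧
              ∃ w : List L, I.IsWitness S w ∧
                m.Derives (m.reg 1) (w.map fun a => (e a : ℕ)) ∧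
                ∃ (t' : ℕ) (m' : Store), Exec write m t' m' ∧
                  (List.range (m'.reg 0)).map (m'.arr 15) = w.map fun a => (e a : ℕ)) := by
  refine ⟨check, writeOut, 100000, ?_⟩
  intro L Qs Γs Qi Γi _ _ _ _ _ _ _ A S I hS hcard e lS lI
  obtain ⟨t, m, h1, h2, h3, h4⟩ := wp_check_inputStore hS e lS lI
  refine ⟨t, m, h1, h2.trans ((inputStore e lS lI).maxSteps_le Fintype.card_pos hcard
    Fintype.card_pos), h3, fun hio => ?_⟩
  obtain ⟨h5, w, h6, h7⟩ := h4 hio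
  obtain ⟨t', m', h8, h9⟩ := h7.writeOut
  exact ⟨h5, w, h6, h7, t', m', h8, h9⟩
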